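/- **Setting.** Let $\nu$ be a measure on $\mathbb{R}$ such that $\int e^{\theta y}\,d\nu(y)<\infty$ for all $\theta\in\mathbb{R}$ and such that $\nu$ is not concentrated on one point (in particular $\nu\neq 0$). Put $b(\theta)=\log\int e^{\theta y}\,d\nu(y)$, so that $p_\theta(y)=e^{y\theta-b(\theta)}$, $\theta\in\mathbb{R}$, is a natural exponential family of densities with respect to $\nu$. For every sample size $n$ let $p=p_n\ge 1$ be an integer, $\phi^*=\phi^*_n\in\mathbb{R}^p$ a true parameter with support $J^*=\{j:\phi^*_j\ne0\}$, and let $(X_{1},Y_1),\dots,(X_{n},Y_n)$ be i.i.d. with $X_i=(X_{i1},\dots,X_{ip})\in\mathbb{R}^p$ random and, given $X_i$, $Y_i$ distributed with density $p_{\theta_i}$, $\theta_i=X_i^T\phi^*$. The law of $X_1$ may depend on $n$. For $J\subset[p]=\{1,\dots,p\}$ and $\phi_J\in\mathbb{R}^J$ write $X_{iJ}=(X_{ij})_{j\in J}$, $$L(\phi_J)=\exp\Big\{\sum_{i=1}^n \big(Y_iX_{iJ}^T\phi_J-b(X_{iJ}^T\phi_J)\big)\Big\},\qquad H_J(\phi_J)=-\nabla^2\log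 L(\phi_J),$$ let $\hat\phi_J$ be the maximizer of $L$ over $\mathbb{R}^J$, and for prior weights $P(J)\ge0$ and prior densities $f_J$ on $\mathbb{R}^J$ let $\mathrm{Bayes}(J)=P(J)\int_{\mathbb{R}^J}L(\phi_J)f_J(\phi_J)\,d\phi_J$. For $\gamma\ge 0$, $\mathrm{Bayes}_\gamma$ is $\mathrm{Bayes}$ with $P(J)=\binom{p}{|J|}^{-\gamma}\mathbf 1\{|J|\le q\}$, and $\mathrm{BIC}_\gamma(J)=-2\log L(\hat\phi_J)+|J|\log n+2\gamma|J|\log p$. Let $\kappa_n=\log_n(p_n)$ and $\kappa=\limsup_n\kappa_n\in[0,\infty]$. Write $a=b(1\pm c)$ for $a\in[b(1-c),b(1+c)]$, and $\preceq$ for the Loewner order. **Assumptions.** Let $q\ge0$ be an integer and $a_1,a_2,a_3>0$ constants. * (B1) $\log p=o(n)$. * (B2) $|J^*|\le q$. * (B3) $a_1\mathbf I_J\preceq\mathbb{E}[X_{1J}X_{1J}^T]\preceq a_2\mathbf I_J$ for all $|J|\le 2q$. * (B4) $\|\phi^*\|_2\le a_3$. * (B5) $\sqrt{\log(np)/n}=o(\min\{|\phi^*_j|:j\in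 J^*\})$, where the minimum over the empty set is $+\infty$. Moreover one of the following holds, with constants not depending on $n$: * (A1) there is a constant $A$ with $|X_{1j}|\le A$ almost surely for all $j\in[p]$; * (A2) there are an even integer $K>2\kappa$, a constant $A_K$ and a function $B_K$ with $\mathbb{E}|X_{1j}|^{6K}\le A_K$ and $\mathbb{E}\big[\sup_{|\theta|\le t|X_{1j}|}|b'''(\theta)|^{2K}\big]\le B_K(t)$ for all $t>0$ and $j\in[p]$. **Theorem.** There are constants $R,\lambda_1,\lambda_2,\lambda_3>0$, depending only on $\nu$, $q$, $a_1,a_2,a_3$ and on the constants of (A1) or (A2) ($A$, or $K$, $A_K$, $B_K$), with the following property. Let $F_1,F_2,F_3>0$ and let the prior densities satisfy, for all $n$ and all $|J|\le q$: $f_J\le F_1$ on $\mathbb{R}^J$; $f_J\ge F_2$ on the ball $\{\|\phi_J\|_2\le R+1\}$; and $f_J$ is Lipschitz with constant $F_3$ on that ball (for instance $\|\nabla f_J\|_2\le F_3$ there). Then there is a constant $$C\le 4F_3F_2^{-1}\lambda_1^{-1/2}+2q\lambda_3\lambda_1^{-3/2}+2$$ and, for every $\gamma\ge0$, a constant $$C_1\le\tfrac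 q2\log(2\pi)+\gamma q\log(2q)+q\log\max\{\lambda_1^{-1},\lambda_2\}+\log\max\{F_1,F_2^{-1}\}+1$$ (with $0\log 0=0$), where $C$ depends only on $F_1,F_2,F_3$ and on the data on which $R,\lambda_1,\lambda_2,\lambda_3$ depend, and $C_1$ in addition on $\gamma$, such that for any prior weights $P(J)\ge0$ and all sufficiently large $n$, with probability at least $1-(np)^{-1}$ under (A1), and at least $$1-(np)^{-1}-4K^{K+1}n^{-\frac{K-2\kappa_n}{2}}$$ under (A2), all of the following hold simultaneously: * for all $|J|\le 2q$ and all $\phi_J,\phi_J'\in\mathbb{R}^J$ of norm at most $R+1$, $\lambda_1\mathbf I_J\preceq\frac1nH_J(\phi_J)\preceq\lambda_2\mathbf I_J$ and $\frac1n(H_J(\phi_J)-H_J(\phi'_J))\preceq\|\phi_J-\phi_J'\|_2\lambda_3\mathbf I_J$; * for all $|J|\le q$, the maximizer $\hat\phi_J$ exists, is unique, and satisfies $\|\hat\phi_J\|_2\le R$; the integral in $\mathrm{Bayes}(J)$ is finite; and $$\mathrm{Bayes}(J)=P(J)\,L(\hat\phi_J)f_J(\hat\phi_J)\,|H_J(\hat\phi_J)|^{-1/2}(2\pi)^{|J|/2}\Big(1\pm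 C\sqrt{\tfrac{\log(np)}{n}}\Big);$$ * for all $|J|\le q$, $\ \big|\log\mathrm{Bayes}_\gamma(J)-\big(-\tfrac12\mathrm{BIC}_\gamma(J)\big)\big|\le C_1$. -/

import Mathlib

open MeasureTheory ProbabilityTheory Filter Topology

noncomputable section

namespace SparseGLM

/-! ### The univariate exponential family -/

/-- `ν` is the dominating measure of a natural exponential family
`p_θ(y) = exp (y θ - b(θ))` with natural parameter space all of `ℝ`, where
`b(θ) = log ∫ exp (θ y) dν(y)`. The family is not degenerate: the response is not a constant. -/
structure IsExpFamilyBase (ν : Measure ℝ) : Prop where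
  integrable_exp : ∀ θ : ℝ, Integrable (fun y : ℝ => Real.exp (θ * y)) ν
  nondegenerate : ∀ c : ℝ, ¬ ∀ᵐ y ∂ν, y = c

/-- The cumulant function `b(θ) = log ∫ exp (θ y) dν(y)` of the family. -/
def cumulant (ν : Measure ℝ) (θ : ℝ) : ℝ := cgf id ν θ

/-! ### The data -/

/-- A sample: `n` pairs (covariate vector in `ℝ^p`, response). -/
abbrev Sample (n p : ℕ) : Type := Fin n → (Fin p → ℝ) × ℝ

/-- The law of one observation `(X, Y)`: `X` has law `μ`, and given `X = x` the response has
density `exp (y θ - b(θ))` with respect to `ν`, where `θ = xᵀ φ` (canonical link). -/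
def obsLaw (ν : Measure ℝ) {p : ℕ} (μ : Measure (Fin p → ℝ)) (φ : EuclideanSpace ℝ (Fin p)) :
    Measure ((Fin p → ℝ) × ℝ) :=
  (μ.prod ν).withDensity fun z =>
    ENNReal.ofReal
      (Real.exp (z.2 * (∑ j, z.1 j * φ j) - cumulant ν (∑ j, z.1 j * φ j)))

/-- The law of `n` independent observations. -/
def sampleLaw (ν : Measure ℝ) (n : ℕ) {p : ℕ} (μ : Measure (Fin p → ℝ))
    (φ : EuclideanSpace ℝ (Fin p)) : Measure (Sample n p) :=
  Measure.pi fun _ : Fin n => obsLaw ν μ φ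

/-- `E` occurs with probability at least `r` (no measurability of `E` is presupposed: `E` contains
a measurable set of probability at least `r`). -/
def ProbAtLeast {Ω : Type*} [MeasurableSpace Ω] (μ : Measure Ω) (r : ℝ) (E : Set Ω) : Prop :=
  ∃ S : Set Ω, MeasurableSet S ∧ S ⊆ E ∧ r ≤ μ.real S

/-! ### Likelihood, maximum likelihood, Hessian -/

section Likelihood

variable (ν : Measure ℝ) {n p : ℕ} (ω : Sample n p) (J : Finset (Fin p))

/-- `X_{iJ}ᵀ φ_J`. -/
def linPred (i : Fin n) (φ : EuclideanSpace ℝ J) : ℝ := ∑ j : J, (ω i).1 j * φ j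

/-- The log-likelihood of model `J`. -/
def logLik (φ : EuclideanSpace ℝ J) : ℝ :=
  ∑ i, ((ω i).2 * linPred ω J i φ - cumulant ν (linPred ω J i φ))

/-- The likelihood of model `J`. -/
def lik (φ : EuclideanSpace ℝ J) : ℝ := Real.exp (logLik ν ω J φ)

/-- `φ` is the maximum likelihood estimator in model `J`: the unique global maximizer. -/
def IsMLE (φ : EuclideanSpace ℝ J) : Prop :=
  (∀ ψ, logLik ν ω J ψ ≤ logLik ν ω J φ) ∧
    ∀ φ', (∀ ψ, logLik ν ω J ψ ≤ logLik ν ω J φ') → φ' = φ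

/-- `H_J(φ)`: the Hessian matrix of the negative log-likelihood of model `J`. -/
def negHessian (φ : EuclideanSpace ℝ J) : Matrix J J ℝ :=
  Matrix.of fun j k =>
    -(fderiv ℝ (fun ψ => fderiv ℝ (logLik ν ω J) ψ (EuclideanSpace.single k 1)) φ
        (EuclideanSpace.single j 1))

/-- The unnormalized posterior probability of model `J`, for the prior weight `w = P(J)` of the
model and the prior density `f` of its parameter. -/
def bayes (w : ℝ) (f : EuclideanSpace ℝ J → ℝ) : ℝ := w * ∫ φ, lik ν ω J φ * f φ

/-- The Laplace approximation to `bayes` at `φ`. -/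
def laplaceApprox (w : ℝ) (f : EuclideanSpace ℝ J → ℝ) (φ : EuclideanSpace ℝ J) : ℝ :=
  w * (lik ν ω J φ * f φ) * (negHessian ν ω J φ).det ^ (-(1 / 2) : ℝ) *
    (2 * Real.pi) ^ ((J.card : ℝ) / 2)

/-- The extended Bayesian information criterion, where `φ` is the MLE in model `J`. -/
def ebic (γ : ℝ) (φ : EuclideanSpace ℝ J) : ℝ :=
  -2 * Real.log (lik ν ω J φ) + J.card * Real.log n + 2 * γ * J.card * Real.log p

end Likelihood

/-- The unnormalized prior `binom(p, |J|)^{-γ} 1{|J| ≤ q}` on models. -/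
def gammaPrior (γ : ℝ) (q : ℕ) {p : ℕ} (J : Finset (Fin p)) : ℝ :=
  if J.card ≤ q then ((p.choose J.card : ℕ) : ℝ) ^ (-γ) else 0

/-- The Loewner order `A ≼ B` on real symmetric matrices. -/
def LoewnerLE {ι : Type*} [Fintype ι] (A B : Matrix ι ι ℝ) : Prop := (B - A).PosSemidef

/-- The bounds `λ₁ I ≼ H_J(φ)/n ≼ λ₂ I` and `(H_J(φ) - H_J(φ'))/n ≼ ‖φ - φ'‖ λ₃ I` on the
ball of radius `r`, for every model `J` with at most `m` covariates. -/
def HessianBounds (ν : Measure ℝ) {n p : ℕ} (ω : Sample n p) (m : ℕ)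
    (r lam₁ lam₂ lam₃ : ℝ) : Prop :=
  ∀ J : Finset (Fin p), J.card ≤ m →
    (∀ φ : EuclideanSpace ℝ J, ‖φ‖ ≤ r →
      LoewnerLE (lam₁ • 1) ((1 / (n : ℝ)) • negHessian ν ω J φ) ∧
      LoewnerLE ((1 / (n : ℝ)) • negHessian ν ω J φ) (lam₂ • 1)) ∧
    ∀ φ φ' : EuclideanSpace ℝ J, ‖φ‖ ≤ r → ‖φ'‖ ≤ r →
      LoewnerLE ((1 / (n : ℝ)) • (negHessian ν ω J φ - negHessian ν ω J φ'))
        ((‖φ - φ'‖ * lam₃) • 1)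

/-! ### The asymptotic scenario and its assumptions -/

/-- For every sample size `n`: a number `p n ≥ 1` of covariates, the law of a covariate vector,
and the true parameter vector. -/
structure Scenario where
  p : ℕ → ℕ
  covLaw : ∀ n, Measure (Fin (p n) → ℝ)
  φstar : ∀ n, EuclideanSpace ℝ (Fin (p n))
  p_pos : ∀ n, 1 ≤ p n
  isProbabilityMeasure : ∀ n, IsProbabilityMeasure (covLaw n)

namespace Scenario

variable (S : Scenario)

/-- The support `J*` of the true parameter vector. -/
def trueSupport (n : ℕ) : Finset (Fin (S.p n)) :=
  Finset.univ.filter fun j => S.φstar n j ≠ 0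

/-- The matrix `E[X_{1J} X_{1J}ᵀ]`. -/
def secondMoment (n : ℕ) (J : Finset (Fin (S.p n))) : Matrix J J ℝ :=
  Matrix.of fun j k => ∫ x, x j * x k ∂(S.covLaw n)

/-- `κ_n = log_n (p_n)`. -/
def kappaSeq (n : ℕ) : ℝ := Real.logb n (S.p n)

/-- `κ = limsup κ_n`, an element of `[0, ∞]`. -/
def kappa : ENNReal := limsup (fun n => ENNReal.ofReal (S.kappaSeq n)) atTop

/-- The standing assumptions on growth, sparsity, second moments and signal. In `signal_decay`,
the formulation "`√(log (np) / n)` is at most `ε |φ*_j|` for all `j ∈ J*`, eventually, for each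
`ε > 0`" says that it is `o (min {|φ*_j| : j ∈ J*})`, the minimum over the empty set being `∞`. -/
structure BaseAssumptions (q : ℕ) (a₁ a₂ a₃ : ℝ) : Prop where
  growth : (fun n => Real.log (S.p n)) =o[atTop] fun n : ℕ => (n : ℝ)
  sparsity : ∀ n, (S.trueSupport n).card ≤ q
  second_moments : ∀ n, ∀ J : Finset (Fin (S.p n)), J.card ≤ 2 * q →
    LoewnerLE (a₁ • 1) (S.secondMoment n J) ∧ LoewnerLE (S.secondMoment n J) (a₂ • 1)
  signal_bound : ∀ n, ‖S.φstar n‖ ≤ a₃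
  signal_decay : ∀ ε : ℝ, 0 < ε → ∀ᶠ n : ℕ in atTop, ∀ j ∈ S.trueSupport n,
    Real.sqrt (Real.log (n * S.p n) / n) ≤ ε * |S.φstar n j|

end Scenario

/-- The two alternative conditions on the covariates, with the constants they involve. -/
inductive CovCondition : Type
  /-- Bounded covariates, `|X_{1j}| ≤ A` almost surely. -/
  | bounded (A : ℝ)
  /-- Moment conditions of order `K`, with bounds `AK` and `BK t`. -/
  | moments (K : ℕ) (AK : ℝ) (BK : ℝ → ℝ)

namespace CovCondition

/-- What the condition says about a scenario. -/
def Holds (ν : Measure ℝ) (S : Scenario) : CovCondition → Prop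
  | bounded A => ∀ n, ∀ j, ∀ᵐ x ∂(S.covLaw n), |x j| ≤ A
  | moments K AK BK =>
      Even K ∧ 2 * S.kappa < (K : ENNReal) ∧
      (∀ n, ∀ j, ∫⁻ x, ENNReal.ofReal (|x j| ^ (6 * K)) ∂(S.covLaw n) ≤ ENNReal.ofReal AK) ∧
      ∀ t : ℝ, 0 < t → ∀ n, ∀ j,
        ∫⁻ x, (⨆ θ ∈ {θ : ℝ | |θ| ≤ t * |x j|},
          ENNReal.ofReal (|iteratedDeriv 3 (cumulant ν) θ| ^ (2 * K))) ∂(S.covLaw n)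
          ≤ ENNReal.ofReal (BK t)

/-- The bound on the failure probability: `(np)⁻¹` for bounded covariates, and
`(np)⁻¹ + 4 K^{K+1} n^{-(K - 2 κ_n)/2}` under the moment conditions. -/
def failProb (S : Scenario) (n : ℕ) : CovCondition → ℝ
  | bounded _ => ((n : ℝ) * S.p n)⁻¹
  | moments K _ _ =>
      ((n : ℝ) * S.p n)⁻¹ +
        4 * (K : ℝ) ^ (K + 1) * (n : ℝ) ^ (-(((K : ℝ) - 2 * S.kappaSeq n) / 2))

end CovCondition

/-! ### Priors on the parameters -/

/-- A probability density on `ℝ^J`. -/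
structure IsDensity {ι : Type*} [Fintype ι] (f : EuclideanSpace ℝ ι → ℝ) : Prop where
  measurable : Measurable f
  nonneg : ∀ φ, 0 ≤ f φ
  lintegral_eq_one : ∫⁻ φ, ENNReal.ofReal (f φ) = 1

/-- The prior density `f` is bounded by `F₁`, and on the closed ball of radius `r` it is bounded
below by `F₂` and Lipschitz with constant `F₃`. -/
structure PriorBounds {ι : Type*} [Fintype ι] (f : EuclideanSpace ℝ ι → ℝ)
    (r F₁ F₂ F₃ : ℝ) : Prop where
  upper : ∀ φ, f φ ≤ F₁
  lower : ∀ φ, ‖φ‖ ≤ r → F₂ ≤ f φ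
  lipschitz : ∀ φ ψ, ‖φ‖ ≤ r → ‖ψ‖ ≤ r → |f φ - f ψ| ≤ F₃ * ‖φ - ψ‖

end SparseGLM

end

/-! The proof separates a deterministic analysis from a probability estimate.

Deterministic part. Suppose that in sparse directions the curvature of the log-likelihood on the
ball of radius `R + 1` lies between `lam₁ * n` and `lam₂ * n` and is Lipschitz with constant `lam₃ *
n` (`CurvBounds`), and that outside radius `R` every sparse log-likelihood is below its value at 0.
Then the maximizer exists in the ball of radius `R`. Around it the log-likelihood falls at least
quadratically up to distance 1 and, by concavity, linearly beyond, with a cubic error in the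
quadratic approximation (`exists_isMLE`). After rescaling by `√n` the integrand differs from a
Gaussian by `n^{-1/2}` times an integrable function (`laplace_approximation`). A constant over `√n`
is eventually below `√(log(np)/n)`, so `C = 2` suffices. Taking logarithms, with a determinant
between `(lam₁ n)^d` and `(lam₂ n)^d` and a binomial coefficient comparable to `p^d`, gives the
information criterion (`laplace_and_criterion`).

Probability part (`exists_event_constants`). The curvature `∑ (xᵢᵀh)² b''(xᵢᵀw)` involves the
covariates only. For the lower bound, truncate the covariates at a level `M`: fourth moments keep
the truncated second moments above `a₁/2`, Hoeffding's inequality and a union bound over the models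
cost another `a₁/4`, and `log p = o(n)` makes the failure probability negligible. The upper and
Lipschitz bounds reduce to sums over `i` of one envelope for each covariate. These are of order `n`
surely in the bounded case; otherwise a moment inequality of order `K` gives failure probability `p
n^{-K/2} = n^{-(K-2κ_n)/2}`.

To confine the likelihood to a ball, no tail estimate for the responses is needed: the likelihood
ratio of any parameter against the true one has expectation 1, so Markov's inequality at the points
`φ* ± u e_j`, combined with the curvature bound, controls each coordinate of the score at `φ*`. With
a small score and a curvature bounded below, concavity forces a linear decrease away from `φ*`. -/

open MeasureTheory ProbabilityTheory Filter Topology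

noncomputable section

namespace SparseGLM

/-! ### The cumulant function -/

section Cumulant

variable {ν : Measure ℝ}

namespace IsExpFamilyBase

variable (hν : IsExpFamilyBase ν)

include hν

lemma isFiniteMeasure : IsFiniteMeasure ν := by
  have h := hν.integrable_exp 0
  simp only [zero_mul, Real.exp_zero] at h
  exact (integrable_const_iff_isFiniteMeasure (one_ne_zero)).1 h

lemma ne_zero : ν ≠ 0 := by
  rintro rfl
  exact hν.nondegenerate 0 (by simp)

lemma integrableExpSet_eq : integrableExpSet id ν = Set.univ :=
  Set.eq_univ_of_forall fun θ => hν.integrable_exp θ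

lemma mem_interior (θ : ℝ) : θ ∈ interior (integrableExpSet id ν) := by
  rw [hν.integrableExpSet_eq, interior_univ]; trivial

lemma analyticAt_cumulant (θ : ℝ) : AnalyticAt ℝ (cumulant ν) θ :=
  analyticAt_cgf (hν.mem_interior θ)

lemma contDiff_cumulant (k : WithTop ℕ∞) : ContDiff ℝ k (cumulant ν) :=
  contDiff_iff_contDiffAt.2 fun θ => (hν.analyticAt_cumulant θ).contDiffAt

lemma continuous_iteratedDeriv_cumulant (k : ℕ) :
    Continuous (iteratedDeriv k (cumulant ν)) :=
  (hν.contDiff_cumulant k).continuous_iteratedDeriv k le_rfl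

lemma continuous_cumulant : Continuous (cumulant ν) := (hν.contDiff_cumulant 0).continuous

lemma measurable_cumulant : Measurable (cumulant ν) := hν.continuous_cumulant.measurable

lemma hasDerivAt_iteratedDeriv_cumulant (k : ℕ) (θ : ℝ) :
    HasDerivAt (iteratedDeriv k (cumulant ν)) (iteratedDeriv (k + 1) (cumulant ν) θ) θ := by
  rw [iteratedDeriv_succ]
  exact ((hν.contDiff_cumulant (k + 1 : ℕ)).differentiable_iteratedDeriv k
    (by exact_mod_cast Nat.lt_succ_self k) θ).hasDerivAt

lemma hasDerivAt_cumulant (θ : ℝ) :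
    HasDerivAt (cumulant ν) (iteratedDeriv 1 (cumulant ν) θ) θ := by
  simpa using hν.hasDerivAt_iteratedDeriv_cumulant 0 θ

lemma exp_cumulant (θ : ℝ) :
    Real.exp (cumulant ν θ) = ∫ y, Real.exp (θ * y) ∂ν := by
  have : NeZero ν := ⟨hν.ne_zero⟩
  exact Real.exp_log (integral_exp_pos (hν.integrable_exp θ))

/-- This is the variance of the exponentially tilted law, which vanishes only for a point mass. -/
lemma iteratedDeriv_two_cumulant_pos (θ : ℝ) : 0 < iteratedDeriv 2 (cumulant ν) θ := by
  have hmem := hν.mem_interior θ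
  have : NeZero ν := ⟨hν.ne_zero⟩
  rw [show cumulant ν = cgf id ν from rfl, iteratedDeriv_two_cgf_eq_integral hmem]
  refine div_pos ?_ (mgf_pos' hν.ne_zero (hν.integrable_exp θ))
  rw [integral_pos_iff_support_of_nonneg]
  · set c := deriv (cgf id ν) θ
    rw [pos_iff_ne_zero]
    intro h0
    refine hν.nondegenerate c ?_
    rw [ae_iff]
    refine measure_mono_null (fun y hy => ?_) h0
    simp only [Function.mem_support, id]
    have : y - c ≠ 0 := sub_ne_zero.2 hy
    positivity
  · intro y
    dsimp only
    positivity
  · have hbase : ∀ k : ℕ, Integrable (fun y : ℝ => id y ^ k * Real.exp (θ * id y)) ν :=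
      fun k => integrable_pow_mul_exp_of_mem_interior_integrableExpSet hmem k
    set c := deriv (cgf id ν) θ
    have := ((hbase 2).sub ((hbase 1).const_mul (2 * c))).add ((hbase 0).const_mul (c ^ 2))
    refine this.congr (ae_of_all _ fun y => ?_)
    simp only [Pi.add_apply, Pi.sub_apply, id]
    ring

lemma exists_lower_bound (M : ℝ) :
    ∃ β > 0, ∀ θ, |θ| ≤ M → β ≤ iteratedDeriv 2 (cumulant ν) θ := by
  by_cases hM : 0 ≤ M
  · obtain ⟨θ₀, _, h⟩ := (isCompact_Icc (a := -M) (b := M)).exists_isMinOn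
      ⟨0, by constructor <;> linarith⟩
      (hν.continuous_iteratedDeriv_cumulant 2).continuousOn
    exact ⟨_, hν.iteratedDeriv_two_cumulant_pos θ₀, fun θ hθ => h (abs_le.1 hθ)⟩
  · exact ⟨1, one_pos, fun θ hθ => absurd ((abs_nonneg θ).trans hθ) hM⟩

end IsExpFamilyBase

/-- The supremum of `|b'''|` over `[-ρ|x|, ρ|x|]`. -/
def thirdSup (ν : Measure ℝ) (ρ x : ℝ) : ℝ :=
  sSup ((fun θ => |iteratedDeriv 3 (cumulant ν) θ|) '' Set.Icc (-(ρ * |x|)) (ρ * |x|))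

/-- `x² + |x|³ sup |b'''|`, a bound for the contribution of a covariate to the
Hessian and to its modulus of continuity. -/
def envelope (ν : Measure ℝ) (ρ x : ℝ) : ℝ := x ^ 2 + |x| ^ 3 * thirdSup ν ρ x

lemma thirdSup_nonneg (ρ x : ℝ) : 0 ≤ thirdSup ν ρ x :=
  Real.sSup_nonneg (by rintro _ ⟨θ, _, rfl⟩; exact abs_nonneg _)

lemma envelope_nonneg (ρ x : ℝ) : 0 ≤ envelope ν ρ x := by
  have := thirdSup_nonneg (ν := ν) ρ x
  unfold envelope; positivity

lemma thirdSup_abs (ρ x : ℝ) : thirdSup ν ρ |x| = thirdSup ν ρ x := by simp [thirdSup]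

namespace IsExpFamilyBase

variable (hν : IsExpFamilyBase ν)

include hν

lemma bddAbove_thirdSup (r : ℝ) :
    BddAbove ((fun θ => |iteratedDeriv 3 (cumulant ν) θ|) '' Set.Icc (-r) r) :=
  isCompact_Icc.bddAbove_image (hν.continuous_iteratedDeriv_cumulant 3).abs.continuousOn

lemma le_thirdSup {ρ x θ : ℝ} (h : |θ| ≤ ρ * |x|) :
    |iteratedDeriv 3 (cumulant ν) θ| ≤ thirdSup ν ρ x :=
  le_csSup (hν.bddAbove_thirdSup _) ⟨θ, abs_le.1 h, rfl⟩

lemma exists_eq_thirdSup {ρ : ℝ} (hρ : 0 ≤ ρ) (x : ℝ) :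
    ∃ θ, |θ| ≤ ρ * |x| ∧ thirdSup ν ρ x = |iteratedDeriv 3 (cumulant ν) θ| := by
  have h0 : 0 ≤ ρ * |x| := by positivity
  obtain ⟨θ, hθ, h⟩ := (isCompact_Icc (a := -(ρ * |x|)) (b := ρ * |x|)).exists_sSup_image_eq
    ⟨0, by constructor <;> linarith⟩
    (hν.continuous_iteratedDeriv_cumulant 3).abs.continuousOn
  exact ⟨θ, abs_le.2 hθ, h⟩

lemma thirdSup_mono {ρ x y : ℝ} (hρ : 0 ≤ ρ) (h : |x| ≤ |y|) :
    thirdSup ν ρ x ≤ thirdSup ν ρ y := by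
  obtain ⟨θ, hθ, he⟩ := hν.exists_eq_thirdSup hρ x
  rw [he]
  exact hν.le_thirdSup (hθ.trans (by gcongr))

lemma envelope_mono {ρ x y : ℝ} (hρ : 0 ≤ ρ) (h : |x| ≤ |y|) :
    envelope ν ρ x ≤ envelope ν ρ y := by
  have h1 := hν.thirdSup_mono hρ h
  have h2 := thirdSup_nonneg (ν := ν) ρ x
  have h3 := sq_le_sq.2 h
  unfold envelope
  gcongr

/-- A supremum over an uncountable set is not measurable by general principles; here it is a
monotone function of `|x|`. -/
lemma measurable_thirdSup {ρ : ℝ} (hρ : 0 ≤ ρ) : Measurable (thirdSup ν ρ) := by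
  have h1 : Monotone fun t : ℝ => thirdSup ν ρ (max t 0) := fun s t hst => by
    refine hν.thirdSup_mono hρ ?_
    rw [abs_of_nonneg (le_max_right _ _), abs_of_nonneg (le_max_right _ _)]
    gcongr
  have h2 := h1.measurable.comp (measurable_norm (α := ℝ))
  convert h2 using 1
  ext x
  simp [thirdSup_abs]

lemma measurable_envelope {ρ : ℝ} (hρ : 0 ≤ ρ) : Measurable (envelope ν ρ) := by
  have := hν.measurable_thirdSup hρ
  unfold envelope
  have habs : Measurable fun x : ℝ => |x| := measurable_norm
  exact (measurable_id.pow_const 2).add ((habs.pow_const 3).mul this)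

lemma abs_sub_le_thirdSup {ρ x θ θ' : ℝ} (h : |θ| ≤ ρ * |x|) (h' : |θ'| ≤ ρ * |x|) :
    |iteratedDeriv 2 (cumulant ν) θ - iteratedDeriv 2 (cumulant ν) θ'|
      ≤ thirdSup ν ρ x * |θ - θ'| := by
  have := (convex_Icc (-(ρ * |x|)) (ρ * |x|)).norm_image_sub_le_of_norm_hasDerivWithin_le
    (fun t _ => (hν.hasDerivAt_iteratedDeriv_cumulant 2 t).hasDerivWithinAt)
    (fun t ht => hν.le_thirdSup (abs_le.2 ht)) (abs_le.1 h') (abs_le.1 h)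
  simpa only [Real.norm_eq_abs] using this

end IsExpFamilyBase

end Cumulant

/-! ### The log-likelihood of the full model and its derivatives -/

/-- Rolle's theorem twice: `c` is chosen so that `F s - F' 0 * s - c * s ^ 2` agrees at 0 and 1, and
the derivative of this function also vanishes at 0. -/
lemma exists_taylor_two {F F' F'' : ℝ → ℝ} (h1 : ∀ s, HasDerivAt F (F' s) s)
    (h2 : ∀ s, HasDerivAt F' (F'' s) s) :
    ∃ ξ ∈ Set.Ioo (0 : ℝ) 1, F 1 = F 0 + F' 0 + F'' ξ / 2 := by
  set c := F 1 - F 0 - F' 0 with hc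
  have hG : ∀ s, HasDerivAt (fun s => F s - F' 0 * s - c * s ^ 2) (F' s - F' 0 - c * (2 * s)) s := by
    intro s
    have := ((h1 s).sub ((hasDerivAt_id s).const_mul (F' 0))).sub
      (((hasDerivAt_id s).pow 2).const_mul c)
    exact this.congr_deriv (by simp)
  have hG' : ∀ s, HasDerivAt (fun s => F' s - F' 0 - c * (2 * s)) (F'' s - c * 2) s := by
    intro s
    have := ((h2 s).sub_const (F' 0)).sub (((hasDerivAt_id s).const_mul 2).const_mul c)
    exact this.congr_deriv (by simp)
  obtain ⟨η, hη, he⟩ := exists_hasDerivAt_eq_zero (a := 0) (b := 1) one_pos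
    (fun s _ => (hG s).continuousAt.continuousWithinAt) (by simp [hc])
    (fun s _ => hG s)
  obtain ⟨ξ, hξ, he'⟩ := exists_hasDerivAt_eq_zero (a := 0) (b := η) hη.1
    (fun s _ => (hG' s).continuousAt.continuousWithinAt) (by simp [he])
    (fun s _ => hG' s)
  exact ⟨ξ, ⟨hξ.1, hξ.2.trans hη.2⟩, by simp only [hc] at he'; linarith⟩

section FullModel

variable {p n : ℕ}

/-- The linear predictor `xᵀ w` of the full model. -/
def pred (x : Fin p → ℝ) (w : EuclideanSpace ℝ (Fin p)) : ℝ := ∑ j, x j * w j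

lemma pred_add (x : Fin p → ℝ) (w h : EuclideanSpace ℝ (Fin p)) :
    pred x (w + h) = pred x w + pred x h := by
  simp [pred, mul_add, Finset.sum_add_distrib]

lemma pred_sub (x : Fin p → ℝ) (w h : EuclideanSpace ℝ (Fin p)) :
    pred x (w - h) = pred x w - pred x h := by
  simp [pred, mul_sub, Finset.sum_sub_distrib]

lemma pred_smul (x : Fin p → ℝ) (s : ℝ) (h : EuclideanSpace ℝ (Fin p)) :
    pred x (s • h) = s * pred x h := by
  simp only [pred, PiLp.smul_apply, smul_eq_mul, Finset.mul_sum]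
  exact Finset.sum_congr rfl fun _ _ => by ring

lemma pred_single (x : Fin p → ℝ) (j : Fin p) (s : ℝ) :
    pred x (EuclideanSpace.single j s) = x j * s := by
  simp [pred]

/-- The log-likelihood of the full model. -/
def fullLogLik (ν : Measure ℝ) (ω : Sample n p) (w : EuclideanSpace ℝ (Fin p)) : ℝ :=
  ∑ i, ((ω i).2 * pred (ω i).1 w - cumulant ν (pred (ω i).1 w))

/-- The derivative of the log-likelihood at `w` in direction `h`. -/
def score (ν : Measure ℝ) (ω : Sample n p) (w h : EuclideanSpace ℝ (Fin p)) : ℝ :=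
  ∑ i, ((ω i).2 - iteratedDeriv 1 (cumulant ν) (pred (ω i).1 w)) * pred (ω i).1 h

/-- The quadratic form of the negative Hessian of the log-likelihood at `w`. -/
def curv (ν : Measure ℝ) (ω : Sample n p) (w h : EuclideanSpace ℝ (Fin p)) : ℝ :=
  ∑ i, pred (ω i).1 h ^ 2 * iteratedDeriv 2 (cumulant ν) (pred (ω i).1 w)

/-- `w` vanishes outside `J`. -/
def SuppOn (J : Finset (Fin p)) (w : EuclideanSpace ℝ (Fin p)) : Prop := ∀ j ∉ J, w j = 0

lemma SuppOn.mono {J J' : Finset (Fin p)} (hJ : J ⊆ J') {w : EuclideanSpace ℝ (Fin p)}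
    (hw : SuppOn J w) : SuppOn J' w := fun j hj => hw j fun h => hj (hJ h)

lemma SuppOn.add {J : Finset (Fin p)} {w h : EuclideanSpace ℝ (Fin p)} (hw : SuppOn J w)
    (hh : SuppOn J h) : SuppOn J (w + h) := fun j hj => by simp [hw j hj, hh j hj]

lemma SuppOn.sub {J : Finset (Fin p)} {w h : EuclideanSpace ℝ (Fin p)} (hw : SuppOn J w)
    (hh : SuppOn J h) : SuppOn J (w - h) := fun j hj => by simp [hw j hj, hh j hj]

lemma SuppOn.smul {J : Finset (Fin p)} {w : EuclideanSpace ℝ (Fin p)} (s : ℝ) (hw : SuppOn J w) :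
    SuppOn J (s • w) := fun j hj => by simp [hw j hj]

lemma SuppOn.neg {J : Finset (Fin p)} {w : EuclideanSpace ℝ (Fin p)} (hw : SuppOn J w) :
    SuppOn J (-w) := fun j hj => by simp [hw j hj]

lemma SuppOn.pred_eq {J : Finset (Fin p)} {w : EuclideanSpace ℝ (Fin p)} (hw : SuppOn J w)
    (x : Fin p → ℝ) : pred x w = ∑ j ∈ J, x j * w j :=
  (Finset.sum_subset (Finset.subset_univ J) fun j _ hj => by rw [hw j hj, mul_zero]).symm

lemma SuppOn.abs_sum_mul_le {J : Finset (Fin p)} {w : EuclideanSpace ℝ (Fin p)}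
    {x : Fin p → ℝ} {m : ℝ} (hx : ∀ j ∈ J, |x j| ≤ m) {c : ℝ} (hc : (J.card : ℝ) ≤ c)
    (hm : 0 ≤ m) : |∑ j ∈ J, x j * w j| ≤ c * m * ‖w‖ := by
  calc |∑ j ∈ J, x j * w j| ≤ ∑ j ∈ J, |x j * w j| := Finset.abs_sum_le_sum_abs _ _
    _ ≤ ∑ j ∈ J, m * ‖w‖ := Finset.sum_le_sum fun j hj => by
        rw [abs_mul]
        exact mul_le_mul (hx j hj) (PiLp.norm_apply_le w j) (abs_nonneg _) hm
    _ = J.card * m * ‖w‖ := by rw [Finset.sum_const, nsmul_eq_mul, mul_assoc]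
    _ ≤ c * m * ‖w‖ := by gcongr

lemma SuppOn.abs_pred_le {J : Finset (Fin p)} {w : EuclideanSpace ℝ (Fin p)} (hw : SuppOn J w)
    {x : Fin p → ℝ} {m : ℝ} (hx : ∀ j ∈ J, |x j| ≤ m) {c : ℝ} (hc : (J.card : ℝ) ≤ c)
    (hm : 0 ≤ m) : |pred x w| ≤ c * m * ‖w‖ := by
  rw [hw.pred_eq]
  exact SuppOn.abs_sum_mul_le hx hc hm

variable {ν : Measure ℝ}

lemma score_smul (ω : Sample n p) (w h : EuclideanSpace ℝ (Fin p)) (s : ℝ) :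
    score ν ω w (s • h) = s * score ν ω w h := by
  simp only [score, pred_smul, Finset.mul_sum]
  exact Finset.sum_congr rfl fun _ _ => by ring

lemma SuppOn.score_eq {J : Finset (Fin p)} {h : EuclideanSpace ℝ (Fin p)} (hh : SuppOn J h)
    (ω : Sample n p) (w : EuclideanSpace ℝ (Fin p)) :
    score ν ω w h = ∑ j ∈ J, score ν ω w (EuclideanSpace.single j 1) * h j := by
  simp only [score, hh.pred_eq, pred_single, mul_one, Finset.mul_sum, Finset.sum_mul]
  rw [Finset.sum_comm]
  exact Finset.sum_congr rfl fun _ _ => Finset.sum_congr rfl fun _ _ => by ring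

/-- Bounds for the envelopes of the covariates. -/
lemma exists_envelope_bound {ρ : ℝ} {J : Finset (Fin p)} {c : ℝ}
    (hc : (J.card : ℝ) ≤ c) {r : ℝ} (hr : c * r ≤ ρ) (x : Fin p → ℝ) :
    ∃ m : ℝ, (∀ h, SuppOn J h → |pred x h| ≤ c * |m| * ‖h‖) ∧
      (∀ w, SuppOn J w → ‖w‖ ≤ r → |pred x w| ≤ ρ * |m|) ∧
      envelope ν ρ m ≤ ∑ j ∈ J, envelope ν ρ (x j) := by
  have hc0 : 0 ≤ c := (Nat.cast_nonneg _).trans hc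
  -- The covariate of largest modulus in `J` stands in for all of them. Bounding its envelope by the
  -- sum over `J` leaves only sums over `i` for one fixed covariate to be controlled.
  obtain ⟨m, hm, hZ⟩ : ∃ m : ℝ, (∀ j ∈ J, |x j| ≤ |m|) ∧
      envelope ν ρ m ≤ ∑ j ∈ J, envelope ν ρ (x j) := by
    rcases J.eq_empty_or_nonempty with rfl | hJ
    · exact ⟨0, by simp, by simp [envelope]⟩
    · obtain ⟨k, hk, hmax⟩ := J.exists_max_image (fun j => |x j|) hJ
      exact ⟨x k, hmax, Finset.single_le_sum (f := fun j => envelope ν ρ (x j))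
        (fun j _ => envelope_nonneg _ _) hk⟩
  have h1 : ∀ h, SuppOn J h → |pred x h| ≤ c * |m| * ‖h‖ := fun h hh =>
    hh.abs_pred_le hm hc (abs_nonneg _)
  refine ⟨m, h1, fun w hw hwr => (h1 w hw).trans ?_, hZ⟩
  have h2 : c * ‖w‖ ≤ ρ := (mul_le_mul_of_nonneg_left hwr hc0).trans hr
  nlinarith [abs_nonneg m]

lemma sum_envelope_le {ω : Sample n p} {ρ t : ℝ} (ht : 0 ≤ t)
    (hZ : ∀ j, ∑ i, envelope ν ρ ((ω i).1 j) ≤ t * n)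
    {J : Finset (Fin p)} {c : ℝ} (hc : (J.card : ℝ) ≤ c) :
    ∑ i, ∑ j ∈ J, envelope ν ρ ((ω i).1 j) ≤ c * t * n := by
  rw [Finset.sum_comm]
  calc ∑ j ∈ J, ∑ i, envelope ν ρ ((ω i).1 j) ≤ ∑ j ∈ J, t * n :=
        Finset.sum_le_sum fun j _ => hZ j
    _ = J.card * (t * n) := by rw [Finset.sum_const, nsmul_eq_mul]
    _ ≤ c * (t * n) := by gcongr
    _ = c * t * n := by ring

/-! ### Concavity of the log-likelihood and bounds for its curvature. -/

namespace IsExpFamilyBase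

variable (hν : IsExpFamilyBase ν)

include hν

lemma curv_nonneg (ω : Sample n p) (w h : EuclideanSpace ℝ (Fin p)) : 0 ≤ curv ν ω w h :=
  Finset.sum_nonneg fun _ _ => mul_nonneg (sq_nonneg _) (hν.iteratedDeriv_two_cumulant_pos _).le

lemma hasDerivAt_fullLogLik (ω : Sample n p) (w h : EuclideanSpace ℝ (Fin p)) (s : ℝ) :
    HasDerivAt (fun s : ℝ => fullLogLik ν ω (w + s • h)) (score ν ω (w + s • h) h) s := by
  unfold fullLogLik score
  refine HasDerivAt.fun_sum fun i _ => ?_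
  have hp : HasDerivAt (fun s : ℝ => pred (ω i).1 (w + s • h)) (pred (ω i).1 h) s := by
    simp only [pred_add, pred_smul]
    simpa using ((hasDerivAt_id s).mul_const (pred (ω i).1 h)).const_add (pred (ω i).1 w)
  have := (hp.const_mul (ω i).2).sub ((hν.hasDerivAt_cumulant (pred (ω i).1 (w + s • h))).comp s hp)
  exact this.congr_deriv (by ring)

lemma hasDerivAt_score (ω : Sample n p) (w h k : EuclideanSpace ℝ (Fin p)) (s : ℝ) :
    HasDerivAt (fun s : ℝ => score ν ω (w + s • h) k)
      (-∑ i, pred (ω i).1 h * pred (ω i).1 k *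
        iteratedDeriv 2 (cumulant ν) (pred (ω i).1 (w + s • h))) s := by
  unfold score
  rw [← Finset.sum_neg_distrib]
  refine HasDerivAt.fun_sum fun i _ => ?_
  have hp : HasDerivAt (fun s : ℝ => pred (ω i).1 (w + s • h)) (pred (ω i).1 h) s := by
    simp only [pred_add, pred_smul]
    simpa using ((hasDerivAt_id s).mul_const (pred (ω i).1 h)).const_add (pred (ω i).1 w)
  have := (((hν.hasDerivAt_iteratedDeriv_cumulant 1
    (pred (ω i).1 (w + s • h))).comp s hp).const_sub (ω i).2).mul_const (pred (ω i).1 k)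
  exact this.congr_deriv (by ring)

lemma exists_taylor_fullLogLik (ω : Sample n p) (w h : EuclideanSpace ℝ (Fin p)) :
    ∃ ξ ∈ Set.Ioo (0 : ℝ) 1,
      fullLogLik ν ω (w + h) = fullLogLik ν ω w + score ν ω w h - curv ν ω (w + ξ • h) h / 2 := by
  obtain ⟨ξ, hξ, h⟩ := exists_taylor_two (hν.hasDerivAt_fullLogLik ω w h)
    (hν.hasDerivAt_score ω w h h)
  refine ⟨ξ, hξ, ?_⟩
  simp only [one_smul, zero_smul, add_zero] at h
  rw [h, curv, neg_div, ← sub_eq_add_neg]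
  simp only [sq]

lemma fullLogLik_le_tangent (ω : Sample n p) (w h : EuclideanSpace ℝ (Fin p)) :
    fullLogLik ν ω (w + h) ≤ fullLogLik ν ω w + score ν ω w h := by
  obtain ⟨ξ, _, h'⟩ := hν.exists_taylor_fullLogLik ω w h
  have := hν.curv_nonneg ω (w + ξ • h) h
  linarith

/-- Concavity along a ray: both `w` and `w + s • h` lie below the tangent at `w + h`. It turns a
decrease at distance 1 into a linear decrease farther out. -/
lemma fullLogLik_chord (ω : Sample n p) (w h : EuclideanSpace ℝ (Fin p)) {s : ℝ} (hs : 1 ≤ s) :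
    fullLogLik ν ω (w + s • h) - fullLogLik ν ω w
      ≤ s * (fullLogLik ν ω (w + h) - fullLogLik ν ω w) := by
  have h1 := hν.fullLogLik_le_tangent ω (w + h) ((-1 : ℝ) • h)
  have h2 := hν.fullLogLik_le_tangent ω (w + h) ((s - 1) • h)
  rw [score_smul] at h1 h2
  have e1 : w + h + (-1 : ℝ) • h = w := by simp
  have e2 : w + h + (s - 1) • h = w + s • h := by rw [sub_smul, one_smul]; abel
  rw [e1] at h1
  rw [e2] at h2
  nlinarith

/-- Since `b''(θ) ≤ b''(0) + |θ| sup |b'''|`, each summand is at most a multiple of the envelope of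
the largest covariate. Of the power `c ^ 3`, two factors come from the squared predictor and one
from the sum over `J`. -/
lemma curv_le {ω : Sample n p} {ρ t : ℝ} (hρ : 0 ≤ ρ) (ht : 0 ≤ t)
    (hZ : ∀ j, ∑ i, envelope ν ρ ((ω i).1 j) ≤ t * n)
    {J : Finset (Fin p)} {c : ℝ} (hc : (J.card : ℝ) ≤ c) {r : ℝ} (hr : c * r ≤ ρ)
    {w h : EuclideanSpace ℝ (Fin p)} (hw : SuppOn J w) (hwr : ‖w‖ ≤ r) (hh : SuppOn J h) :
    curv ν ω w h ≤ c ^ 3 * (iteratedDeriv 2 (cumulant ν) 0 + ρ) * t * n * ‖h‖ ^ 2 := by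
  have hc0 : 0 ≤ c := (Nat.cast_nonneg _).trans hc
  have hb := (hν.iteratedDeriv_two_cumulant_pos 0).le
  set b₀ := iteratedDeriv 2 (cumulant ν) 0
  have key : ∀ i, pred (ω i).1 h ^ 2 * iteratedDeriv 2 (cumulant ν) (pred (ω i).1 w)
      ≤ c ^ 2 * (b₀ + ρ) * ‖h‖ ^ 2 * ∑ j ∈ J, envelope ν ρ ((ω i).1 j) := by
    intro i
    obtain ⟨m, h1, h2, h3⟩ := exists_envelope_bound (ν := ν) hc hr (ω i).1
    have hg := thirdSup_nonneg (ν := ν) ρ m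
    have a1 : pred (ω i).1 h ^ 2 ≤ (c * |m| * ‖h‖) ^ 2 := sq_le_sq' (by
      have := (abs_le.1 (h1 h hh)).1; linarith) (abs_le.1 (h1 h hh)).2
    have a2 : iteratedDeriv 2 (cumulant ν) (pred (ω i).1 w) ≤ b₀ + thirdSup ν ρ m * (ρ * |m|) := by
      have h0 : |(0 : ℝ)| ≤ ρ * |m| := by rw [abs_zero]; positivity
      have := (le_abs_self _).trans (hν.abs_sub_le_thirdSup (h2 w hw hwr) h0)
      rw [sub_zero] at this
      have := mul_le_mul_of_nonneg_left (h2 w hw hwr) hg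
      linarith
    calc _ ≤ (c * |m| * ‖h‖) ^ 2 * (b₀ + thirdSup ν ρ m * (ρ * |m|)) :=
          mul_le_mul a1 a2 (hν.iteratedDeriv_two_cumulant_pos _).le (sq_nonneg _)
      _ = c ^ 2 * ‖h‖ ^ 2 * (b₀ * m ^ 2 + ρ * (|m| ^ 3 * thirdSup ν ρ m)) := by
          rw [← sq_abs m]; ring
      _ ≤ c ^ 2 * ‖h‖ ^ 2 * (b₀ * envelope ν ρ m + ρ * envelope ν ρ m) := by
          unfold envelope
          gcongr
          · have : 0 ≤ |m| ^ 3 * thirdSup ν ρ m := by positivity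
            linarith
          · have := sq_nonneg m
            linarith
      _ = c ^ 2 * (b₀ + ρ) * ‖h‖ ^ 2 * envelope ν ρ m := by ring
      _ ≤ _ := by gcongr
  calc curv ν ω w h ≤ ∑ i, c ^ 2 * (b₀ + ρ) * ‖h‖ ^ 2 * ∑ j ∈ J, envelope ν ρ ((ω i).1 j) :=
        Finset.sum_le_sum fun i _ => key i
    _ = c ^ 2 * (b₀ + ρ) * ‖h‖ ^ 2 * ∑ i, ∑ j ∈ J, envelope ν ρ ((ω i).1 j) := by
        rw [Finset.mul_sum]
    _ ≤ c ^ 2 * (b₀ + ρ) * ‖h‖ ^ 2 * (c * t * n) := by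
        gcongr
        exact sum_envelope_le ht hZ hc
    _ = _ := by ring

/-- The mean value theorem for `b''` contributes `sup |b'''|` and a third predictor, hence the term
`|x| ^ 3 * sup |b'''|` of the envelope. -/
lemma abs_curv_sub_le {ω : Sample n p} {ρ t : ℝ} (ht : 0 ≤ t)
    (hZ : ∀ j, ∑ i, envelope ν ρ ((ω i).1 j) ≤ t * n)
    {J : Finset (Fin p)} {c : ℝ} (hc : (J.card : ℝ) ≤ c) {r : ℝ} (hr : c * r ≤ ρ)
    {w w' h : EuclideanSpace ℝ (Fin p)} (hw : SuppOn J w) (hwr : ‖w‖ ≤ r)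
    (hw' : SuppOn J w') (hwr' : ‖w'‖ ≤ r) (hh : SuppOn J h) :
    |curv ν ω w h - curv ν ω w' h| ≤ c ^ 4 * t * n * ‖w - w'‖ * ‖h‖ ^ 2 := by
  have hc0 : 0 ≤ c := (Nat.cast_nonneg _).trans hc
  have key : ∀ i, |pred (ω i).1 h ^ 2 * iteratedDeriv 2 (cumulant ν) (pred (ω i).1 w)
      - pred (ω i).1 h ^ 2 * iteratedDeriv 2 (cumulant ν) (pred (ω i).1 w')|
      ≤ c ^ 3 * ‖w - w'‖ * ‖h‖ ^ 2 * ∑ j ∈ J, envelope ν ρ ((ω i).1 j) := by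
    intro i
    obtain ⟨m, h1, h2, h3⟩ := exists_envelope_bound (ν := ν) hc hr (ω i).1
    have hg := thirdSup_nonneg (ν := ν) ρ m
    have a1 : pred (ω i).1 h ^ 2 ≤ (c * |m| * ‖h‖) ^ 2 := sq_le_sq' (by
      have := (abs_le.1 (h1 h hh)).1; linarith) (abs_le.1 (h1 h hh)).2
    have a2 := hν.abs_sub_le_thirdSup (h2 w hw hwr) (h2 w' hw' hwr')
    rw [← pred_sub] at a2
    have a3 := h1 _ (hw.sub hw')
    rw [← mul_sub, abs_mul, abs_of_nonneg (sq_nonneg _)]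
    calc _ ≤ (c * |m| * ‖h‖) ^ 2 * (thirdSup ν ρ m * (c * |m| * ‖w - w'‖)) := by
          refine mul_le_mul a1 (a2.trans ?_) (abs_nonneg _) (sq_nonneg _)
          gcongr
      _ = c ^ 3 * ‖w - w'‖ * ‖h‖ ^ 2 * (|m| ^ 3 * thirdSup ν ρ m) := by ring
      _ ≤ c ^ 3 * ‖w - w'‖ * ‖h‖ ^ 2 * envelope ν ρ m := by
          unfold envelope
          have := sq_nonneg m
          gcongr
          linarith
      _ ≤ _ := by gcongr
  calc |curv ν ω w h - curv ν ω w' h|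
      ≤ ∑ i, c ^ 3 * ‖w - w'‖ * ‖h‖ ^ 2 * ∑ j ∈ J, envelope ν ρ ((ω i).1 j) := by
        unfold curv
        rw [← Finset.sum_sub_distrib]
        exact (Finset.abs_sum_le_sum_abs _ _).trans (Finset.sum_le_sum fun i _ => key i)
    _ = c ^ 3 * ‖w - w'‖ * ‖h‖ ^ 2 * ∑ i, ∑ j ∈ J, envelope ν ρ ((ω i).1 j) := by
        rw [Finset.mul_sum]
    _ ≤ c ^ 3 * ‖w - w'‖ * ‖h‖ ^ 2 * (c * t * n) := by
        gcongr
        exact sum_envelope_le ht hZ hc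
    _ = _ := by ring

end IsExpFamilyBase

end FullModel

/-! ### The law of the sample -/

section Law

variable {ν : Measure ℝ} {p n : ℕ} {μ : Measure (Fin p → ℝ)} {φ : EuclideanSpace ℝ (Fin p)}

lemma measurable_pred (w : EuclideanSpace ℝ (Fin p)) : Measurable fun x : Fin p → ℝ => pred x w := by
  unfold pred
  fun_prop

/-! ### Marginals of the sample law and likelihood ratios. -/

namespace IsExpFamilyBase

variable (hν : IsExpFamilyBase ν)

include hν

lemma lintegral_density (θ : ℝ) :
    ∫⁻ y, ENNReal.ofReal (Real.exp (y * θ - cumulant ν θ)) ∂ν = 1 := by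
  have h : ∀ y, Real.exp (y * θ - cumulant ν θ)
      = Real.exp (θ * y) * (Real.exp (cumulant ν θ))⁻¹ := fun y => by
    rw [sub_eq_add_neg, Real.exp_add, Real.exp_neg, mul_comm y]
  simp_rw [h]
  rw [← ofReal_integral_eq_lintegral_ofReal ((hν.integrable_exp θ).mul_const _)
    (ae_of_all _ fun y => by positivity), integral_mul_const, ← hν.exp_cumulant,
    mul_inv_cancel₀ (Real.exp_ne_zero _), ENNReal.ofReal_one]

lemma measurable_density (w : EuclideanSpace ℝ (Fin p)) :
    Measurable fun z : (Fin p → ℝ) × ℝ =>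
      ENNReal.ofReal (Real.exp (z.2 * pred z.1 w - cumulant ν (pred z.1 w))) := by
  have h1 : Measurable fun z : (Fin p → ℝ) × ℝ => pred z.1 w :=
    (measurable_pred w).comp measurable_fst
  have h2 := hν.measurable_cumulant.comp h1
  exact ((measurable_snd.mul h1).sub h2).exp.ennreal_ofReal

lemma lintegral_obsLaw [SFinite μ] {F : (Fin p → ℝ) × ℝ → ENNReal} (hF : Measurable F) :
    ∫⁻ z, F z ∂(obsLaw ν μ φ) = ∫⁻ x, ∫⁻ y,
      ENNReal.ofReal (Real.exp (y * pred x φ - cumulant ν (pred x φ))) * F (x, y) ∂ν ∂μ := by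
  have := hν.isFiniteMeasure
  have hm := hν.measurable_density φ
  change ∫⁻ z, F z ∂((μ.prod ν).withDensity fun z =>
    ENNReal.ofReal (Real.exp (z.2 * pred z.1 φ - cumulant ν (pred z.1 φ)))) = _
  rw [lintegral_withDensity_eq_lintegral_mul _ hm hF, lintegral_prod _ (hm.mul hF).aemeasurable]
  rfl

lemma lintegral_obsLaw_fst [SFinite μ] {g : (Fin p → ℝ) → ENNReal} (hg : Measurable g) :
    ∫⁻ z, g z.1 ∂(obsLaw ν μ φ) = ∫⁻ x, g x ∂μ := by
  rw [hν.lintegral_obsLaw (F := fun z => g z.1) (hg.comp measurable_fst)]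
  refine lintegral_congr fun x => ?_
  dsimp only
  rw [lintegral_mul_const _ (by fun_prop), hν.lintegral_density, one_mul]

lemma map_fst_obsLaw [SFinite μ] : (obsLaw ν μ φ).map Prod.fst = μ := by
  ext s hs
  rw [← lintegral_indicator_one hs, lintegral_map (measurable_one.indicator hs) measurable_fst,
    hν.lintegral_obsLaw_fst (measurable_one.indicator hs), lintegral_indicator_one hs]

lemma isProbabilityMeasure_obsLaw [IsProbabilityMeasure μ] :
    IsProbabilityMeasure (obsLaw ν μ φ) := by
  constructor
  have := hν.lintegral_obsLaw_fst (μ := μ) (φ := φ) (g := fun _ => 1) measurable_const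
  simpa using this

lemma isProbabilityMeasure_sampleLaw [IsProbabilityMeasure μ] :
    IsProbabilityMeasure (sampleLaw ν n μ φ) := by
  have := hν.isProbabilityMeasure_obsLaw (μ := μ) (φ := φ)
  unfold sampleLaw
  infer_instance

lemma map_cov_sampleLaw [IsProbabilityMeasure μ] :
    (sampleLaw ν n μ φ).map (fun ω i => (ω i).1) = Measure.pi fun _ : Fin n => μ := by
  have := hν.isProbabilityMeasure_obsLaw (μ := μ) (φ := φ)
  have h1 := Measure.pi_map_pi (μ := fun _ : Fin n => obsLaw ν μ φ)
    (f := fun _ => Prod.fst) (fun _ => measurable_fst.aemeasurable)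
  simpa only [hν.map_fst_obsLaw, sampleLaw] using h1

/-- The outer probability of an event that concerns the covariates only. -/
lemma sampleLaw_cov_le [IsProbabilityMeasure μ] (A : Set (Fin n → Fin p → ℝ)) :
    sampleLaw ν n μ φ {ω | (fun i => (ω i).1) ∈ A} ≤ Measure.pi (fun _ : Fin n => μ) A := by
  have hm : Measurable fun (ω : Sample n p) i => (ω i).1 := by fun_prop
  -- The events of interest quantify over uncountably many parameters and `A` is not assumed
  -- measurable, so it is replaced by its measurable hull.
  rw [← measure_toMeasurable A, ← hν.map_cov_sampleLaw (φ := φ),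
    Measure.map_apply hm (measurableSet_toMeasurable _ _)]
  exact measure_mono fun ω hω => subset_toMeasurable _ _ hω

/-- Multiplying the density at `φ` by the ratio gives the density at `w`, which again integrates to
1; independence makes the expectation a product. -/
lemma lintegral_likelihood_ratio [IsProbabilityMeasure μ] (w : EuclideanSpace ℝ (Fin p)) :
    ∫⁻ ω, ENNReal.ofReal (Real.exp (fullLogLik ν ω w - fullLogLik ν ω φ))
      ∂(sampleLaw ν n μ φ) = 1 := by
  have := hν.isProbabilityMeasure_obsLaw (μ := μ) (φ := φ)
  set g : (Fin p → ℝ) × ℝ → ENNReal := fun z => ENNReal.ofReal (Real.exp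
    ((z.2 * pred z.1 w - cumulant ν (pred z.1 w))
      - (z.2 * pred z.1 φ - cumulant ν (pred z.1 φ)))) with hg
  have hpm : ∀ w : EuclideanSpace ℝ (Fin p),
      Measurable fun z : (Fin p → ℝ) × ℝ => z.2 * pred z.1 w - cumulant ν (pred z.1 w) := by
    intro w
    have h1 : Measurable fun z : (Fin p → ℝ) × ℝ => pred z.1 w :=
      (measurable_pred w).comp measurable_fst
    exact (measurable_snd.mul h1).sub (hν.measurable_cumulant.comp h1)
  have hgm : Measurable g := ((hpm w).sub (hpm φ)).exp.ennreal_ofReal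
  have h1 : ∫⁻ z, g z ∂(obsLaw ν μ φ) = 1 := by
    rw [hν.lintegral_obsLaw hgm]
    have : ∀ x, ∫⁻ y, ENNReal.ofReal (Real.exp (y * pred x φ - cumulant ν (pred x φ)))
        * g (x, y) ∂ν = 1 := by
      intro x
      rw [← hν.lintegral_density (pred x w)]
      refine lintegral_congr fun y => ?_
      rw [hg, ← ENNReal.ofReal_mul (Real.exp_pos _).le, ← Real.exp_add]
      congr 2
      ring
    simp [this]
  have h2 : ∀ ω : Sample n p,
      ENNReal.ofReal (Real.exp (fullLogLik ν ω w - fullLogLik ν ω φ)) = ∏ i, g (ω i) := by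
    intro ω
    rw [fullLogLik, fullLogLik, ← Finset.sum_sub_distrib, Real.exp_sum,
      ENNReal.ofReal_prod_of_nonneg fun _ _ => (Real.exp_pos _).le]
  simp_rw [h2, sampleLaw]
  rw [lintegral_prod_eq_prod_lintegral_of_indepFun Finset.univ (fun i (ω : Sample n p) => g (ω i))
    (iIndepFun_pi fun _ => hgm.aemeasurable) fun i => hgm.comp (measurable_pi_apply i)]
  refine Finset.prod_eq_one fun i _ => ?_
  rw [(measurePreserving_eval (fun _ : Fin n => obsLaw ν μ φ) i).lintegral_comp hgm, h1]

/-- Markov's inequality for a variable of mean 1. This is the only control of the responses in the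
whole argument. -/
lemma sampleLaw_likelihood_ratio_gt_le [IsProbabilityMeasure μ] (w : EuclideanSpace ℝ (Fin p))
    (a : ℝ) : sampleLaw ν n μ φ {ω | a < fullLogLik ν ω w - fullLogLik ν ω φ}
      ≤ ENNReal.ofReal (Real.exp (-a)) := by
  have hpm : ∀ w : EuclideanSpace ℝ (Fin p), Measurable fun ω : Sample n p => fullLogLik ν ω w := by
    intro w
    unfold fullLogLik
    refine Finset.measurable_fun_sum _ fun i _ => ?_
    have h1 : Measurable fun ω : Sample n p => pred (ω i).1 w :=
      (measurable_pred w).comp (by fun_prop)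
    exact (Measurable.mul (by fun_prop) h1).sub (hν.measurable_cumulant.comp h1)
  have h := mul_meas_ge_le_lintegral₀ (μ := sampleLaw ν n μ φ)
    ((hpm w).sub (hpm φ)).exp.ennreal_ofReal.aemeasurable (ENNReal.ofReal (Real.exp a))
  simp only [Pi.sub_apply] at h
  rw [hν.lintegral_likelihood_ratio w] at h
  rw [Real.exp_neg, ENNReal.ofReal_inv_of_pos (Real.exp_pos a), ENNReal.le_inv_iff_mul_le, mul_comm]
  refine le_trans (mul_le_mul_right (measure_mono fun ω hω => ?_) _) h
  exact ENNReal.ofReal_le_ofReal (Real.exp_le_exp.2 (le_of_lt hω))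

/-- All single-coordinate perturbations of the true parameter have a controlled likelihood. -/
lemma sampleLaw_perturbation_le [IsProbabilityMeasure μ] (u a : ℝ) :
    sampleLaw ν n μ φ {ω | ¬ ∀ j : Fin p, ∀ s : ℝ, |s| = u →
      fullLogLik ν ω (φ + EuclideanSpace.single j s) - fullLogLik ν ω φ ≤ a}
      ≤ ENNReal.ofReal (2 * p * Real.exp (-a)) := by
  have hsub : {ω : Sample n p | ¬ ∀ j : Fin p, ∀ s : ℝ, |s| = u →
      fullLogLik ν ω (φ + EuclideanSpace.single j s) - fullLogLik ν ω φ ≤ a}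
      ⊆ ⋃ jε : Fin p × Bool, {ω | a < fullLogLik ν ω
        (φ + EuclideanSpace.single jε.1 (if jε.2 then u else -u)) - fullLogLik ν ω φ} := by
    intro ω hω
    simp only [Set.mem_ofPred_eq, not_forall, not_le] at hω
    obtain ⟨j, s, hs, h⟩ := hω
    rcases eq_or_eq_neg_of_abs_eq hs with rfl | rfl
    · exact Set.mem_iUnion.2 ⟨(j, true), by simpa using h⟩
    · exact Set.mem_iUnion.2 ⟨(j, false), by simpa using h⟩
  refine (measure_mono hsub).trans ((measure_iUnion_fintype_le _ _).trans ?_)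
  refine (Finset.sum_le_sum fun jε _ => hν.sampleLaw_likelihood_ratio_gt_le _ a).trans ?_
  rw [Finset.sum_const, nsmul_eq_mul, Finset.card_univ, Fintype.card_prod, Fintype.card_fin,
    Fintype.card_bool, ENNReal.ofReal_mul (by positivity), mul_comm p 2]
  refine mul_le_mul_left (le_of_eq ?_) _
  rw [← ENNReal.ofReal_natCast]
  push_cast
  rfl

end IsExpFamilyBase

end Law

/-! ### A moment inequality for sums of independent variables -/

section Moments

lemma pow_le_one_add_pow {x : ℝ} (hx : 0 ≤ x) {k K : ℕ} (h : k ≤ K) : x ^ k ≤ 1 + x ^ K := by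
  rcases le_total x 1 with h1 | h1
  · have := pow_le_one₀ hx h1 (n := k)
    have := pow_nonneg hx K
    linarith
  · have := pow_le_pow_right₀ h1 h
    linarith

/-- The two top powers of `s` are kept exactly, because the linear term in `z` will have expectation
0. Every other term contains `z ^ 2`, and the mixed power `|s| ^ k * |z| ^ (2m - k)` that remains is
at most the larger of `s ^ (2m)` and `z ^ (2m)`. The binomial coefficients sum to at most `2 ^ (2m +
2)`. -/
lemma add_pow_even_le (s z : ℝ) (m : ℕ) :
    (s + z) ^ (2 * (m + 1)) ≤ s ^ (2 * (m + 1)) + (2 * (m + 1)) * (s ^ (2 * m + 1) * z)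
      + 4 ^ (m + 1) * (s ^ (2 * m) * z ^ 2 + z ^ (2 * (m + 1))) := by
  have hterm : ∀ k ∈ Finset.range (2 * m + 1),
      s ^ k * z ^ (2 * (m + 1) - k) * ((2 * (m + 1)).choose k : ℝ)
        ≤ ((2 * (m + 1)).choose k : ℝ) * (s ^ (2 * m) * z ^ 2 + z ^ (2 * (m + 1))) := by
    intro k hk
    have hk' : k ≤ 2 * m := by simpa [Nat.lt_succ_iff] using hk
    have e1 : z ^ (2 * (m + 1) - k) = z ^ (2 * m - k) * z ^ 2 := by
      rw [← pow_add]; congr 1; omega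
    have e2 : z ^ (2 * (m + 1)) = z ^ (2 * m) * z ^ 2 := by rw [← pow_add]; congr 1
    have e3 : s ^ k * z ^ (2 * m - k) ≤ s ^ (2 * m) + z ^ (2 * m) := by
      refine (le_abs_self _).trans ?_
      rw [abs_mul, abs_pow, abs_pow, pow_mul s, pow_mul z, ← sq_abs s, ← sq_abs z, ← pow_mul,
        ← pow_mul]
      rcases le_total |s| |z| with h | h
      · calc |s| ^ k * |z| ^ (2 * m - k) ≤ |z| ^ k * |z| ^ (2 * m - k) := by gcongr
          _ = |z| ^ (2 * m) := by rw [← pow_add]; congr 1; omega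
          _ ≤ _ := by have : 0 ≤ |s| ^ (2 * m) := by positivity
                      linarith
      · calc |s| ^ k * |z| ^ (2 * m - k) ≤ |s| ^ k * |s| ^ (2 * m - k) := by gcongr
          _ = |s| ^ (2 * m) := by rw [← pow_add]; congr 1; omega
          _ ≤ _ := by have : 0 ≤ |z| ^ (2 * m) := by positivity
                      linarith
    rw [e1, e2]
    calc _ = ((2 * (m + 1)).choose k : ℝ) * ((s ^ k * z ^ (2 * m - k)) * z ^ 2) := by ring
      _ ≤ ((2 * (m + 1)).choose k : ℝ) * ((s ^ (2 * m) + z ^ (2 * m)) * z ^ 2) := by gcongr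
      _ = _ := by ring
  have hsum : ∑ k ∈ Finset.range (2 * m + 1), ((2 * (m + 1)).choose k : ℝ) ≤ 4 ^ (m + 1) := by
    have h1 : ∑ k ∈ Finset.range (2 * (m + 1) + 1), ((2 * (m + 1)).choose k : ℝ)
        = 2 ^ (2 * (m + 1)) := by exact_mod_cast Nat.sum_range_choose (2 * (m + 1))
    rw [pow_mul] at h1
    norm_num at h1
    rw [← h1]
    exact Finset.sum_le_sum_of_subset_of_nonneg (Finset.range_subset_range.2 (by omega))
      fun _ _ _ => Nat.cast_nonneg _
  have hnn : 0 ≤ s ^ (2 * m) * z ^ 2 + z ^ (2 * (m + 1)) := by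
    rw [pow_mul, pow_mul]; positivity
  rw [add_pow, show 2 * (m + 1) + 1 = 2 * m + 1 + 1 + 1 by ring, Finset.sum_range_succ,
    Finset.sum_range_succ]
  have c1 : (2 * (m + 1)).choose (2 * m + 1) = 2 * (m + 1) := by
    rw [show 2 * (m + 1) = 2 * m + 1 + 1 by ring]; simp
  have c2 : 2 * (m + 1) - (2 * m + 1) = 1 := by omega
  have c3 : 2 * (m + 1) - (2 * m + 1 + 1) = 0 := by omega
  have c4 : (2 * (m + 1)).choose (2 * m + 1 + 1) = 1 := by
    rw [show 2 * (m + 1) = 2 * m + 1 + 1 by ring]; simp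
  rw [c1, c2, c3, c4]
  have h2 := (Finset.sum_le_sum hterm).trans_eq (Finset.sum_mul _ _ _).symm
  have h3 := h2.trans (mul_le_mul_of_nonneg_right hsum hnn)
  have e4 : s ^ (2 * m + 1 + 1) = s ^ (2 * (m + 1)) := by congr 1
  rw [e4]
  push_cast
  linarith

/-- The constants of the moment inequality `integral_sum_pow_le`. -/
def momentConst (M : ℝ) : ℕ → ℝ
  | 0 => 1
  | m + 1 => 4 ^ (m + 1) * (momentConst M m * M + M)

lemma momentConst_nonneg {M : ℝ} (hM : 0 ≤ M) : ∀ m, 0 ≤ momentConst M m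
  | 0 => zero_le_one
  | m + 1 => by
    have := momentConst_nonneg hM m
    unfold momentConst
    positivity

variable {Ω ι : Type*} {mΩ : MeasurableSpace Ω} {P : Measure Ω}

lemma integrable_pow_of_le [IsFiniteMeasure P] {f : Ω → ℝ} (hf : Measurable f) {k K : ℕ}
    (hk : k ≤ K) (hi : Integrable (fun a => |f a| ^ K) P) : Integrable (fun a => f a ^ k) P := by
  refine ((integrable_const 1).add hi).mono' (hf.pow_const k).aestronglyMeasurable
    (ae_of_all _ fun a => ?_)
  rw [Real.norm_eq_abs, abs_pow]
  exact pow_le_one_add_pow (abs_nonneg _) hk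

lemma integrable_abs_sum_pow [IsFiniteMeasure P] {ξ : ι → Ω → ℝ} (hm : ∀ i, Measurable (ξ i))
    {K : ℕ} (hi : ∀ i, Integrable (fun a => |ξ i a| ^ K) P) (s : Finset ι) :
    Integrable (fun a => |∑ i ∈ s, ξ i a| ^ K) P := by
  classical
  induction s using Finset.induction_on with
  | empty => simp
  | insert i s his ih =>
    refine (((hi i).add ih).const_mul (2 ^ (K - 1))).mono'
      (((Finset.measurable_fun_sum _ fun i _ => hm i).abs.pow_const K).aestronglyMeasurable)
      (ae_of_all _ fun a => ?_)
    rw [Real.norm_eq_abs, abs_pow, abs_abs, Finset.sum_insert his]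
    calc |ξ i a + ∑ i ∈ s, ξ i a| ^ K ≤ (|ξ i a| + |∑ i ∈ s, ξ i a|) ^ K := by
          gcongr; exact abs_add_le _ _
      _ ≤ _ := add_pow_le (abs_nonneg _) (abs_nonneg _) K

/-- Induction on the order and, inside it, on the number of summands. By independence and centering,
adding a summand raises the moment of order `2(m + 1)` only through `E S^{2m} E ξ² + E ξ^{2(m+1)}`,
which is of order `card ^ m` by the outer hypothesis; accumulating these increments yields `card ^
(m + 1)`. -/
lemma integral_sum_pow_le [IsProbabilityMeasure P] {ξ : ι → Ω → ℝ} (hind : iIndepFun ξ P)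
    (hm : ∀ i, Measurable (ξ i)) {M : ℝ} (hM : 0 ≤ M) (h0 : ∀ i, ∫ a, ξ i a ∂P = 0) (m : ℕ)
    (hi : ∀ i, Integrable (fun a => |ξ i a| ^ (2 * m)) P)
    (hb : ∀ i, ∀ k ≤ m, ∫ a, ξ i a ^ (2 * k) ∂P ≤ M) (s : Finset ι) :
    ∫ a, (∑ i ∈ s, ξ i a) ^ (2 * m) ∂P ≤ momentConst M m * (s.card : ℝ) ^ m := by
  classical
  induction m generalizing s with
  | zero => simp [momentConst]
  | succ m ihm =>
    have hi' : ∀ i, Integrable (fun a => |ξ i a| ^ (2 * m)) P := fun i => by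
      have := integrable_pow_of_le (f := fun a => |ξ i a|) (hm i).abs
        (k := 2 * m) (K := 2 * (m + 1)) (by omega)
        (by simpa only [abs_abs] using hi i)
      exact this
    have ihm := ihm hi' fun i k hk => hb i k (hk.trans m.le_succ)
    have hC := momentConst_nonneg hM m
    induction s using Finset.induction_on with
    | empty => simp
    | insert i s his ihs =>
      set S : Ω → ℝ := fun a => ∑ i ∈ s, ξ i a with hS
      have hSm : Measurable S := Finset.measurable_fun_sum _ fun i _ => hm i
      have hSi := integrable_abs_sum_pow hm hi s
      have hindep : S ⟂ᵢ[P] ξ i := by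
        have := hind.indepFun_finsetSum_of_notMem hm his
        convert this using 1
        ext a
        simp [hS]
      have hprod : ∀ k l : ℕ, k ≤ 2 * (m + 1) → l ≤ 2 * (m + 1) →
          Integrable (fun a => S a ^ k * ξ i a ^ l) P ∧
            ∫ a, S a ^ k * ξ i a ^ l ∂P = (∫ a, S a ^ k ∂P) * ∫ a, ξ i a ^ l ∂P := by
        intro k l hk hl
        have hkl := hindep.comp (measurable_id.pow_const k) (measurable_id.pow_const l)
        exact ⟨hkl.integrable_mul (integrable_pow_of_le hSm hk hSi)
          (integrable_pow_of_le (hm i) hl (hi i)),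
          hkl.integral_fun_mul_eq_mul_integral (hSm.pow_const k).aestronglyMeasurable
          ((hm i).pow_const l).aestronglyMeasurable⟩
      have i1 := integrable_pow_of_le hSm le_rfl hSi
      have i2 := hprod (2 * m + 1) 1 (by omega) (by omega)
      have i3 := hprod (2 * m) 2 (by omega) (by omega)
      have i4 := integrable_pow_of_le (hm i) le_rfl (hi i)
      simp only [pow_one] at i2
      rw [h0 i, mul_zero] at i2
      have hA : Integrable (fun a => S a ^ (2 * (m + 1))
          + (2 * ((m : ℝ) + 1)) * (S a ^ (2 * m + 1) * ξ i a)) P := i1.add (i2.1.const_mul _)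
      have hB : Integrable (fun a => (4 : ℝ) ^ (m + 1)
          * (S a ^ (2 * m) * ξ i a ^ 2 + ξ i a ^ (2 * (m + 1)))) P := (i3.1.add i4).const_mul _
      have hle : ∫ a, (∑ i ∈ insert i s, ξ i a) ^ (2 * (m + 1)) ∂P
          ≤ ∫ a, (S a ^ (2 * (m + 1)) + (2 * (m + 1)) * (S a ^ (2 * m + 1) * ξ i a)
            + 4 ^ (m + 1) * (S a ^ (2 * m) * ξ i a ^ 2 + ξ i a ^ (2 * (m + 1)))) ∂P := by
        refine integral_mono
          (integrable_pow_of_le (Finset.measurable_fun_sum _ fun i _ => hm i) le_rfl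
            (integrable_abs_sum_pow hm hi _))
          (hA.add hB) fun a => ?_
        dsimp only
        rw [Finset.sum_insert his, add_comm (ξ i a)]
        exact add_pow_even_le _ _ m
      rw [integral_add hA hB,
        integral_add i1 (i2.1.const_mul _), integral_const_mul, integral_const_mul,
        integral_add i3.1 i4, i2.2, i3.2, mul_zero, add_zero] at hle
      have b1 := ihm s
      have b2 : ∫ a, ξ i a ^ 2 ∂P ≤ M := by simpa using hb i 1 (by omega)
      have b3 := hb i (m + 1) le_rfl
      have b4 : 0 ≤ ∫ a, ξ i a ^ 2 ∂P := integral_nonneg fun a => sq_nonneg _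
      have b5 : (∫ a, S a ^ (2 * m) ∂P) * ∫ a, ξ i a ^ 2 ∂P
          ≤ momentConst M m * (s.card : ℝ) ^ m * M := mul_le_mul b1 b2 b4 (by positivity)
      rw [Finset.card_insert_of_notMem his]
      set c : ℝ := (s.card : ℝ) with hc
      have hc0 : 0 ≤ c := Nat.cast_nonneg _
      have hcm : c ^ m ≤ (c + 1) ^ m := by gcongr; linarith
      have hc1 : 1 ≤ (c + 1) ^ m := one_le_pow₀ (by linarith)
      calc _ ≤ _ := hle
        _ ≤ momentConst M (m + 1) * c ^ (m + 1)
            + 4 ^ (m + 1) * (momentConst M m * (c + 1) ^ m * M + M * (c + 1) ^ m) := by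
          have b6 : (∫ a, S a ^ (2 * m) ∂P) * ∫ a, ξ i a ^ 2 ∂P
              ≤ momentConst M m * (c + 1) ^ m * M := b5.trans (by gcongr)
          have b7 : M ≤ M * (c + 1) ^ m := le_mul_of_one_le_right hM hc1
          exact add_le_add ihs (mul_le_mul_of_nonneg_left
            (add_le_add b6 (b3.trans b7)) (by positivity))
        _ = momentConst M (m + 1) * (c ^ m * c + (c + 1) ^ m) := by
          rw [momentConst]; ring
        _ ≤ momentConst M (m + 1) * ((c + 1) ^ m * c + (c + 1) ^ m) := by
          have := momentConst_nonneg hM (m + 1)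
          gcongr
        _ = momentConst M (m + 1) * ((s.card + 1 : ℕ) : ℝ) ^ (m + 1) := by
          push_cast; ring

/-- Sums of independent copies of a nonnegative variable with a finite moment of order `2m`
exceed a large multiple of `n` with probability at most `n⁻ᵐ`. -/
lemma exists_sum_tail_bound {m : ℕ} (hm : 1 ≤ m) (M₀ : ℝ) :
    ∃ t : ℝ, 0 ≤ t ∧ ∀ {α : Type} [MeasurableSpace α] (μ : Measure α) [IsProbabilityMeasure μ]
      (f : α → ℝ), Measurable f → (∀ a, 0 ≤ f a) →
      ∫⁻ a, ENNReal.ofReal (f a ^ (2 * m)) ∂μ ≤ ENNReal.ofReal M₀ → ∀ n : ℕ, 1 ≤ n →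
      Measure.pi (fun _ : Fin n => μ) {x | t * n < ∑ i, f (x i)}
        ≤ ENNReal.ofReal (((n : ℝ) ^ m)⁻¹) := by
  set N := max M₀ 0 with hN
  have hN0 : 0 ≤ N := le_max_right _ _
  set M := 1 + 2 ^ (2 * m - 1) * (N + (1 + N) ^ (2 * m)) with hMdef
  have hM : 0 ≤ M := by positivity
  set C := momentConst M m
  have hC : 0 ≤ C := momentConst_nonneg hM m
  -- `1 + N` dominates the mean, so exceeding this multiple of `n` forces the centered sum above `(1
  -- + C) * n`.
  refine ⟨1 + N + (1 + C), by positivity, ?_⟩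
  intro α _ μ _ f hf hf0 hfm n hn
  have hlt : ∫⁻ a, ENNReal.ofReal (f a ^ (2 * m)) ∂μ < ⊤ := hfm.trans_lt ENNReal.ofReal_lt_top
  have hfi : Integrable (fun a => f a ^ (2 * m)) μ := by
    refine ⟨(hf.pow_const _).aestronglyMeasurable, ?_⟩
    rw [hasFiniteIntegral_iff_ofReal (ae_of_all _ fun a => pow_nonneg (hf0 a) _)]
    exact hlt
  have hfa : Integrable (fun a => |f a| ^ (2 * m)) μ := by
    simpa only [fun a => abs_of_nonneg (hf0 a)] using hfi
  have hfN : ∫ a, f a ^ (2 * m) ∂μ ≤ N := by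
    rw [integral_eq_lintegral_of_nonneg_ae (ae_of_all _ fun a => pow_nonneg (hf0 a) _)
      (hf.pow_const _).aestronglyMeasurable]
    refine (ENNReal.toReal_mono ENNReal.ofReal_ne_top hfm).trans_eq ?_
    rw [ENNReal.toReal_ofReal', hN]
  have hf1 : Integrable f μ := by
    simpa using integrable_pow_of_le hf (k := 1) (by omega) hfa
  set e := ∫ a, f a ∂μ with he
  have he0 : 0 ≤ e := integral_nonneg hf0
  have heN : e ≤ 1 + N := by
    calc e ≤ ∫ a, (1 + f a ^ (2 * m)) ∂μ :=
          integral_mono hf1 ((integrable_const _).add hfi) fun a => by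
            simpa using pow_le_one_add_pow (hf0 a) (k := 1) (K := 2 * m) (by omega)
      _ = 1 + ∫ a, f a ^ (2 * m) ∂μ := by
          rw [integral_add (integrable_const _) hfi]; simp
      _ ≤ 1 + N := by linarith
  set g : α → ℝ := fun a => f a - e with hg
  have hgm : Measurable g := hf.sub_const _
  have hgle : ∀ a, |g a| ^ (2 * m) ≤ 2 ^ (2 * m - 1) * (f a ^ (2 * m) + e ^ (2 * m)) := by
    intro a
    refine le_trans ?_ (add_pow_le (hf0 a) he0 (2 * m))
    gcongr
    rw [hg, abs_le]
    constructor <;> linarith [hf0 a]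
  have hgi : Integrable (fun a => |g a| ^ (2 * m)) μ := by
    refine ((hfi.add (integrable_const (e ^ (2 * m)))).const_mul (2 ^ (2 * m - 1))).mono'
      (hgm.abs.pow_const _).aestronglyMeasurable (ae_of_all _ fun a => ?_)
    rw [Real.norm_eq_abs, abs_pow, abs_abs]
    exact hgle a
  have hA : Integrable (fun a => 2 ^ (2 * m - 1) * (f a ^ (2 * m) + e ^ (2 * m))) μ :=
    (hfi.add (integrable_const _)).const_mul _
  have hgb : ∀ k ≤ m, ∫ a, g a ^ (2 * k) ∂μ ≤ M := by
    intro k hk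
    calc ∫ a, g a ^ (2 * k) ∂μ
        ≤ ∫ a, (1 + 2 ^ (2 * m - 1) * (f a ^ (2 * m) + e ^ (2 * m))) ∂μ := by
          refine integral_mono (integrable_pow_of_le hgm (by omega) hgi)
            ((integrable_const _).add hA) fun a => ?_
          refine (le_abs_self _).trans ?_
          rw [abs_pow]
          refine (pow_le_one_add_pow (abs_nonneg _) (K := 2 * m) (by omega)).trans ?_
          linarith [hgle a]
      _ = 1 + 2 ^ (2 * m - 1) * ((∫ a, f a ^ (2 * m) ∂μ) + e ^ (2 * m)) := by
          rw [integral_add (integrable_const _) hA,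
            integral_const_mul, integral_add hfi (integrable_const _)]
          simp
      _ ≤ M := by rw [hMdef]; gcongr
  have hmp : ∀ i : Fin n, MeasurePreserving (fun x : Fin n → α => x i)
      (Measure.pi fun _ : Fin n => μ) μ := fun i => measurePreserving_eval (fun _ : Fin n => μ) i
  have hgm' : ∀ i : Fin n, Measurable fun x : Fin n → α => g (x i) :=
    fun i => hgm.comp (measurable_pi_apply i)
  have hind : iIndepFun (fun (i : Fin n) (x : Fin n → α) => g (x i))
      (Measure.pi fun _ : Fin n => μ) := iIndepFun_pi fun _ => hgm.aemeasurable
  have hint : ∀ (F : α → ℝ) (_ : Measurable F) (i : Fin n),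
      ∫ x, F (x i) ∂(Measure.pi fun _ : Fin n => μ) = ∫ a, F a ∂μ := fun F hF i => by
    rw [← (hmp i).map_eq, integral_map (hmp i).measurable.aemeasurable
      hF.aestronglyMeasurable, (hmp i).map_eq]
  have hmom := integral_sum_pow_le hind hgm' hM
    (fun i => by
      rw [hint g hgm i, hg, integral_sub hf1 (integrable_const _)]
      simp [he]) m
    (fun i => (hmp i).integrable_comp_of_integrable hgi)
    (fun i k hk => by
      rw [hint (fun a => g a ^ (2 * k)) (hgm.pow_const _) i]
      exact hgb k hk) Finset.univ
  rw [Finset.card_univ, Fintype.card_fin] at hmom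
  have hn0 : (0 : ℝ) < n := by exact_mod_cast hn
  have hSint : Integrable (fun x : Fin n → α => (∑ i, g (x i)) ^ (2 * m))
      (Measure.pi fun _ : Fin n => μ) :=
    integrable_pow_of_le (Finset.measurable_fun_sum _ fun i _ => hgm' i) le_rfl
      (integrable_abs_sum_pow hgm' (fun i => (hmp i).integrable_comp_of_integrable hgi) _)
  have hmarkov := mul_meas_ge_le_integral_of_nonneg
    (ae_of_all _ fun x => (by rw [pow_mul]; positivity)) hSint (((1 + C) * n) ^ (2 * m))
  have hsub : {x : Fin n → α | (1 + N + (1 + C)) * n < ∑ i, f (x i)}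
      ⊆ {x | ((1 + C) * n) ^ (2 * m) ≤ (∑ i, g (x i)) ^ (2 * m)} := by
    intro x hx
    simp only [Set.mem_ofPred_eq] at hx ⊢
    refine pow_le_pow_left₀ (by positivity) ?_ _
    simp only [hg, Finset.sum_sub_distrib, Finset.sum_const, Finset.card_univ, Fintype.card_fin,
      nsmul_eq_mul]
    nlinarith
  refine (measure_mono hsub).trans ?_
  rw [← ofReal_measureReal]
  refine ENNReal.ofReal_le_ofReal ?_
  have h1 := hmarkov.trans hmom
  -- Markov's inequality leaves `C n^m / ((1 + C) n)^{2m}`; this inequality absorbs the constant and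
  -- leaves exactly `n⁻ᵐ`.
  have hpow : C ≤ (1 + C) ^ (2 * m) := by
    calc C ≤ 1 + C := by linarith
      _ ≤ (1 + C) ^ (2 * m) := le_self_pow₀ (by linarith) (by omega)
  set π := (Measure.pi fun _ : Fin n => μ).real
    {x | ((1 + C) * n) ^ (2 * m) ≤ (∑ i, g (x i)) ^ (2 * m)} with hπ
  have hπ0 : 0 ≤ π := measureReal_nonneg
  have hnm : (0 : ℝ) < (n : ℝ) ^ m := by positivity
  have hCm : 0 < (1 + C) ^ (2 * m) := by positivity
  have h2 : (1 + C) ^ (2 * m) * ((n : ℝ) ^ m * π) ≤ (1 + C) ^ (2 * m) := by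
    have e : ((1 + C) * (n : ℝ)) ^ (2 * m) * π
        = ((1 + C) ^ (2 * m) * ((n : ℝ) ^ m * π)) * (n : ℝ) ^ m := by
      rw [mul_pow, two_mul m, pow_add (n : ℝ)]; ring
    rw [e] at h1
    have := le_of_mul_le_mul_right h1 hnm
    linarith
  have h3 : (n : ℝ) ^ m * π ≤ 1 := by
    by_contra h
    push Not at h
    nlinarith
  rw [inv_eq_one_div, le_div_iff₀ hnm]
  linarith

end Moments

/-! ### The truncated Gram matrix -/

section Gram

variable {p n : ℕ}

lemma card_filter_card_le (hp : 1 ≤ p) (m : ℕ) :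
    (Finset.univ.filter fun J : Finset (Fin p) => J.card ≤ m).card ≤ (m + 1) * p ^ m := by
  have hsub : (Finset.univ.filter fun J : Finset (Fin p) => J.card ≤ m)
      ⊆ (Finset.range (m + 1)).biUnion fun k => Finset.powersetCard k Finset.univ := by
    intro J hJ
    simp only [Finset.mem_filter, Finset.mem_univ, true_and] at hJ
    simpa [Finset.mem_powersetCard, Nat.lt_succ_iff] using hJ
  refine (Finset.card_le_card hsub).trans (Finset.card_biUnion_le.trans ?_)
  calc ∑ k ∈ Finset.range (m + 1), (Finset.powersetCard k (Finset.univ : Finset (Fin p))).card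
      ≤ ∑ _k ∈ Finset.range (m + 1), p ^ m := by
        refine Finset.sum_le_sum fun k hk => ?_
        rw [Finset.card_powersetCard, Finset.card_univ, Fintype.card_fin]
        exact (Nat.choose_le_pow p k).trans
          (Nat.pow_le_pow_right hp (by simpa [Nat.lt_succ_iff] using hk))
    _ = (m + 1) * p ^ m := by simp

/-- The product `x j * x k`, truncated to covariate vectors with entries in `J` at most `M`. -/
def truncProd (J : Finset (Fin p)) (M : ℝ) (j k : Fin p) (x : Fin p → ℝ) : ℝ :=
  {x : Fin p → ℝ | ∀ l ∈ J, |x l| ≤ M}.indicator (fun x => x j * x k) x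

/-- The square of the linear predictor, truncated like `truncProd`. -/
def truncSq (J : Finset (Fin p)) (M : ℝ) (v : EuclideanSpace ℝ (Fin p)) (x : Fin p → ℝ) : ℝ :=
  {x : Fin p → ℝ | ∀ l ∈ J, |x l| ≤ M}.indicator (fun x => pred x v ^ 2) x

lemma measurableSet_trunc (J : Finset (Fin p)) (M : ℝ) :
    MeasurableSet {x : Fin p → ℝ | ∀ l ∈ J, |x l| ≤ M} := by
  have : {x : Fin p → ℝ | ∀ l ∈ J, |x l| ≤ M} = ⋂ l ∈ J, {x | |x l| ≤ M} := by
    ext x; simp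
  rw [this]
  exact Finset.measurableSet_biInter _ fun l _ =>
    measurableSet_le (measurable_pi_apply l).abs measurable_const

lemma measurable_truncProd (J : Finset (Fin p)) (M : ℝ) (j k : Fin p) :
    Measurable (truncProd J M j k) :=
  ((measurable_pi_apply j).mul (measurable_pi_apply k)).indicator (measurableSet_trunc J M)

lemma abs_truncProd_le {J : Finset (Fin p)} {M : ℝ} (hM : 0 ≤ M) {j k : Fin p} (hj : j ∈ J)
    (hk : k ∈ J) (x : Fin p → ℝ) : |truncProd J M j k x| ≤ M ^ 2 := by
  unfold truncProd
  by_cases hx : x ∈ {x : Fin p → ℝ | ∀ l ∈ J, |x l| ≤ M}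
  · rw [Set.indicator_of_mem hx, abs_mul, sq]
    exact mul_le_mul (hx j hj) (hx k hk) (abs_nonneg _) hM
  · rw [Set.indicator_of_notMem hx, abs_zero]
    positivity

lemma SuppOn.truncSq_eq {J : Finset (Fin p)} {v : EuclideanSpace ℝ (Fin p)} (hv : SuppOn J v)
    (M : ℝ) (x : Fin p → ℝ) :
    truncSq J M v x = ∑ j ∈ J, ∑ k ∈ J, v j * v k * truncProd J M j k x := by
  unfold truncSq truncProd
  by_cases hx : x ∈ {x : Fin p → ℝ | ∀ l ∈ J, |x l| ≤ M}
  · simp only [Set.indicator_of_mem hx]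
    rw [hv.pred_eq, sq, Finset.sum_mul_sum]
    exact Finset.sum_congr rfl fun _ _ => Finset.sum_congr rfl fun _ _ => by ring
  · simp only [Set.indicator_of_notMem hx]
    simp

/-- Where the truncation acts, `A = ∑ x_j²` is at least `M ^ 2`, so `A ≤ A ^ 2 / M ^ 2`, and `A ^ 2`
is bounded by fourth powers. Thus fourth moments bound what truncation loses. -/
lemma sq_pred_le_truncSq_add {J : Finset (Fin p)} {c : ℝ} (hc : (J.card : ℝ) ≤ c) {M : ℝ}
    (hM : 0 < M) {v : EuclideanSpace ℝ (Fin p)} (hv : SuppOn J v) (x : Fin p → ℝ) :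
    pred x v ^ 2 ≤ truncSq J M v x + ‖v‖ ^ 2 * c / M ^ 2 * ∑ j ∈ J, x j ^ 4 := by
  have hc0 : 0 ≤ c := (Nat.cast_nonneg _).trans hc
  have hs : 0 ≤ ∑ j ∈ J, x j ^ 4 := Finset.sum_nonneg fun j _ => by positivity
  by_cases hx : x ∈ {x : Fin p → ℝ | ∀ l ∈ J, |x l| ≤ M}
  · rw [truncSq, Set.indicator_of_mem hx]
    have : 0 ≤ ‖v‖ ^ 2 * c / M ^ 2 * ∑ j ∈ J, x j ^ 4 := by positivity
    linarith
  · rw [truncSq, Set.indicator_of_notMem hx, zero_add]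
    simp only [Set.mem_ofPred_eq, not_forall, not_le] at hx
    obtain ⟨l, hl, hlM⟩ := hx
    set A := ∑ j ∈ J, x j ^ 2 with hA
    have hA0 : 0 ≤ A := Finset.sum_nonneg fun j _ => sq_nonneg _
    have h1 : M ^ 2 ≤ A := by
      calc M ^ 2 ≤ |x l| ^ 2 := by gcongr
        _ = x l ^ 2 := sq_abs _
        _ ≤ A := Finset.single_le_sum (f := fun j => x j ^ 2) (fun j _ => sq_nonneg _) hl
    have h2 : pred x v ^ 2 ≤ A * ‖v‖ ^ 2 := by
      rw [hv.pred_eq]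
      refine (Finset.sum_mul_sq_le_sq_mul_sq J x v).trans ?_
      refine mul_le_mul_of_nonneg_left ?_ hA0
      rw [EuclideanSpace.norm_sq_eq]
      simp only [Real.norm_eq_abs, sq_abs]
      exact Finset.sum_le_sum_of_subset_of_nonneg (Finset.subset_univ _) fun _ _ _ => sq_nonneg _
    have h3 : A ^ 2 ≤ c * ∑ j ∈ J, x j ^ 4 := by
      have := sq_sum_le_card_mul_sum_sq (s := J) (f := fun j => x j ^ 2)
      simp only [← pow_mul] at this
      exact this.trans (by gcongr)
    calc pred x v ^ 2 ≤ A * ‖v‖ ^ 2 := h2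
      _ = A * M ^ 2 * ‖v‖ ^ 2 / M ^ 2 := by field_simp
      _ ≤ A * A * ‖v‖ ^ 2 / M ^ 2 := by gcongr
      _ = A ^ 2 * ‖v‖ ^ 2 / M ^ 2 := by ring
      _ ≤ (c * ∑ j ∈ J, x j ^ 4) * ‖v‖ ^ 2 / M ^ 2 := by gcongr
      _ = _ := by ring

lemma integrable_truncProd {μ : Measure (Fin p → ℝ)} [IsFiniteMeasure μ] {J : Finset (Fin p)}
    {M : ℝ} (hM : 0 ≤ M) {j k : Fin p} (hj : j ∈ J) (hk : k ∈ J) :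
    Integrable (truncProd J M j k) μ :=
  (integrable_const (M ^ 2)).mono' (measurable_truncProd J M j k).aestronglyMeasurable
    (ae_of_all _ fun x => abs_truncProd_le hM hj hk x)

lemma integrable_pow_four {μ : Measure (Fin p → ℝ)} {D : ℝ} {j : Fin p}
    (hD : ∫⁻ x, ENNReal.ofReal (x j ^ 4) ∂μ ≤ ENNReal.ofReal D) :
    Integrable (fun x : Fin p → ℝ => x j ^ 4) μ := by
  refine ⟨((measurable_pi_apply j).pow_const 4).aestronglyMeasurable, ?_⟩
  rw [hasFiniteIntegral_iff_ofReal (ae_of_all _ fun x => by positivity)]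
  exact hD.trans_lt ENNReal.ofReal_lt_top

lemma integral_pow_four_le {μ : Measure (Fin p → ℝ)} {D : ℝ} (hD0 : 0 ≤ D) {j : Fin p}
    (hD : ∫⁻ x, ENNReal.ofReal (x j ^ 4) ∂μ ≤ ENNReal.ofReal D) :
    ∫ x : Fin p → ℝ, x j ^ 4 ∂μ ≤ D := by
  rw [integral_eq_lintegral_of_nonneg_ae (ae_of_all _ fun x => by positivity)
    ((measurable_pi_apply j).pow_const 4).aestronglyMeasurable]
  exact (ENNReal.toReal_mono ENNReal.ofReal_ne_top hD).trans_eq (ENNReal.toReal_ofReal hD0)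

lemma integral_truncSq_ge {μ : Measure (Fin p → ℝ)} [IsProbabilityMeasure μ]
    {J : Finset (Fin p)} {c : ℝ} (hc : (J.card : ℝ) ≤ c) {M D a : ℝ} (hM : 0 < M) (hD0 : 0 ≤ D)
    (hMa : c ^ 2 * D / M ^ 2 ≤ a / 2)
    (hD : ∀ j, ∫⁻ x, ENNReal.ofReal (x j ^ 4) ∂μ ≤ ENNReal.ofReal D)
    {v : EuclideanSpace ℝ (Fin p)} (hv : SuppOn J v) (ha : a * ‖v‖ ^ 2 ≤ ∫ x, pred x v ^ 2 ∂μ) :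
    a / 2 * ‖v‖ ^ 2 ≤ ∑ j ∈ J, ∑ k ∈ J, v j * v k * ∫ x, truncProd J M j k x ∂μ := by
  have hc0 : 0 ≤ c := (Nat.cast_nonneg _).trans hc
  have hi : ∀ j ∈ J, ∀ k ∈ J, Integrable (fun x => v j * v k * truncProd J M j k x) μ :=
    fun j hj k hk => (integrable_truncProd hM.le hj hk).const_mul _
  have h1 : ∫ x, truncSq J M v x ∂μ
      = ∑ j ∈ J, ∑ k ∈ J, v j * v k * ∫ x, truncProd J M j k x ∂μ := by
    simp only [hv.truncSq_eq]
    rw [integral_finsetSum _ fun j hj => integrable_finsetSum _ fun k hk => hi j hj k hk]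
    refine Finset.sum_congr rfl fun j hj => ?_
    rw [integral_finsetSum _ fun k hk => hi j hj k hk]
    exact Finset.sum_congr rfl fun k _ => integral_const_mul _ _
  have h1i : Integrable (truncSq J M v) μ := by
    have : truncSq J M v = fun x => ∑ j ∈ J, ∑ k ∈ J, v j * v k * truncProd J M j k x :=
      funext fun x => hv.truncSq_eq M x
    rw [this]
    exact integrable_finsetSum _ fun j hj => integrable_finsetSum _ fun k hk => hi j hj k hk
  have h4i : Integrable (fun x : Fin p → ℝ => ∑ j ∈ J, x j ^ 4) μ :=
    integrable_finsetSum _ fun j _ => integrable_pow_four (hD j)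
  have h4 : ∫ x : Fin p → ℝ, ∑ j ∈ J, x j ^ 4 ∂μ ≤ c * D := by
    rw [integral_finsetSum _ fun j _ => integrable_pow_four (hD j)]
    calc _ ≤ ∑ j ∈ J, D := Finset.sum_le_sum fun j _ => integral_pow_four_le hD0 (hD j)
      _ = J.card * D := by rw [Finset.sum_const, nsmul_eq_mul]
      _ ≤ c * D := by gcongr
  -- Nonnegativity of the left integrand and integrability of the right one suffice here.
  have h2 : ∫ x, pred x v ^ 2 ∂μ
      ≤ ∫ x, (truncSq J M v x + ‖v‖ ^ 2 * c / M ^ 2 * ∑ j ∈ J, x j ^ 4) ∂μ :=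
    integral_mono_of_nonneg (ae_of_all _ fun x => sq_nonneg _) (h1i.add (h4i.const_mul _))
      (ae_of_all _ fun x => sq_pred_le_truncSq_add hc hM hv x)
  rw [integral_add h1i (h4i.const_mul _), integral_const_mul, h1] at h2
  have h3 : ‖v‖ ^ 2 * c / M ^ 2 * ∫ x : Fin p → ℝ, ∑ j ∈ J, x j ^ 4 ∂μ ≤ a / 2 * ‖v‖ ^ 2 := by
    calc _ ≤ ‖v‖ ^ 2 * c / M ^ 2 * (c * D) := by gcongr
      _ = c ^ 2 * D / M ^ 2 * ‖v‖ ^ 2 := by ring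
      _ ≤ _ := by gcongr
  linarith

/-- Hoeffding's inequality for independent copies of a bounded variable. -/
lemma pi_abs_sum_sub_gt_le {α : Type*} [MeasurableSpace α] {μ : Measure α}
    [IsProbabilityMeasure μ] {f : α → ℝ} (hf : Measurable f) {B : ℝ} (hB : ∀ a, |f a| ≤ B)
    {η : ℝ} (hη : 0 ≤ η) (n : ℕ) :
    Measure.pi (fun _ : Fin n => μ) {x | η * n < |∑ i, f (x i) - n * ∫ a, f a ∂μ|}
      ≤ ENNReal.ofReal (2 * Real.exp (-(η ^ 2 / (2 * B ^ 2)) * n)) := by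
  have hsub : HasSubgaussianMGF (fun a => f a - ∫ a, f a ∂μ) ((‖B - -B‖₊ / 2) ^ 2) μ :=
    hasSubgaussianMGF_of_mem_Icc hf.aemeasurable (ae_of_all _ fun a => abs_le.1 (hB a))
  set Q := Measure.pi (fun _ : Fin n => μ)
  have hone : ∀ g : α → ℝ, Measurable g → HasSubgaussianMGF g ((‖B - -B‖₊ / 2) ^ 2) μ →
      Q.real {x | η * n ≤ ∑ i, g (x i)} ≤ Real.exp (-(η ^ 2 / (2 * B ^ 2)) * n) := by
    intro g hg hs
    have h := HasSubgaussianMGF.measure_sum_ge_le_of_iIndepFun (s := Finset.univ)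
      (iIndepFun_pi (μ := fun _ : Fin n => μ) (X := fun _ => g) fun _ => hg.aemeasurable)
      (c := fun _ => (‖B - -B‖₊ / 2) ^ 2)
      (fun i _ => by
        have hmp := measurePreserving_eval (fun _ : Fin n => μ) i
        exact HasSubgaussianMGF.of_map (Y := fun x : Fin n → α => x i)
          hmp.measurable.aemeasurable (by rw [hmp.map_eq]; exact hs))
      (ε := η * n) (by positivity)
    refine h.trans (le_of_eq ?_)
    congr 1
    -- For `n = 0`, and below for `B = 0`, both exponents are 0, by the convention `x / 0 = 0` where
    -- a denominator vanishes.
    rcases n.eq_zero_or_pos with rfl | hn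
    · simp
    have hn0 : (n : ℝ) ≠ 0 := by positivity
    have e : (‖B - -B‖ / 2) ^ 2 = B ^ 2 := by
      rw [Real.norm_eq_abs, div_pow, sq_abs]; ring
    push_cast
    rw [Finset.sum_const, Finset.card_univ, Fintype.card_fin, nsmul_eq_mul, e]
    by_cases hB0 : B = 0
    · simp [hB0]
    · field_simp
  have h1 := hone (fun a => f a - ∫ a, f a ∂μ) (hf.sub_const _) hsub
  have h2 := hone (-(fun a => f a - ∫ a, f a ∂μ)) (hf.sub_const _).neg hsub.neg
  have hcov : {x : Fin n → α | η * n < |∑ i, f (x i) - n * ∫ a, f a ∂μ|}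
      ⊆ {x | η * n ≤ ∑ i, (fun a => f a - ∫ a, f a ∂μ) (x i)}
        ∪ {x | η * n ≤ ∑ i, (-(fun a => f a - ∫ a, f a ∂μ)) (x i)} := by
    intro x hx
    have e1 : ∑ i, (fun a => f a - ∫ a, f a ∂μ) (x i) = ∑ i, f (x i) - n * ∫ a, f a ∂μ := by
      simp [Finset.sum_sub_distrib]
    have e2 : ∑ i, (-(fun a => f a - ∫ a, f a ∂μ)) (x i)
        = -(∑ i, f (x i) - n * ∫ a, f a ∂μ) := by
      rw [← e1, ← Finset.sum_neg_distrib]; rfl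
    simp only [Set.mem_union, Set.mem_ofPred_eq, e1, e2] at hx ⊢
    rcases lt_abs.1 hx with h | h
    · exact Or.inl h.le
    · exact Or.inr h.le
  rw [← ofReal_measureReal]
  refine ENNReal.ofReal_le_ofReal ?_
  calc _ ≤ _ := measureReal_mono hcov
    _ ≤ _ := measureReal_union_le _ _
    _ ≤ _ := add_le_add h1 h2
    _ = _ := by ring

/-- With high probability the truncated Gram matrices of all small models are bounded below. -/
lemma exists_gram_lower_bound (m : ℕ) {a : ℝ} (ha : 0 < a) {D : ℝ} (hD0 : 0 ≤ D) :
    ∃ M τ C : ℝ, 0 < M ∧ 0 < τ ∧ 0 ≤ C ∧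
      ∀ {p : ℕ} (_ : 1 ≤ p) (μ : Measure (Fin p → ℝ)) [IsProbabilityMeasure μ],
      (∀ j, ∫⁻ x, ENNReal.ofReal (x j ^ 4) ∂μ ≤ ENNReal.ofReal D) →
      (∀ J : Finset (Fin p), J.card ≤ m → ∀ v, SuppOn J v →
        a * ‖v‖ ^ 2 ≤ ∫ x, pred x v ^ 2 ∂μ) →
      ∀ n : ℕ, Measure.pi (fun _ : Fin n => μ) {x | ¬ ∀ J : Finset (Fin p), J.card ≤ m →
        ∀ v, SuppOn J v → a / 4 * n * ‖v‖ ^ 2 ≤ ∑ i, truncSq J M v (x i)}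
        ≤ ENNReal.ofReal (C * (p : ℝ) ^ m * Real.exp (-τ * n)) := by
  -- One more than the largest model size, so that `c` is positive also for `m = 0`.
  set c : ℝ := m + 1 with hc
  have hc0 : 0 < c := by positivity
  set M : ℝ := Real.sqrt (2 * c ^ 2 * D / a) + 1 with hM
  have hM0 : 0 < M := by positivity
  have hMa : c ^ 2 * D / M ^ 2 ≤ a / 2 := by
    have h1 : 2 * c ^ 2 * D / a ≤ M ^ 2 := by
      have := Real.sq_sqrt (show 0 ≤ 2 * c ^ 2 * D / a by positivity)
      have := Real.sqrt_nonneg (2 * c ^ 2 * D / a)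
      rw [hM]; nlinarith
    rw [div_le_iff₀ ha] at h1
    rw [div_le_iff₀ (by positivity)]
    linarith
  -- A quadratic form on `J` has at most `c ^ 2` entries; an error of `η * n` in each costs at most
  -- `a / 4 * n * ‖v‖ ^ 2`, half of what truncation has left.
  set η : ℝ := a / (4 * c ^ 2) with hη
  have hη0 : 0 < η := by positivity
  refine ⟨M, η ^ 2 / (2 * (M ^ 2) ^ 2), c * c ^ 2 * 2, hM0, by positivity, by positivity, ?_⟩
  intro p hp μ _ hD hv n
  set T := η ^ 2 / (2 * (M ^ 2) ^ 2)
  set bad : Finset (Fin p) → Fin p → Fin p → Set (Fin n → Fin p → ℝ) := fun J j k =>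
    {x | η * n < |∑ i, truncProd J M j k (x i) - n * ∫ y, truncProd J M j k y ∂μ|} with hbad
  have hsub : {x : Fin n → Fin p → ℝ | ¬ ∀ J : Finset (Fin p), J.card ≤ m →
        ∀ v, SuppOn J v → a / 4 * n * ‖v‖ ^ 2 ≤ ∑ i, truncSq J M v (x i)}
      ⊆ ⋃ J ∈ (Finset.univ.filter fun J : Finset (Fin p) => J.card ≤ m),
        ⋃ j ∈ J, ⋃ k ∈ J, bad J j k := by
    intro x hx
    by_contra hcon
    refine hx fun J hJ v hvJ => ?_
    have hgood : ∀ j ∈ J, ∀ k ∈ J,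
        |∑ i, truncProd J M j k (x i) - n * ∫ y, truncProd J M j k y ∂μ| ≤ η * n := by
      intro j hj k hk
      by_contra h
      push Not at h
      refine hcon ?_
      simp only [Set.mem_iUnion]
      exact ⟨J, by simpa using hJ, j, hj, k, hk, h⟩
    have hJc : (J.card : ℝ) ≤ c := by
      have : (J.card : ℝ) ≤ m := by exact_mod_cast hJ
      linarith
    have h1 := integral_truncSq_ge hJc hM0 hD0 hMa hD hvJ (hv J hJ v hvJ)
    have h2 : ∑ i, truncSq J M v (x i)
        = ∑ j ∈ J, ∑ k ∈ J, v j * v k * ∑ i, truncProd J M j k (x i) := by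
      simp only [hvJ.truncSq_eq, Finset.mul_sum]
      rw [Finset.sum_comm]
      exact Finset.sum_congr rfl fun j _ => Finset.sum_comm
    have h3 : ∑ j ∈ J, ∑ k ∈ J, v j * v k * (n * ∫ y, truncProd J M j k y ∂μ)
        - ∑ j ∈ J, ∑ k ∈ J, v j * v k * ∑ i, truncProd J M j k (x i)
        ≤ ∑ j ∈ J, ∑ k ∈ J, ‖v‖ ^ 2 * (η * n) := by
      rw [← Finset.sum_sub_distrib]
      refine Finset.sum_le_sum fun j hj => ?_
      rw [← Finset.sum_sub_distrib]
      refine Finset.sum_le_sum fun k hk => ?_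
      rw [← mul_sub]
      refine (le_abs_self _).trans ?_
      rw [abs_mul, abs_mul, abs_sub_comm, sq]
      exact mul_le_mul (mul_le_mul (PiLp.norm_apply_le v j) (PiLp.norm_apply_le v k)
        (abs_nonneg _) (norm_nonneg _)) (hgood j hj k hk) (abs_nonneg _) (by positivity)
    have h4 : ∑ j ∈ J, ∑ k ∈ J, ‖v‖ ^ 2 * (η * n) ≤ a / 4 * n * ‖v‖ ^ 2 := by
      simp only [Finset.sum_const, nsmul_eq_mul]
      calc (J.card : ℝ) * (J.card * (‖v‖ ^ 2 * (η * n))) ≤ c * (c * (‖v‖ ^ 2 * (η * n))) := by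
            gcongr
        _ = a / 4 * n * ‖v‖ ^ 2 := by rw [hη]; field_simp
    have h5 : ∑ j ∈ J, ∑ k ∈ J, v j * v k * (n * ∫ y, truncProd J M j k y ∂μ)
        = n * ∑ j ∈ J, ∑ k ∈ J, v j * v k * ∫ y, truncProd J M j k y ∂μ := by
      simp only [Finset.mul_sum]
      exact Finset.sum_congr rfl fun _ _ => Finset.sum_congr rfl fun _ _ => by ring
    rw [h5] at h3
    rw [h2]
    have h6 := mul_le_mul_of_nonneg_left h1 (Nat.cast_nonneg (α := ℝ) n)
    nlinarith
  have hE : 0 ≤ 2 * Real.exp (-T * n) := by positivity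
  calc _ ≤ _ := measure_mono hsub
    _ ≤ ∑ J ∈ (Finset.univ.filter fun J : Finset (Fin p) => J.card ≤ m),
        Measure.pi (fun _ : Fin n => μ) (⋃ j ∈ J, ⋃ k ∈ J, bad J j k) :=
      measure_biUnion_finset_le _ _
    _ ≤ ∑ J ∈ (Finset.univ.filter fun J : Finset (Fin p) => J.card ≤ m),
        ENNReal.ofReal (c ^ 2 * (2 * Real.exp (-T * n))) := by
      refine Finset.sum_le_sum fun J hJ => ?_
      have hJ' : J.card ≤ m := by simpa using hJ
      have hJc : (J.card : ℝ) ≤ c := by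
        have : (J.card : ℝ) ≤ m := by exact_mod_cast hJ'
        linarith
      calc _ ≤ ∑ j ∈ J, Measure.pi (fun _ : Fin n => μ) (⋃ k ∈ J, bad J j k) :=
            measure_biUnion_finset_le _ _
        _ ≤ ∑ j ∈ J, ∑ k ∈ J, Measure.pi (fun _ : Fin n => μ) (bad J j k) :=
            Finset.sum_le_sum fun j _ => measure_biUnion_finset_le _ _
        _ ≤ ∑ j ∈ J, ∑ k ∈ J, ENNReal.ofReal (2 * Real.exp (-T * n)) :=
            Finset.sum_le_sum fun j hj => Finset.sum_le_sum fun k hk =>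
              pi_abs_sum_sub_gt_le (measurable_truncProd J M j k)
                (fun x => abs_truncProd_le hM0.le hj hk x) hη0.le n
        _ = ENNReal.ofReal (J.card * (J.card * (2 * Real.exp (-T * n)))) := by
            simp only [Finset.sum_const, nsmul_eq_mul]
            rw [ENNReal.ofReal_mul (Nat.cast_nonneg _), ENNReal.ofReal_mul (Nat.cast_nonneg _),
              ENNReal.ofReal_natCast]
        _ ≤ _ := by
            refine ENNReal.ofReal_le_ofReal ?_
            calc (J.card : ℝ) * (J.card * (2 * Real.exp (-T * n)))
                ≤ c * (c * (2 * Real.exp (-T * n))) := by gcongr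
              _ = _ := by ring
    _ ≤ _ := by
      rw [Finset.sum_const, nsmul_eq_mul, ← ENNReal.ofReal_natCast,
        ← ENNReal.ofReal_mul (Nat.cast_nonneg _)]
      refine ENNReal.ofReal_le_ofReal ?_
      have hcard : ((Finset.univ.filter fun J : Finset (Fin p) => J.card ≤ m).card : ℝ)
          ≤ c * (p : ℝ) ^ m := by
        have := card_filter_card_le hp m
        have h : ((Finset.univ.filter fun J : Finset (Fin p) => J.card ≤ m).card : ℝ)
          ≤ (((m + 1) * p ^ m : ℕ) : ℝ) := by exact_mod_cast this
        push_cast at h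
        exact h
      calc _ ≤ c * (p : ℝ) ^ m * (c ^ 2 * (2 * Real.exp (-T * n))) := by gcongr
        _ = _ := by ring

/-- All summands are nonnegative, so those with a covariate above `M` may be dropped. In the others
the predictor is at most `c * M * r`, where `b''` is at least `β`; no bound on the covariates
themselves enters. -/
lemma IsExpFamilyBase.curv_ge {ν : Measure ℝ} (hν : IsExpFamilyBase ν) {ω : Sample n p}
    {J : Finset (Fin p)} {c : ℝ} (hc : (J.card : ℝ) ≤ c) {M r β a : ℝ} (hM : 0 ≤ M)
    (hβ0 : 0 ≤ β) (hβ : ∀ θ, |θ| ≤ c * M * r → β ≤ iteratedDeriv 2 (cumulant ν) θ)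
    {w h : EuclideanSpace ℝ (Fin p)} (hw : SuppOn J w) (hwr : ‖w‖ ≤ r)
    (hG : a / 4 * n * ‖h‖ ^ 2 ≤ ∑ i, truncSq J M h (ω i).1) :
    β * (a / 4) * n * ‖h‖ ^ 2 ≤ curv ν ω w h := by
  have hc0 : 0 ≤ c := (Nat.cast_nonneg _).trans hc
  calc β * (a / 4) * n * ‖h‖ ^ 2 = β * (a / 4 * n * ‖h‖ ^ 2) := by ring
    _ ≤ β * ∑ i, truncSq J M h (ω i).1 := by gcongr
    _ = ∑ i, β * truncSq J M h (ω i).1 := by rw [Finset.mul_sum]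
    _ ≤ curv ν ω w h := by
      refine Finset.sum_le_sum fun i _ => ?_
      have hpos := (hν.iteratedDeriv_two_cumulant_pos (pred (ω i).1 w)).le
      unfold truncSq
      by_cases hx : (ω i).1 ∈ {x : Fin p → ℝ | ∀ l ∈ J, |x l| ≤ M}
      · rw [Set.indicator_of_mem hx, mul_comm]
        refine mul_le_mul_of_nonneg_left (hβ _ ?_) (sq_nonneg _)
        exact (hw.abs_pred_le hx hc hM).trans (by gcongr)
      · rw [Set.indicator_of_notMem hx, mul_zero]
        positivity

end Gram

/-! ### Consequences of the covariate conditions -/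

section Covariates

variable {ν : Measure ℝ}

/-- The part of the failure probability that the moment conditions add. -/
def CovCondition.extraFail (cond : CovCondition) (S : Scenario) (n : ℕ) : ℝ :=
  cond.failProb S n - ((n : ℝ) * S.p n)⁻¹

lemma CovCondition.extraFail_bounded (A : ℝ) (S : Scenario) (n : ℕ) :
    (CovCondition.bounded A).extraFail S n = 0 := by
  simp [CovCondition.extraFail, CovCondition.failProb]

/-- With `K = 2m`, the identity `n ^ κ_n = p` (valid for base `n ≥ 2`) turns `n^{-(K - 2κ_n)/2}`
into `p n⁻ᵐ`, the union bound over the covariates. The factor 2 leaves room for two such events, one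
for each radius. -/
lemma CovCondition.extraFail_moments {m : ℕ} (hm : 1 ≤ m) (AK : ℝ) (BK : ℝ → ℝ) (S : Scenario)
    {n : ℕ} (hn : 2 ≤ n) :
    2 * (S.p n * ((n : ℝ) ^ m)⁻¹) ≤ (CovCondition.moments (2 * m) AK BK).extraFail S n := by
  have hn0 : (0 : ℝ) < n := by positivity
  have hn1 : (n : ℝ) ≠ 1 := by
    have : (2 : ℝ) ≤ n := by exact_mod_cast hn
    linarith
  have hp : (0 : ℝ) < S.p n := by exact_mod_cast S.p_pos n
  have e : (n : ℝ) ^ (-((((2 * m : ℕ) : ℝ) - 2 * S.kappaSeq n) / 2)) = S.p n * ((n : ℝ) ^ m)⁻¹ := by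
    have : -((((2 * m : ℕ) : ℝ) - 2 * S.kappaSeq n) / 2) = S.kappaSeq n + -(m : ℝ) := by
      push_cast; ring
    rw [this, Real.rpow_add hn0, Scenario.kappaSeq, Real.rpow_logb hn0 hn1 hp, Real.rpow_neg hn0.le,
      Real.rpow_natCast]
  rw [CovCondition.extraFail, CovCondition.failProb, e, add_sub_cancel_left]
  have h1 : (1 : ℝ) ≤ ((2 * m : ℕ) : ℝ) ^ (2 * m + 1) := one_le_pow₀ (by
    have : 1 ≤ 2 * m := by omega
    exact_mod_cast this)
  have h2 : 0 ≤ S.p n * ((n : ℝ) ^ m)⁻¹ := by positivity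
  nlinarith

lemma Scenario.one_le_of_moments {S : Scenario} {K : ℕ} (hK : Even K)
    (h : 2 * S.kappa < (K : ENNReal)) : ∃ m, 1 ≤ m ∧ K = 2 * m := by
  obtain ⟨m, rfl⟩ := hK
  refine ⟨m, ?_, by ring⟩
  rcases m.eq_zero_or_pos with rfl | h0
  · simp at h
  · exact h0

lemma CovCondition.exists_pow_four_bound (cond : CovCondition) :
    ∃ D : ℝ, 0 ≤ D ∧ ∀ S : Scenario, cond.Holds ν S → ∀ n j,
      ∫⁻ x, ENNReal.ofReal (x j ^ 4) ∂(S.covLaw n) ≤ ENNReal.ofReal D := by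
  cases cond with
  | bounded A =>
    refine ⟨A ^ 4, by positivity, fun S hS n j => ?_⟩
    have := S.isProbabilityMeasure n
    calc ∫⁻ x, ENNReal.ofReal (x j ^ 4) ∂(S.covLaw n)
        ≤ ∫⁻ _x, ENNReal.ofReal (A ^ 4) ∂(S.covLaw n) := by
          refine lintegral_mono_ae ?_
          filter_upwards [hS n j] with x hx
          refine ENNReal.ofReal_le_ofReal ?_
          calc x j ^ 4 = |x j| ^ 4 := ((show Even 4 by decide).pow_abs _).symm
            _ ≤ A ^ 4 := by gcongr
      _ = ENNReal.ofReal (A ^ 4) := by simp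
  | moments K AK BK =>
    refine ⟨1 + max AK 0, by positivity, fun S hS n j => ?_⟩
    have := S.isProbabilityMeasure n
    obtain ⟨hK, hk, h6, _⟩ := hS
    obtain ⟨m, hm, rfl⟩ := S.one_le_of_moments hK hk
    calc ∫⁻ x, ENNReal.ofReal (x j ^ 4) ∂(S.covLaw n)
        ≤ ∫⁻ x, (1 + ENNReal.ofReal (|x j| ^ (6 * (2 * m)))) ∂(S.covLaw n) := by
          refine lintegral_mono fun x => ?_
          rw [← ENNReal.ofReal_one, ← ENNReal.ofReal_add zero_le_one (by positivity)]
          refine ENNReal.ofReal_le_ofReal ?_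
          rw [← (show Even 4 by decide).pow_abs]
          exact pow_le_one_add_pow (abs_nonneg _) (by omega)
      _ = 1 + ∫⁻ x, ENNReal.ofReal (|x j| ^ (6 * (2 * m))) ∂(S.covLaw n) := by
          rw [lintegral_add_left measurable_const]
          simp
      _ ≤ 1 + ENNReal.ofReal AK := by gcongr; exact h6 n j
      _ ≤ ENNReal.ofReal (1 + max AK 0) := by
          rw [ENNReal.ofReal_add zero_le_one (le_max_right _ _), ENNReal.ofReal_one]
          gcongr
          exact le_max_left _ _

/-- The moment conditions enter through this bound: `|x|^{3K} g^K ≤ |x|^{6K} + g^{2K}`, so the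
orders `6K` for the covariate and `2K` for `b'''` are those that give the envelope a moment of order
`K`. -/
lemma envelope_pow_le (hν : IsExpFamilyBase ν) {ρ : ℝ} (hρ : 0 ≤ ρ) (m : ℕ) (x : ℝ) :
    ENNReal.ofReal (envelope ν ρ x ^ (2 * m)) ≤ ENNReal.ofReal (2 ^ (2 * m)) *
      (1 + 2 * ENNReal.ofReal (|x| ^ (6 * (2 * m))) + ⨆ θ ∈ {θ : ℝ | |θ| ≤ ρ * |x|},
          ENNReal.ofReal (|iteratedDeriv 3 (cumulant ν) θ| ^ (2 * (2 * m)))) := by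
  set K := 2 * m
  obtain ⟨θ, hθ, he⟩ := hν.exists_eq_thirdSup hρ x
  have hg := thirdSup_nonneg (ν := ν) ρ x
  have h1 : ENNReal.ofReal (thirdSup ν ρ x ^ (2 * K)) ≤ ⨆ θ ∈ {θ : ℝ | |θ| ≤ ρ * |x|},
      ENNReal.ofReal (|iteratedDeriv 3 (cumulant ν) θ| ^ (2 * K)) := by
    rw [he]
    exact le_iSup₂_of_le θ hθ le_rfl
  refine le_trans ?_ (mul_le_mul_right (add_le_add_right h1 _) _)
  rw [show (2 : ENNReal) = ENNReal.ofReal 2 by simp, ← ENNReal.ofReal_one,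
    ← ENNReal.ofReal_mul (by norm_num), ← ENNReal.ofReal_add (by norm_num) (by positivity),
    ← ENNReal.ofReal_add (by positivity) (by positivity), ← ENNReal.ofReal_mul (by positivity)]
  refine ENNReal.ofReal_le_ofReal ?_
  unfold envelope
  have hx : 0 ≤ |x| := abs_nonneg x
  calc (x ^ 2 + |x| ^ 3 * thirdSup ν ρ x) ^ K
      ≤ 2 ^ (K - 1) * ((x ^ 2) ^ K + (|x| ^ 3 * thirdSup ν ρ x) ^ K) :=
        add_pow_le (by positivity) (by positivity) K
    _ ≤ 2 ^ K * ((1 + |x| ^ (6 * K)) + (|x| ^ (6 * K) + thirdSup ν ρ x ^ (2 * K))) := by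
        gcongr
        · norm_num
        · omega
        · rw [← sq_abs, ← pow_mul]
          exact pow_le_one_add_pow hx (by omega)
        · have := two_mul_le_add_sq (|x| ^ (3 * K)) (thirdSup ν ρ x ^ K)
          have e1 : (|x| ^ (3 * K)) ^ 2 = |x| ^ (6 * K) := by rw [← pow_mul]; congr 1; ring
          have e2 : (thirdSup ν ρ x ^ K) ^ 2 = thirdSup ν ρ x ^ (2 * K) := by
            rw [← pow_mul]; congr 1; ring
          have h0 : 0 ≤ |x| ^ (3 * K) * thirdSup ν ρ x ^ K := by positivity
          rw [mul_pow, ← pow_mul]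
          linarith
    _ = 2 ^ K * (1 + 2 * |x| ^ (6 * K) + thirdSup ν ρ x ^ (2 * K)) := by ring

/-- The sums of the envelopes of every covariate are of order `n`, up to an event whose
probability the covariate condition controls. -/
lemma CovCondition.exists_envelope_tail (hν : IsExpFamilyBase ν) (cond : CovCondition) {ρ : ℝ}
    (hρ : 0 < ρ) :
    ∃ t : ℝ, 0 ≤ t ∧ ∀ S : Scenario, cond.Holds ν S → ∀ n : ℕ, 2 ≤ n →
      sampleLaw ν n (S.covLaw n) (S.φstar n)
        {ω | ¬ ∀ j, ∑ i, envelope ν ρ ((ω i).1 j) ≤ t * n}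
        ≤ ENNReal.ofReal (cond.extraFail S n / 2) := by
  cases cond with
  | bounded A =>
    refine ⟨envelope ν ρ A, envelope_nonneg _ _, fun S hS n hn => ?_⟩
    have := S.isProbabilityMeasure n
    refine (le_of_eq ?_).trans zero_le
    rw [← nonpos_iff_eq_zero]
    refine (hν.sampleLaw_cov_le {x : Fin n → Fin (S.p n) → ℝ |
      ¬ ∀ j, ∑ i, envelope ν ρ (x i j) ≤ envelope ν ρ A * n}).trans (le_of_eq ?_)
    have hae : ∀ᵐ x ∂(Measure.pi fun _ : Fin n => S.covLaw n), ∀ i j, |x i j| ≤ A := by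
      rw [ae_all_iff]
      intro i
      have h1 : ∀ᵐ y ∂(S.covLaw n), ∀ j, |y j| ≤ A := ae_all_iff.2 (hS n)
      exact (measurePreserving_eval (fun _ : Fin n => S.covLaw n) i).quasiMeasurePreserving.ae h1
    have hgoal : ∀ᵐ x ∂(Measure.pi fun _ : Fin n => S.covLaw n),
        ∀ j, ∑ i, envelope ν ρ (x i j) ≤ envelope ν ρ A * n := by
      filter_upwards [hae] with x hx j
      calc ∑ i, envelope ν ρ (x i j) ≤ ∑ _i : Fin n, envelope ν ρ A :=
            Finset.sum_le_sum fun i _ =>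
              hν.envelope_mono hρ.le ((hx i j).trans (le_abs_self A))
        _ = envelope ν ρ A * n := by simp [mul_comm]
    exact hgoal
  | moments K AK BK =>
    -- The constant `t` must be chosen before the scenario. If `K` is not of this form, no scenario
    -- satisfies the condition and any `t` serves.
    by_cases hex : ∃ m, 1 ≤ m ∧ K = 2 * m
    · obtain ⟨m, hm, rfl⟩ := hex
      obtain ⟨t, ht, htail⟩ := exists_sum_tail_bound hm
        (2 ^ (2 * m) * (1 + 2 * max AK 0 + max (BK ρ) 0))
      refine ⟨t, ht, fun S hS n hn => ?_⟩
      have := S.isProbabilityMeasure n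
      obtain ⟨_, _, h6, hB⟩ := hS
      have hone : ∀ j : Fin (S.p n), Measure.pi (fun _ : Fin n => S.covLaw n)
          {x | t * n < ∑ i, envelope ν ρ (x i j)} ≤ ENNReal.ofReal (((n : ℝ) ^ m)⁻¹) := by
        intro j
        refine htail (S.covLaw n) (fun x => envelope ν ρ (x j))
          ((hν.measurable_envelope hρ.le).comp (measurable_pi_apply j))
          (fun x => envelope_nonneg _ _) ?_ n (by omega)
        calc ∫⁻ x, ENNReal.ofReal (envelope ν ρ (x j) ^ (2 * m)) ∂(S.covLaw n)
            ≤ ∫⁻ x, ENNReal.ofReal (2 ^ (2 * m)) * (1 + 2 * ENNReal.ofReal (|x j| ^ (6 * (2 * m)))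
              + ⨆ θ ∈ {θ : ℝ | |θ| ≤ ρ * |x j|},
                ENNReal.ofReal (|iteratedDeriv 3 (cumulant ν) θ| ^ (2 * (2 * m))))
              ∂(S.covLaw n) := lintegral_mono fun x => envelope_pow_le hν hρ.le m (x j)
          _ = ENNReal.ofReal (2 ^ (2 * m)) * (1
              + 2 * ∫⁻ x, ENNReal.ofReal (|x j| ^ (6 * (2 * m))) ∂(S.covLaw n)
              + ∫⁻ x, (⨆ θ ∈ {θ : ℝ | |θ| ≤ ρ * |x j|},
                ENNReal.ofReal (|iteratedDeriv 3 (cumulant ν) θ| ^ (2 * (2 * m))))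
              ∂(S.covLaw n)) := by
            have hm1 : Measurable fun x : Fin (S.p n) → ℝ =>
                ENNReal.ofReal (|x j| ^ (6 * (2 * m))) :=
              ((measurable_pi_apply j).abs.pow_const _).ennreal_ofReal
            -- The supremum is kept as the last summand: splitting the integral then requires
            -- measurability of the other terms only.
            rw [lintegral_const_mul' _ _ ENNReal.ofReal_ne_top,
              lintegral_add_left ((hm1.const_mul 2).const_add 1),
              lintegral_add_left measurable_const, lintegral_const_mul _ hm1]
            simp
          _ ≤ ENNReal.ofReal (2 ^ (2 * m)) * (1 + 2 * ENNReal.ofReal AK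
              + ENNReal.ofReal (BK ρ)) := by
            gcongr
            · exact h6 n j
            · exact hB ρ hρ n j
          _ ≤ ENNReal.ofReal (2 ^ (2 * m)) * (ENNReal.ofReal 1
              + ENNReal.ofReal 2 * ENNReal.ofReal (max AK 0)
              + ENNReal.ofReal (max (BK ρ) 0)) := by
            gcongr
            · simp
            · simp
            · exact le_max_left _ _
            · exact le_max_left _ _
          _ = _ := by
            rw [← ENNReal.ofReal_mul (by norm_num), ← ENNReal.ofReal_add (by norm_num)
              (by positivity), ← ENNReal.ofReal_add (by positivity) (by positivity),
              ← ENNReal.ofReal_mul (by positivity)]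
      refine (hν.sampleLaw_cov_le {x : Fin n → Fin (S.p n) → ℝ |
        ¬ ∀ j, ∑ i, envelope ν ρ (x i j) ≤ t * n}).trans ?_
      have hsub : {x : Fin n → Fin (S.p n) → ℝ | ¬ ∀ j, ∑ i, envelope ν ρ (x i j) ≤ t * n}
          ⊆ ⋃ j, {x | t * n < ∑ i, envelope ν ρ (x i j)} := by
        intro x hx
        simpa using hx
      refine (measure_mono hsub).trans ((measure_iUnion_fintype_le _ _).trans ?_)
      refine (Finset.sum_le_sum fun j _ => hone j).trans ?_
      rw [Finset.sum_const, Finset.card_univ, Fintype.card_fin, nsmul_eq_mul,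
        ← ENNReal.ofReal_natCast, ← ENNReal.ofReal_mul (Nat.cast_nonneg _)]
      refine ENNReal.ofReal_le_ofReal ?_
      have := CovCondition.extraFail_moments hm AK BK S hn
      linarith
    · exact ⟨0, le_rfl, fun S hS => absurd (S.one_le_of_moments hS.1 hS.2.1) hex⟩

lemma CovCondition.extraFail_nonneg (cond : CovCondition) {S : Scenario} (hS : cond.Holds ν S)
    {n : ℕ} (hn : 2 ≤ n) : 0 ≤ cond.extraFail S n := by
  cases cond with
  | bounded A => rw [CovCondition.extraFail_bounded]
  | moments K AK BK =>
    obtain ⟨m, hm, rfl⟩ := S.one_le_of_moments hS.1 hS.2.1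
    exact le_trans (by positivity) (CovCondition.extraFail_moments hm AK BK S hn)

/-- The second-moment assumption as a bound on quadratic forms. -/
lemma Scenario.sq_norm_le_integral {S : Scenario} {q : ℕ} {a₁ a₂ a₃ : ℝ}
    (hS : S.BaseAssumptions q a₁ a₂ a₃) {n : ℕ} {D : ℝ}
    (hD : ∀ j, ∫⁻ x, ENNReal.ofReal (x j ^ 4) ∂(S.covLaw n) ≤ ENNReal.ofReal D)
    {J : Finset (Fin (S.p n))} (hJ : J.card ≤ 2 * q) {v : EuclideanSpace ℝ (Fin (S.p n))}
    (hv : SuppOn J v) : a₁ * ‖v‖ ^ 2 ≤ ∫ x, pred x v ^ 2 ∂(S.covLaw n) := by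
  have := S.isProbabilityMeasure n
  -- Finite fourth moments make the entries of the second-moment matrix genuine integrals, so the
  -- quadratic form may be expanded under the integral.
  have hint : ∀ j k : Fin (S.p n), Integrable (fun x => x j * x k) (S.covLaw n) := by
    intro j k
    refine (((integrable_const 2).add (integrable_pow_four (hD j))).add
      (integrable_pow_four (hD k))).mono'
      ((measurable_pi_apply j).mul (measurable_pi_apply k)).aestronglyMeasurable
      (ae_of_all _ fun x => ?_)
    simp only [Pi.add_apply, Real.norm_eq_abs, abs_mul]
    rw [← (show Even 4 by decide).pow_abs (x j), ← (show Even 4 by decide).pow_abs (x k)]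
    have h1 := pow_le_one_add_pow (abs_nonneg (x j)) (show 2 ≤ 4 by norm_num)
    have h2 := pow_le_one_add_pow (abs_nonneg (x k)) (show 2 ≤ 4 by norm_num)
    nlinarith [sq_nonneg (|x j| - |x k|), sq_nonneg (|x j|), sq_nonneg (|x k|)]
  have hpsd := (hS.second_moments n J hJ).1
  have h1 := hpsd.dotProduct_mulVec_nonneg (fun j : J => v j)
  have h2 : ∫ x, pred x v ^ 2 ∂(S.covLaw n)
      = ∑ j ∈ J, ∑ k ∈ J, v j * v k * ∫ x, x j * x k ∂(S.covLaw n) := by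
    have : ∀ x : Fin (S.p n) → ℝ, pred x v ^ 2 = ∑ j ∈ J, ∑ k ∈ J, v j * v k * (x j * x k) := by
      intro x
      rw [hv.pred_eq, sq, Finset.sum_mul_sum]
      exact Finset.sum_congr rfl fun _ _ => Finset.sum_congr rfl fun _ _ => by ring
    simp only [this]
    rw [integral_finsetSum _ fun j _ => integrable_finsetSum _ fun k _ => (hint j k).const_mul _]
    refine Finset.sum_congr rfl fun j _ => ?_
    rw [integral_finsetSum _ fun k _ => (hint j k).const_mul _]
    exact Finset.sum_congr rfl fun k _ => integral_const_mul _ _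
  have h3 : ‖v‖ ^ 2 = ∑ j ∈ J, v j ^ 2 := by
    rw [EuclideanSpace.norm_sq_eq]
    simp only [Real.norm_eq_abs, sq_abs]
    exact (Finset.sum_subset (Finset.subset_univ J) fun j _ hj => by rw [hv j hj]; simp).symm
  have h4 : ∑ j ∈ J, ∑ k ∈ J, v j * v k * ∫ x, x j * x k ∂(S.covLaw n)
      = (fun j : J => v j) ⬝ᵥ (S.secondMoment n J).mulVec (fun j : J => v j) := by
    simp only [dotProduct, Matrix.mulVec, Scenario.secondMoment, Matrix.of_apply, Finset.mul_sum]
    rw [← Finset.sum_coe_sort J]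
    refine Finset.sum_congr rfl fun j _ => ?_
    rw [← Finset.sum_coe_sort J]
    exact Finset.sum_congr rfl fun k _ => by ring
  have h5 : ∑ j ∈ J, v j ^ 2 = (fun j : J => v j) ⬝ᵥ (fun j : J => v j) := by
    simp only [dotProduct]
    rw [← Finset.sum_coe_sort J]
    exact Finset.sum_congr rfl fun _ _ => sq _
  rw [h2, h3, h4, h5]
  simp only [star_trivial, Matrix.sub_mulVec, dotProduct_sub, Matrix.smul_mulVec,
    Matrix.one_mulVec, dotProduct_smul, smul_eq_mul] at h1
  linarith

end Covariates

/-! ### The high-probability event -/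

section Event

lemma probAtLeast_of_compl_le {Ω : Type*} [MeasurableSpace Ω] {P : Measure Ω}
    [IsProbabilityMeasure P] {E : Set Ω} {δ : ℝ} (hδ : 0 ≤ δ) (h : P Eᶜ ≤ ENNReal.ofReal δ) :
    ProbAtLeast P (1 - δ) E := by
  refine ⟨(toMeasurable P Eᶜ)ᶜ, (measurableSet_toMeasurable _ _).compl,
    Set.compl_subset_comm.1 (subset_toMeasurable _ _), ?_⟩
  rw [probReal_compl_eq_one_sub (measurableSet_toMeasurable _ _), measureReal_def,
    measure_toMeasurable]
  have := ENNReal.toReal_mono ENNReal.ofReal_ne_top h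
  rw [ENNReal.toReal_ofReal hδ] at this
  linarith

/-- Since `log p = o(n)`, half of the exponent absorbs `p ^ (k + 1)` and the other half absorbs the
factor `n`. -/
lemma eventually_exp_bound {p : ℕ → ℕ} (hp : ∀ n, 1 ≤ p n)
    (hg : (fun n => Real.log (p n)) =o[atTop] fun n : ℕ => (n : ℝ)) (C : ℝ) (k : ℕ) {τ : ℝ}
    (hτ : 0 < τ) :
    ∀ᶠ n : ℕ in atTop,
      C * (p n : ℝ) ^ k * Real.exp (-τ * n) ≤ ((n : ℝ) * p n)⁻¹ / 2 := by
  have h1 := hg.bound (show (0 : ℝ) < τ / (2 * (k + 1)) by positivity)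
  have h2 : Tendsto (fun n : ℕ => 2 * max C 0 * ((n : ℝ) * Real.exp (-(τ / 2) * n))) atTop
      (𝓝 (2 * max C 0 * 0)) := by
    refine Tendsto.const_mul _ ?_
    have h := (Real.tendsto_pow_mul_exp_neg_atTop_nhds_zero 1).comp
      (tendsto_natCast_atTop_atTop.const_mul_atTop (show (0 : ℝ) < τ / 2 by positivity))
    have h' := h.const_mul (τ / 2)⁻¹
    rw [mul_zero] at h'
    refine h'.congr fun n => ?_
    simp only [Function.comp_apply, pow_one]
    rw [neg_mul]
    field_simp
  rw [mul_zero] at h2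
  filter_upwards [h1, h2.eventually (eventually_le_nhds (show (0 : ℝ) < 1 by norm_num)),
    eventually_ge_atTop 1] with n hn1 hn2 hn3
  have hn0 : (0 : ℝ) < n := by exact_mod_cast hn3
  have hp1 : (1 : ℝ) ≤ p n := by exact_mod_cast hp n
  have hp0 : (0 : ℝ) < p n := by linarith
  have hlog : Real.log (p n) * (k + 1) ≤ τ / 2 * n := by
    rw [Real.norm_eq_abs, Real.norm_eq_abs, abs_of_nonneg (Real.log_nonneg hp1),
      abs_of_pos hn0] at hn1
    calc Real.log (p n) * (k + 1) ≤ τ / (2 * (k + 1)) * n * (k + 1) := by gcongr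
      _ = τ / 2 * n := by field_simp
  have hpk : (p n : ℝ) ^ (k + 1) ≤ Real.exp (τ / 2 * n) := by
    rw [← Real.exp_log hp0, ← Real.exp_nat_mul]
    refine Real.exp_le_exp.2 ?_
    push_cast
    linarith
  rw [div_eq_mul_inv, ← mul_inv, inv_eq_one_div, le_div_iff₀ (by positivity)]
  calc C * (p n : ℝ) ^ k * Real.exp (-τ * n) * (n * p n * 2)
      = 2 * C * (n * (p n : ℝ) ^ (k + 1) * Real.exp (-τ * n)) := by ring
    _ ≤ 2 * max C 0 * (n * Real.exp (τ / 2 * n) * Real.exp (-τ * n)) := by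
        gcongr
        exact le_max_left _ _
    _ = 2 * max C 0 * (n * Real.exp (-(τ / 2) * n)) := by
        rw [mul_assoc (n : ℝ), ← Real.exp_add]
        congr 3
        ring
    _ ≤ 1 := hn2

variable {ν : Measure ℝ} {n p : ℕ}

/-- Bounds for the curvature of the log-likelihood on the ball of radius `r` of all models with at
most `m` covariates. -/
def CurvBounds (ν : Measure ℝ) (ω : Sample n p) (m : ℕ) (r lam₁ lam₂ lam₃ : ℝ) : Prop :=
  ∀ J : Finset (Fin p), J.card ≤ m → ∀ w h, SuppOn J w → SuppOn J h → ‖w‖ ≤ r →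
    lam₁ * n * ‖h‖ ^ 2 ≤ curv ν ω w h ∧ curv ν ω w h ≤ lam₂ * n * ‖h‖ ^ 2 ∧
    ∀ w', SuppOn J w' → ‖w'‖ ≤ r →
      |curv ν ω w h - curv ν ω w' h| ≤ lam₃ * n * ‖w - w'‖ * ‖h‖ ^ 2

/-- Away from a ball, the log-likelihood is smaller than at the origin. -/
lemma IsExpFamilyBase.fullLogLik_lt_of_norm_gt (hν : IsExpFamilyBase ν) {ω : Sample n p}
    (hn : 1 ≤ n) {q : ℕ} {a L₁ L₂ u : ℝ} (hu : 0 < u) (hu1 : u ≤ 1) (hL₁ : 0 < L₁)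
    (hL₂ : 0 < L₂) (huL : (2 * q + 1) * (u * (1 + L₂ / 2)) ≤ L₁ / 4)
    (hlow : ∀ J : Finset (Fin p), J.card ≤ 2 * q → ∀ w h, SuppOn J w → SuppOn J h →
      ‖w‖ ≤ a + 1 → L₁ * n * ‖h‖ ^ 2 ≤ curv ν ω w h)
    (hup : ∀ J : Finset (Fin p), J.card ≤ 2 * q + 1 → ∀ w h, SuppOn J w → SuppOn J h →
      ‖w‖ ≤ a + 1 → curv ν ω w h ≤ L₂ * n * ‖h‖ ^ 2)
    {φ : EuclideanSpace ℝ (Fin p)} (hφ : ‖φ‖ ≤ a) {J₀ : Finset (Fin p)} (hJ₀ : J₀.card ≤ q)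
    (hφJ : SuppOn J₀ φ)
    (hpert : ∀ j : Fin p, ∀ s : ℝ, |s| = u →
      fullLogLik ν ω (φ + EuclideanSpace.single j s) - fullLogLik ν ω φ ≤ u ^ 2 * n)
    {J : Finset (Fin p)} (hJ : J.card ≤ q) {w : EuclideanSpace ℝ (Fin p)} (hw : SuppOn J w)
    (hwn : a + (1 + a + 2 * L₂ * a ^ 2 / L₁) < ‖w‖) :
    fullLogLik ν ω w < fullLogLik ν ω 0 := by
  classical
  have hn0 : (0 : ℝ) < n := by exact_mod_cast hn
  have ha : 0 ≤ a := (norm_nonneg _).trans hφ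
  -- the score at the true parameter
  have hscore : ∀ j : Fin p, |score ν ω φ (EuclideanSpace.single j 1)|
      ≤ u * (1 + L₂ / 2) * n := by
    intro j
    -- Taylor's formula recovers the score from the finite perturbation: `s` times the score is the
    -- increment, at most `u ^ 2 * n`, plus half the curvature, at most `L₂ * n * u ^ 2 / 2`. Both
    -- signs of `s` are needed for the absolute value.
    have hs : ∀ s : ℝ, |s| = u →
        s * score ν ω φ (EuclideanSpace.single j 1) ≤ u * (u * (1 + L₂ / 2) * n) := by
      intro s hsu
      obtain ⟨ξ, hξ, hT⟩ := hν.exists_taylor_fullLogLik ω φ (EuclideanSpace.single j s)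
      have hnorm : ‖EuclideanSpace.single j s‖ = u := by
        rw [PiLp.norm_single, Real.norm_eq_abs, hsu]
      have hsupp : SuppOn (insert j J₀) (EuclideanSpace.single j s) := by
        intro k hk
        have : k ≠ j := fun h => hk (h ▸ Finset.mem_insert_self _ _)
        simp [this]
      have hφ' : SuppOn (insert j J₀) φ := hφJ.mono (Finset.subset_insert _ _)
      -- The perturbed coordinate may lie outside the true support. The size `q + 1` exceeds `2 * q`
      -- when `q = 0`, which is why the upper curvature bound is assumed up to `2 * q + 1`.
      have hcard : (insert j J₀).card ≤ 2 * q + 1 :=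
        (Finset.card_insert_le _ _).trans (by omega)
      have hball : ‖φ + ξ • EuclideanSpace.single j s‖ ≤ a + 1 := by
        refine (norm_add_le _ _).trans (add_le_add hφ ?_)
        rw [norm_smul, hnorm, Real.norm_eq_abs, abs_of_pos hξ.1]
        nlinarith [hξ.2, hξ.1]
      have hc := hup _ hcard _ _ (hφ'.add (hsupp.smul ξ)) hsupp hball
      rw [hnorm] at hc
      have hp := hpert j s hsu
      have he : score ν ω φ (EuclideanSpace.single j s)
          = s * score ν ω φ (EuclideanSpace.single j 1) := by
        rw [← score_smul]
        congr 1
        ext k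
        by_cases hk : k = j
        · subst hk; simp
        · simp [hk]
      rw [he] at hT
      nlinarith
    have h1 := hs u (abs_of_pos hu)
    have h2 := hs (-u) (by rw [abs_neg, abs_of_pos hu])
    rw [abs_le]
    constructor
    · have := le_of_mul_le_mul_left (by linarith :
        u * -(score ν ω φ (EuclideanSpace.single j 1)) ≤ u * (u * (1 + L₂ / 2) * n)) hu
      linarith
    · exact le_of_mul_le_mul_left h1 hu
  have hcardU : (J ∪ J₀).card ≤ 2 * q := (Finset.card_union_le _ _).trans (by omega)
  have hscoreU : ∀ v, SuppOn (J ∪ J₀) v → |score ν ω φ v| ≤ L₁ / 4 * n * ‖v‖ := by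
    intro v hv
    rw [hv.score_eq]
    have hc : ((J ∪ J₀).card : ℝ) ≤ 2 * q + 1 := by
      have : ((J ∪ J₀).card : ℝ) ≤ ((2 * q : ℕ) : ℝ) := by exact_mod_cast hcardU
      push_cast at this
      linarith
    refine (SuppOn.abs_sum_mul_le (x := fun j => score ν ω φ (EuclideanSpace.single j 1))
      (fun j _ => hscore j) hc (by positivity)).trans ?_
    refine mul_le_mul_of_nonneg_right ?_ (norm_nonneg _)
    calc (2 * (q : ℝ) + 1) * (u * (1 + L₂ / 2) * n)
        = (2 * q + 1) * (u * (1 + L₂ / 2)) * n := by ring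
      _ ≤ L₁ / 4 * n := by gcongr
  have hwU : SuppOn (J ∪ J₀) w := hw.mono Finset.subset_union_left
  have hφU : SuppOn (J ∪ J₀) φ := hφJ.mono Finset.subset_union_right
  -- far away from the true parameter
  set T := ‖w - φ‖ with hT
  have hT1 : 1 + a + 2 * L₂ * a ^ 2 / L₁ < T := by
    have := norm_sub_norm_le w φ
    linarith
  have hdiv : 0 ≤ 2 * L₂ * a ^ 2 / L₁ := by positivity
  have hT0 : 0 < T := by linarith
  set k := T⁻¹ • (w - φ) with hk
  have hkn : ‖k‖ = 1 := by
    rw [hk, norm_smul, Real.norm_eq_abs, abs_of_pos (inv_pos.2 hT0), ← hT,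
      inv_mul_cancel₀ hT0.ne']
  have hkU : SuppOn (J ∪ J₀) k := (hwU.sub hφU).smul _
  have hwk : φ + T • k = w := by
    rw [hk, smul_smul, mul_inv_cancel₀ hT0.ne', one_smul]
    abel
  have h1 := hν.fullLogLik_chord ω φ k (s := T) (by linarith)
  rw [hwk] at h1
  -- At distance 1 the score contributes at most `L₁ / 4 * n` and the curvature at least `L₁ / 2 *
  -- n`. The chord inequality `h1` multiplies the decrease by `T`.
  have h2 : fullLogLik ν ω (φ + k) - fullLogLik ν ω φ ≤ -(L₁ / 4 * n) := by
    obtain ⟨ξ, hξ, hTk⟩ := hν.exists_taylor_fullLogLik ω φ k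
    have hball : ‖φ + ξ • k‖ ≤ a + 1 := by
      refine (norm_add_le _ _).trans (add_le_add hφ ?_)
      rw [norm_smul, hkn, Real.norm_eq_abs, abs_of_pos hξ.1]
      linarith [hξ.2]
    have hc := hlow _ hcardU _ _ (hφU.add (hkU.smul ξ)) hkU hball
    have hs := (le_abs_self _).trans (hscoreU k hkU)
    rw [hkn] at hc hs
    linarith
  -- The comparison point is the origin, because the true parameter need not belong to the model
  -- `J`; the origin belongs to every model and its log-likelihood is only `O(n)` below that of the
  -- true parameter.
  have h3 : -(L₁ / 4 * n * a + L₂ * n * a ^ 2 / 2) ≤ fullLogLik ν ω 0 - fullLogLik ν ω φ := by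
    obtain ⟨ξ, hξ, hT0⟩ := hν.exists_taylor_fullLogLik ω φ (-φ)
    have hball : ‖φ + ξ • -φ‖ ≤ a + 1 := by
      have e : φ + ξ • -φ = (1 - ξ) • φ := by rw [sub_smul, one_smul, smul_neg, sub_eq_add_neg]
      rw [e, norm_smul, Real.norm_eq_abs, abs_of_pos (by linarith [hξ.2])]
      nlinarith [hξ.1, norm_nonneg φ]
    have hc := hup _ (hcardU.trans (Nat.le_succ _)) _ _ (hφU.add (hφU.neg.smul ξ)) hφU.neg hball
    have hs := (neg_abs_le _).trans' (neg_le_neg (hscoreU _ hφU.neg))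
    rw [norm_neg] at hc hs
    rw [add_neg_cancel] at hT0
    have e1 : L₁ / 4 * n * ‖φ‖ ≤ L₁ / 4 * n * a := by gcongr
    have e2 : L₂ * n * ‖φ‖ ^ 2 ≤ L₂ * n * a ^ 2 := by gcongr
    linarith
  have h4 : L₁ / 4 * a + L₂ * a ^ 2 / 2 < T * (L₁ / 4) := by
    have : (a + 2 * L₂ * a ^ 2 / L₁) * (L₁ / 4) = L₁ / 4 * a + L₂ * a ^ 2 / 2 := by
      field_simp; ring
    rw [← this]
    have : a + 2 * L₂ * a ^ 2 / L₁ < T := by linarith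
    gcongr
  have h5 : T * (fullLogLik ν ω (φ + k) - fullLogLik ν ω φ) ≤ T * -(L₁ / 4 * n) := by gcongr
  have h6 := mul_lt_mul_of_pos_right h4 hn0
  nlinarith

/-- The event on which the conclusions of the theorem hold has high probability. -/
theorem exists_event_constants (hν : IsExpFamilyBase ν) (q : ℕ) {a₁ a₂ a₃ : ℝ} (ha₁ : 0 < a₁)
    (ha₃ : 0 < a₃) (cond : CovCondition) :
    ∃ R lam₁ lam₂ lam₃ : ℝ, 0 < R ∧ 0 < lam₁ ∧ lam₁ ≤ 1 ∧ 0 < lam₂ ∧ 0 < lam₃ ∧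
      ∀ S : Scenario, S.BaseAssumptions q a₁ a₂ a₃ → cond.Holds ν S → ∀ᶠ n : ℕ in atTop,
        ProbAtLeast (sampleLaw ν n (S.covLaw n) (S.φstar n)) (1 - cond.failProb S n)
          {ω | CurvBounds ν ω (2 * q) (R + 1) lam₁ lam₂ lam₃ ∧
            ∀ J : Finset (Fin (S.p n)), J.card ≤ q → ∀ w, SuppOn J w → R < ‖w‖ →
              fullLogLik ν ω w < fullLogLik ν ω 0} := by
  set c : ℝ := 2 * q + 1 with hc
  have hc0 : 0 < c := by positivity
  have hcard : ∀ {p : ℕ} {J : Finset (Fin p)}, J.card ≤ 2 * q + 1 → (J.card : ℝ) ≤ c := by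
    intro p J hJ
    have : (J.card : ℝ) ≤ ((2 * q + 1 : ℕ) : ℝ) := by exact_mod_cast hJ
    push_cast at this
    exact this
  set b₀ := iteratedDeriv 2 (cumulant ν) 0
  have hb₀ : 0 < b₀ := hν.iteratedDeriv_two_cumulant_pos 0
  obtain ⟨D, hD0, hD⟩ := CovCondition.exists_pow_four_bound (ν := ν) cond
  obtain ⟨M, τ, C, hM, hτ, hC, hgram⟩ := exists_gram_lower_bound (2 * q) ha₁ hD0
  -- constants for the ball that contains the true parameter
  set ρ₀ : ℝ := c * (a₃ + 1) with hρ₀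
  have hρ₀' : 0 < ρ₀ := by positivity
  obtain ⟨t₀, ht₀, htail₀⟩ := cond.exists_envelope_tail hν hρ₀'
  obtain ⟨β₀, hβ₀, hβ₀'⟩ := hν.exists_lower_bound (c * M * (a₃ + 1))
  set L₁ := β₀ * (a₁ / 4) with hL₁
  have hL₁' : 0 < L₁ := by positivity
  set L₂ := c ^ 3 * (b₀ + ρ₀) * t₀ + 1 with hL₂
  have hL₂' : 0 < L₂ := by positivity
  set u := min 1 (L₁ / (4 * c * (1 + L₂ / 2))) with hu
  have hu0 : 0 < u := by positivity
  have huL : (2 * q + 1) * (u * (1 + L₂ / 2)) ≤ L₁ / 4 := by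
    calc (2 * q + 1) * (u * (1 + L₂ / 2))
        ≤ c * (L₁ / (4 * c * (1 + L₂ / 2)) * (1 + L₂ / 2)) := by
          gcongr
          exact min_le_right _ _
      _ = L₁ / 4 := by field_simp
  -- `R` uses only curvature constants of the ball of radius `a₃ + 1`. The final constants are then
  -- taken on the ball of radius `R + 1`, so the choice is not circular.
  set R := a₃ + (1 + a₃ + 2 * L₂ * a₃ ^ 2 / L₁) with hR
  have hR0 : 0 < R := by positivity
  -- constants for the ball of radius `R + 1`
  set ρ : ℝ := c * (R + 1) with hρ
  have hρ' : 0 < ρ := by positivity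
  obtain ⟨t, ht, htail⟩ := cond.exists_envelope_tail hν hρ'
  obtain ⟨β, hβ, hβ'⟩ := hν.exists_lower_bound (c * M * (R + 1))
  -- The minimum with 1 makes `log (max lam₁⁻¹ lam₂)` nonnegative, as `abs_log_laplace_le` needs;
  -- the summands `+ 1` keep the other constants positive even if `t = 0`.
  refine ⟨R, min 1 (β * (a₁ / 4)), c ^ 3 * (b₀ + ρ) * t + 1, c ^ 4 * t + 1, hR0, by positivity,
    min_le_left _ _, by positivity, by positivity, fun S hS hcond => ?_⟩
  filter_upwards [eventually_ge_atTop 2,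
    eventually_exp_bound S.p_pos hS.growth C (2 * q) hτ,
    eventually_exp_bound S.p_pos hS.growth 2 1 (show 0 < u ^ 2 by positivity)] with n hn hn1 hn2
  have := S.isProbabilityMeasure n
  have := hν.isProbabilityMeasure_sampleLaw (n := n) (μ := S.covLaw n) (φ := S.φstar n)
  have hextra := cond.extraFail_nonneg hcond hn
  have hfail : cond.failProb S n = cond.extraFail S n + ((n : ℝ) * S.p n)⁻¹ := by
    simp [CovCondition.extraFail]
  have hnp : 0 ≤ ((n : ℝ) * S.p n)⁻¹ := by positivity
  refine probAtLeast_of_compl_le (by rw [hfail]; positivity) ?_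
  set P := sampleLaw ν n (S.covLaw n) (S.φstar n)
  set A₀ : Set (Sample n (S.p n)) := {ω | ¬ ∀ j, ∑ i, envelope ν ρ₀ ((ω i).1 j) ≤ t₀ * n}
  set A₁ : Set (Sample n (S.p n)) := {ω | ¬ ∀ j, ∑ i, envelope ν ρ ((ω i).1 j) ≤ t * n}
  set A₂ : Set (Sample n (S.p n)) := {ω | (fun i => (ω i).1) ∈ {x : Fin n → Fin (S.p n) → ℝ |
    ¬ ∀ J : Finset (Fin (S.p n)), J.card ≤ 2 * q →
        ∀ v, SuppOn J v → a₁ / 4 * n * ‖v‖ ^ 2 ≤ ∑ i, truncSq J M v (x i)}}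
  set A₃ : Set (Sample n (S.p n)) := {ω | ¬ ∀ j : Fin (S.p n), ∀ s : ℝ, |s| = u →
      fullLogLik ν ω (S.φstar n + EuclideanSpace.single j s)
        - fullLogLik ν ω (S.φstar n) ≤ u ^ 2 * n}
  have hP₀ : P A₀ ≤ _ := htail₀ S hcond n hn
  have hP₁ : P A₁ ≤ _ := htail S hcond n hn
  have hP₂ : P A₂ ≤ ENNReal.ofReal (((n : ℝ) * S.p n)⁻¹ / 2) := by
    refine (hν.sampleLaw_cov_le _).trans ((hgram (S.p_pos n) (S.covLaw n) (hD S hcond n)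
      (fun J hJ v hv => S.sq_norm_le_integral hS (hD S hcond n) hJ hv) n).trans ?_)
    exact ENNReal.ofReal_le_ofReal hn1
  have hP₃ : P A₃ ≤ ENNReal.ofReal (((n : ℝ) * S.p n)⁻¹ / 2) := by
    refine (hν.sampleLaw_perturbation_le u (u ^ 2 * n)).trans (ENNReal.ofReal_le_ofReal ?_)
    rw [pow_one, neg_mul] at hn2
    exact hn2
  have hsub : {ω : Sample n (S.p n) | CurvBounds ν ω (2 * q) (R + 1) (min 1 (β * (a₁ / 4)))
      (c ^ 3 * (b₀ + ρ) * t + 1) (c ^ 4 * t + 1) ∧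
      ∀ J : Finset (Fin (S.p n)), J.card ≤ q → ∀ w, SuppOn J w → R < ‖w‖ →
        fullLogLik ν ω w < fullLogLik ν ω 0}ᶜ ⊆ A₀ ∪ A₁ ∪ (A₂ ∪ A₃) := by
    intro ω hω
    by_contra hcon
    simp only [Set.mem_union, not_or] at hcon
    obtain ⟨⟨h0, h1⟩, h2, h3⟩ := hcon
    have h0 : ∀ j, ∑ i, envelope ν ρ₀ ((ω i).1 j) ≤ t₀ * n := not_not.1 h0
    have h1 : ∀ j, ∑ i, envelope ν ρ ((ω i).1 j) ≤ t * n := not_not.1 h1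
    have h2 : ∀ J : Finset (Fin (S.p n)), J.card ≤ 2 * q →
        ∀ v, SuppOn J v → a₁ / 4 * n * ‖v‖ ^ 2 ≤ ∑ i, truncSq J M v (ω i).1 := not_not.1 h2
    have h3 : ∀ j : Fin (S.p n), ∀ s : ℝ, |s| = u →
      fullLogLik ν ω (S.φstar n + EuclideanSpace.single j s)
        - fullLogLik ν ω (S.φstar n) ≤ u ^ 2 * n := not_not.1 h3
    refine hω ⟨?_, ?_⟩
    · intro J hJ w h hw hh hwr
      have hJc := hcard (hJ.trans (Nat.le_succ _))
      refine ⟨?_, ?_, ?_⟩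
      · refine le_trans ?_ (hν.curv_ge hJc hM.le hβ.le hβ' hw hwr (h2 J hJ h hh))
        gcongr
        exact min_le_right _ _
      · refine (hν.curv_le hρ'.le ht h1 hJc le_rfl hw hwr hh).trans ?_
        gcongr
        linarith
      · intro w' hw' hwr'
        refine (hν.abs_curv_sub_le ht h1 hJc le_rfl hw hwr hw' hwr' hh).trans ?_
        gcongr
        linarith
    · intro J hJ w hw hwR
      refine hν.fullLogLik_lt_of_norm_gt (by omega) hu0 (min_le_left _ _) hL₁' hL₂' huL
        (fun J hJ w h hw hh hwr => hν.curv_ge (hcard (hJ.trans (Nat.le_succ _))) hM.le hβ₀.le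
          hβ₀' hw hwr (h2 J hJ h hh))
        (fun J hJ w h hw hh hwr =>
          (hν.curv_le hρ₀'.le ht₀ h0 (hcard hJ) le_rfl hw hwr hh).trans ?_)
        (hS.signal_bound n) (hS.sparsity n) ?_ h3 hJ hw hwR
      · gcongr
        linarith
      · intro j hj
        by_contra h
        exact hj (by simp [Scenario.trueSupport, h])
  -- The two envelope events share the extra failure probability; the Gram and likelihood-ratio
  -- events share `(np)⁻¹`.
  calc P _ ≤ P (A₀ ∪ A₁ ∪ (A₂ ∪ A₃)) := measure_mono hsub
    _ ≤ (P A₀ + P A₁) + (P A₂ + P A₃) :=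
      (measure_union_le _ _).trans (add_le_add (measure_union_le _ _) (measure_union_le _ _))
    _ ≤ (ENNReal.ofReal (cond.extraFail S n / 2) + ENNReal.ofReal (cond.extraFail S n / 2))
        + (ENNReal.ofReal (((n : ℝ) * S.p n)⁻¹ / 2) + ENNReal.ofReal (((n : ℝ) * S.p n)⁻¹ / 2)) :=
      add_le_add (add_le_add hP₀ hP₁) (add_le_add hP₂ hP₃)
    _ = ENNReal.ofReal (cond.failProb S n) := by
      rw [← ENNReal.ofReal_add (by positivity) (by positivity),
        ← ENNReal.ofReal_add (by positivity) (by positivity),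
        ← ENNReal.ofReal_add (by positivity) (by positivity), hfail]
      congr 1
      ring

end Event

/-! ### Laplace approximation -/

section Laplace

open Matrix

variable {ι : Type*} [Fintype ι]

lemma det_mem_Icc_of_quadratic_form [DecidableEq ι] {H : Matrix ι ι ℝ} (hH : H.IsHermitian)
    {l u : ℝ} (hl : 0 ≤ l)
    (hlow : ∀ h : EuclideanSpace ℝ ι, l * ‖h‖ ^ 2 ≤ h.ofLp ⬝ᵥ H *ᵥ h.ofLp)
    (hup : ∀ h : EuclideanSpace ℝ ι, h.ofLp ⬝ᵥ H *ᵥ h.ofLp ≤ u * ‖h‖ ^ 2) :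
    l ^ Fintype.card ι ≤ H.det ∧ H.det ≤ u ^ Fintype.card ι := by
  have he : ∀ i, hH.eigenvalues i = (hH.eigenvectorBasis i).ofLp ⬝ᵥ
      H *ᵥ (hH.eigenvectorBasis i).ofLp := fun i => by
    rw [hH.eigenvalues_eq]; simp
  have h1 : ∀ i, l ≤ hH.eigenvalues i ∧ hH.eigenvalues i ≤ u := by
    intro i
    have a := hlow (hH.eigenvectorBasis i)
    have b := hup (hH.eigenvectorBasis i)
    rw [← he, hH.eigenvectorBasis.norm_eq_one] at a b
    constructor <;> linarith
  rw [hH.det_eq_prod_eigenvalues]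
  simp only [RCLike.ofReal_real_eq_id, id]
  constructor
  · calc l ^ Fintype.card ι = ∏ _i : ι, l := by simp
      _ ≤ _ := Finset.prod_le_prod (fun _ _ => hl) fun i _ => (h1 i).1
  · calc _ ≤ ∏ _i : ι, u := Finset.prod_le_prod (fun i _ => hl.trans (h1 i).1) fun i _ => (h1 i).2
      _ = u ^ Fintype.card ι := by simp

/-- Factoring `H = Bᵀ * B`, the substitution `h ↦ B h` reduces this to the standard Gaussian
integral, with Jacobian `|det B| = (det H)^{1/2}`. -/
lemma integral_exp_neg_quadratic_form [DecidableEq ι] {H : Matrix ι ι ℝ} (hH : H.PosDef) :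
    ∫ h : EuclideanSpace ℝ ι, Real.exp (-((h.ofLp ⬝ᵥ H *ᵥ h.ofLp) / 2))
      = H.det ^ (-(1 / 2) : ℝ) * (2 * Real.pi) ^ ((Fintype.card ι : ℝ) / 2) := by
  obtain ⟨B, hB⟩ : ∃ B : Matrix ι ι ℝ, H = Bᵀ * B := by
    open MatrixOrder in
    obtain ⟨B, hB⟩ := CStarAlgebra.nonneg_iff_eq_star_mul_self.1 hH.posSemidef.nonneg
    exact ⟨B, by rw [hB, star_eq_conjTranspose, conjTranspose_eq_transpose_of_trivial]⟩
  have hdet : H.det = B.det ^ 2 := by rw [hB, det_mul, det_transpose, sq]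
  have hB0 : B.det ≠ 0 := by
    intro h
    have := hH.det_pos
    rw [hdet, h] at this
    norm_num at this
  set f : EuclideanSpace ℝ ι →ₗ[ℝ] EuclideanSpace ℝ ι :=
    Matrix.toLin (PiLp.basisFun 2 ℝ ι) (PiLp.basisFun 2 ℝ ι) B with hf
  have hfdet : LinearMap.det f = B.det := LinearMap.det_toLin _ _
  have hfapp : ∀ h : EuclideanSpace ℝ ι, (f h).ofLp = B *ᵥ h.ofLp := fun h => rfl
  have hq : ∀ h : EuclideanSpace ℝ ι, h.ofLp ⬝ᵥ H *ᵥ h.ofLp = ‖f h‖ ^ 2 := by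
    intro h
    rw [EuclideanSpace.norm_sq_eq, hB, ← Matrix.mulVec_mulVec, Matrix.dotProduct_mulVec,
      Matrix.vecMul_transpose]
    simp only [hfapp, dotProduct, Real.norm_eq_abs, sq_abs]
    exact Finset.sum_congr rfl fun _ _ => (sq _).symm
  have hmap := Measure.map_linearMap_addHaar_eq_smul_addHaar
    (volume : Measure (EuclideanSpace ℝ ι)) (f := f) (by rw [hfdet]; exact hB0)
  have hcont : Continuous f := LinearMap.continuous_of_finiteDimensional f
  have h1 : ∫ h, Real.exp (-(1 / 2) * ‖f h‖ ^ 2)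
      = |B.det|⁻¹ * ∫ h : EuclideanSpace ℝ ι, Real.exp (-(1 / 2) * ‖h‖ ^ 2) := by
    rw [← integral_map (φ := f) (f := fun y => Real.exp (-(1 / 2) * ‖y‖ ^ 2))
      hcont.measurable.aemeasurable (by fun_prop), hmap, integral_smul_measure, hfdet,
      ENNReal.toReal_ofReal (abs_nonneg _), abs_inv, smul_eq_mul]
  have h2 : ∀ h : EuclideanSpace ℝ ι, -((h.ofLp ⬝ᵥ H *ᵥ h.ofLp) / 2)
      = -(1 / 2) * ‖f h‖ ^ 2 := fun h => by rw [hq]; ring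
  simp only [h2]
  rw [h1, GaussianFourier.integral_rexp_neg_mul_sq_norm (by norm_num), finrank_euclideanSpace,
    hdet]
  congr 1
  · rw [← sq_abs, ← Real.rpow_natCast, ← Real.rpow_mul (abs_nonneg _)]
    norm_num
    rw [Real.rpow_neg_one]
  · congr 1
    ring

/-- The integral `∫ (1 + ‖s‖)^{-(d+1)} ds` over `ℝ^d`. -/
def bracketIntegral (d : ℕ) : ℝ :=
  ∫ s : EuclideanSpace ℝ (Fin d), (1 + ‖s‖) ^ (-((d : ℝ) + 1))

lemma bracketIntegral_nonneg (d : ℕ) : 0 ≤ bracketIntegral d :=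
  integral_nonneg fun s => by positivity

/-- Makes the Laplace constant depend on the dimension of the model only, hence uniform over models
and `n`. -/
lemma integral_bracket_eq :
    ∫ s : EuclideanSpace ℝ ι, (1 + ‖s‖) ^ (-((Fintype.card ι : ℝ) + 1))
      = bracketIntegral (Fintype.card ι) := by
  set e := LinearIsometryEquiv.piLpCongrLeft 2 ℝ ℝ (Fintype.equivFin ι)
  rw [bracketIntegral, ← e.measurePreserving.integral_comp e.toHomeomorph.measurableEmbedding]
  simp

lemma integrable_bracket :
    Integrable fun s : EuclideanSpace ℝ ι => (1 + ‖s‖) ^ (-((Fintype.card ι : ℝ) + 1)) :=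
  integrable_one_add_norm (by rw [finrank_euclideanSpace]; linarith)

/-- One term of the exponential series, `y ^ N / N! ≤ exp y` at `y = c * (1 + x)` with `N = d + 1 +
k`, provides enough decay for integrability in dimension `d`. -/
lemma pow_mul_exp_neg_le {x c : ℝ} (hx : 0 ≤ x) (hc : 0 < c) (d k : ℕ) :
    (1 + x) ^ k * Real.exp (-(c * x))
      ≤ (d + 1 + k).factorial * Real.exp c / c ^ (d + 1 + k) * (1 + x) ^ (-((d : ℝ) + 1)) := by
  have h := Real.pow_div_factorial_le_exp (x := c * (1 + x)) (by positivity) (d + 1 + k)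
  have hfac : (0 : ℝ) < (d + 1 + k).factorial := by positivity
  rw [div_le_iff₀ hfac] at h
  have e : (1 + x) ^ (-((d : ℝ) + 1)) = ((1 + x) ^ (d + 1))⁻¹ := by
    rw [Real.rpow_neg (by positivity)]
    congr 1
    exact_mod_cast Real.rpow_natCast (1 + x) (d + 1)
  rw [e, ← div_eq_mul_inv, le_div_iff₀ (by positivity), le_div_iff₀ (by positivity)]
  calc (1 + x) ^ k * Real.exp (-(c * x)) * (1 + x) ^ (d + 1) * c ^ (d + 1 + k)
      = (c * (1 + x)) ^ (d + 1 + k) * Real.exp (-(c * x)) := by rw [mul_pow]; ring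
    _ ≤ (Real.exp (c * (1 + x)) * (d + 1 + k).factorial) * Real.exp (-(c * x)) := by gcongr
    _ = (d + 1 + k).factorial * (Real.exp (c * (1 + x)) * Real.exp (-(c * x))) := by ring
    _ = (d + 1 + k).factorial * Real.exp c := by
      rw [← Real.exp_add]; congr 2; ring

lemma abs_exp_sub_exp_le {a b m : ℝ} (ha : a ≤ m) (hb : b ≤ m) :
    |Real.exp a - Real.exp b| ≤ |a - b| * Real.exp m := by
  have key : ∀ {a b : ℝ}, b ≤ a → a ≤ m → Real.exp a - Real.exp b ≤ (a - b) * Real.exp m := by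
    intro a b hab ham
    have h1 : 1 - Real.exp (b - a) ≤ a - b := by
      have := Real.add_one_le_exp (b - a)
      linarith
    calc Real.exp a - Real.exp b = (1 - Real.exp (b - a)) * Real.exp a := by
          rw [sub_mul, one_mul, ← Real.exp_add]; congr 2; ring
      _ ≤ (a - b) * Real.exp a := by gcongr
      _ ≤ (a - b) * Real.exp m := by
          have : 0 ≤ a - b := by linarith
          gcongr
  rcases le_total b a with h | h
  · rw [abs_of_nonneg (sub_nonneg.2 (Real.exp_le_exp.2 h)), abs_of_nonneg (sub_nonneg.2 h)]
    exact key h ha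
  · rw [abs_sub_comm, abs_sub_comm a, abs_of_nonneg (sub_nonneg.2 (Real.exp_le_exp.2 h)),
      abs_of_nonneg (sub_nonneg.2 h)]
    exact key h hb

/-- Pointwise comparison of the integrand with its Gaussian approximation. -/
lemma abs_laplace_integrand_le {l₁ l₃ F₁ F₃ a Q y z x r : ℝ} (hl₁ : 0 < l₁) (hl₃ : 0 < l₃)
    (hF₁ : 0 < F₁) (hF₃ : 0 < F₃) (hx : 0 ≤ x) (hr : 1 ≤ r) (hy0 : 0 ≤ y) (hy : y ≤ F₁)
    (hz0 : 0 ≤ z) (hz : z ≤ F₁) (hQ : l₁ * r ^ 2 * x ^ 2 ≤ Q)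
    (hnear : x ≤ 1 → a ≤ -(l₁ * r ^ 2 * x ^ 2 / 2) ∧ |a + Q / 2| ≤ l₃ * r ^ 2 * x ^ 3 ∧
      |y - z| ≤ F₃ * x)
    (hfar : 1 ≤ x → a ≤ -(l₁ * r ^ 2 * x / 2)) :
    |Real.exp a * y - z * Real.exp (-(Q / 2))| ≤ (F₁ * l₃ + F₃ + 2 * F₁) * Real.exp (l₁ / 2) / r
      * ((1 + r * x) ^ 3 * Real.exp (-(l₁ / 2 * (r * x)))) := by
  have hr0 : 0 < r := by linarith
  set s := r * x with hs
  have hs0 : 0 ≤ s := by positivity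
  have hs3 : s ^ 3 ≤ (1 + s) ^ 3 := by gcongr; linarith
  have hs1 : s ≤ (1 + s) ^ 3 := by nlinarith [pow_nonneg hs0 2, pow_nonneg hs0 3]
  have hqm : -(Q / 2) ≤ -(l₁ * r ^ 2 * x ^ 2 / 2) := by linarith
  set m := Real.exp (-(l₁ * r ^ 2 * x ^ 2 / 2)) with hm
  have hm0 : 0 < m := Real.exp_pos _
  set E := Real.exp (-(l₁ / 2 * s)) with hE
  have hE0 : 0 < E := Real.exp_pos _
  -- Since `s ^ 2 ≥ s - 1`, Gaussian decay is weakened to exponential decay in `s`, so that both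
  -- regimes share one majorant.
  have hmE : m ≤ Real.exp (l₁ / 2) * E := by
    rw [hm, hE, ← Real.exp_add]
    refine Real.exp_le_exp.2 ?_
    have : l₁ * r ^ 2 * x ^ 2 = l₁ * s ^ 2 := by rw [hs, mul_pow]; ring
    rw [this]
    nlinarith [sq_nonneg (s - 1 / 2)]
  have hQm : Real.exp (-(Q / 2)) ≤ m := Real.exp_le_exp.2 hqm
  set T := Real.exp (l₁ / 2) / r * ((1 + s) ^ 3 * E) with hT
  have hT0 : 0 ≤ T := by positivity
  have hgoal : (F₁ * l₃ + F₃ + 2 * F₁) * Real.exp (l₁ / 2) / r * ((1 + s) ^ 3 * E)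
      = (F₁ * l₃ + F₃ + 2 * F₁) * T := by rw [hT]; ring
  rw [hgoal]
  rcases le_total x 1 with hx1 | hx1
  · obtain ⟨h1, h2, h3⟩ := hnear hx1
    have a1 : |Real.exp a - Real.exp (-(Q / 2))| ≤ l₃ * r ^ 2 * x ^ 3 * m := by
      refine (abs_exp_sub_exp_le h1 hqm).trans (mul_le_mul_of_nonneg_right ?_ hm0.le)
      rwa [sub_neg_eq_add]
    have a3 : Real.exp a * y - z * Real.exp (-(Q / 2))
        = (Real.exp a - Real.exp (-(Q / 2))) * y + Real.exp (-(Q / 2)) * (y - z) := by ring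
    -- In the rescaled variable `s = r * x` the cubic Taylor error and the Lipschitz error of the
    -- prior each carry a factor `1 / r`, the rate of the approximation.
    have e1 : r ^ 2 * x ^ 3 = s ^ 3 / r := by rw [hs]; field_simp
    have e2 : F₃ * x = F₃ * s / r := by rw [hs]; field_simp
    calc |Real.exp a * y - z * Real.exp (-(Q / 2))|
        ≤ l₃ * r ^ 2 * x ^ 3 * m * F₁ + m * (F₃ * x) := by
          rw [a3]
          refine (abs_add_le _ _).trans (add_le_add ?_ ?_)
          · rw [abs_mul, abs_of_nonneg hy0]
            exact mul_le_mul a1 hy hy0 (by positivity)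
          · rw [abs_mul, abs_of_pos (Real.exp_pos _)]
            exact mul_le_mul hQm h3 (abs_nonneg _) hm0.le
      _ = (F₁ * l₃ * (r ^ 2 * x ^ 3) + F₃ * x) * m := by ring
      _ = (F₁ * l₃ * s ^ 3 + F₃ * s) / r * m := by rw [e1, e2]; ring
      _ ≤ (F₁ * l₃ * (1 + s) ^ 3 + F₃ * (1 + s) ^ 3) / r * (Real.exp (l₁ / 2) * E) := by gcongr
      _ = (F₁ * l₃ + F₃) * T := by rw [hT]; ring
      _ ≤ (F₁ * l₃ + F₃ + 2 * F₁) * T := mul_le_mul_of_nonneg_right (by linarith) hT0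
  · have b1 : Real.exp a ≤ E := by
      refine Real.exp_le_exp.2 ((hfar hx1).trans ?_)
      have : s ≤ r ^ 2 * x := by rw [hs]; nlinarith
      nlinarith
    have b3 : 1 ≤ Real.exp (l₁ / 2) := Real.one_le_exp (by positivity)
    -- Far from the maximizer `s ≥ r`, so the factor `1 / r` is inserted at no cost and the two
    -- terms need not be compared with each other.
    have b4 : 1 ≤ (1 + s) ^ 3 / r := by
      rw [one_le_div hr0]
      refine le_trans ?_ hs1
      rw [hs]
      nlinarith
    have b5 : |Real.exp a * y - z * Real.exp (-(Q / 2))|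
        ≤ E * F₁ + F₁ * (Real.exp (l₁ / 2) * E) := by
      refine (abs_sub _ _).trans (add_le_add ?_ ?_)
      · rw [abs_mul, abs_of_pos (Real.exp_pos _), abs_of_nonneg hy0]
        exact mul_le_mul b1 hy hy0 hE0.le
      · rw [abs_mul, abs_of_pos (Real.exp_pos _), abs_of_nonneg hz0]
        exact mul_le_mul hz (hQm.trans hmE) (Real.exp_pos _).le hF₁.le
    have b6 : E ≤ Real.exp (l₁ / 2) * E := le_mul_of_one_le_left hE0.le b3
    have b7 : Real.exp (l₁ / 2) * E ≤ T := by
      calc Real.exp (l₁ / 2) * E ≤ Real.exp (l₁ / 2) * E * ((1 + s) ^ 3 / r) :=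
            le_mul_of_one_le_right (by positivity) b4
        _ = T := by rw [hT]; ring
    have b8 : 0 ≤ (F₁ * l₃ + F₃) * T := by positivity
    nlinarith

/-- The constant of the Laplace approximation in dimension `d`. -/
def laplaceConst (l₁ l₂ l₃ F₁ F₂ F₃ : ℝ) (d : ℕ) : ℝ :=
  (F₁ * l₃ + F₃ + 2 * F₁) * Real.exp (l₁ / 2)
    * ((d + 1 + 3).factorial * Real.exp (l₁ / 2) / (l₁ / 2) ^ (d + 1 + 3))
    * bracketIntegral d * l₂ ^ ((d : ℝ) / 2) / F₂

lemma laplaceConst_nonneg {l₁ l₂ l₃ F₁ F₂ F₃ : ℝ} (h₁ : 0 < l₁) (h₂ : 0 < l₂) (h₃ : 0 < l₃)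
    (hF₁ : 0 < F₁) (hF₂ : 0 < F₂) (hF₃ : 0 < F₃) (d : ℕ) :
    0 ≤ laplaceConst l₁ l₂ l₃ F₁ F₂ F₃ d := by
  have := bracketIntegral_nonneg d
  unfold laplaceConst
  positivity

/-- The Laplace approximation of `∫ exp(ℓ) f` around a maximizer `φ` of `ℓ`. -/
theorem laplace_approximation [DecidableEq ι] {l₁ l₂ l₃ F₁ F₂ F₃ R : ℝ} (hl₁ : 0 < l₁)
    (hl₂ : 0 < l₂) (hl₃ : 0 < l₃) (hF₁ : 0 < F₁) (hF₂ : 0 < F₂) (hF₃ : 0 < F₃) {n : ℕ} (hn : 1 ≤ n)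
    {ℓ f : EuclideanSpace ℝ ι → ℝ} {φ : EuclideanSpace ℝ ι} {H : Matrix ι ι ℝ}
    (hℓm : Measurable ℓ) (hfm : Measurable f) (hf0 : ∀ ψ, 0 ≤ f ψ) (hf : PriorBounds f (R + 1) F₁ F₂ F₃)
    (hφ : ‖φ‖ ≤ R) (hH : H.IsHermitian)
    (hlow : ∀ h : EuclideanSpace ℝ ι, l₁ * n * ‖h‖ ^ 2 ≤ h.ofLp ⬝ᵥ H *ᵥ h.ofLp)
    (hup : ∀ h : EuclideanSpace ℝ ι, h.ofLp ⬝ᵥ H *ᵥ h.ofLp ≤ l₂ * n * ‖h‖ ^ 2)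
    (h1 : ∀ h, ‖h‖ ≤ 1 → ℓ (φ + h) - ℓ φ ≤ -(l₁ * n * ‖h‖ ^ 2 / 2))
    (h2 : ∀ h : EuclideanSpace ℝ ι, ‖h‖ ≤ 1 →
      |ℓ (φ + h) - ℓ φ + (h.ofLp ⬝ᵥ H *ᵥ h.ofLp) / 2| ≤ l₃ * n * ‖h‖ ^ 3)
    (h3 : ∀ h, 1 ≤ ‖h‖ → ℓ (φ + h) - ℓ φ ≤ -(l₁ * n * ‖h‖ / 2)) :
    Integrable (fun ψ => Real.exp (ℓ ψ) * f ψ) ∧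
      |(∫ ψ, Real.exp (ℓ ψ) * f ψ) - Real.exp (ℓ φ) * f φ * (H.det ^ (-(1 / 2) : ℝ)
          * (2 * Real.pi) ^ ((Fintype.card ι : ℝ) / 2))|
        ≤ laplaceConst l₁ l₂ l₃ F₁ F₂ F₃ (Fintype.card ι) / Real.sqrt n *
          (Real.exp (ℓ φ) * f φ * (H.det ^ (-(1 / 2) : ℝ)
          * (2 * Real.pi) ^ ((Fintype.card ι : ℝ) / 2))) := by
  set d := Fintype.card ι with hd
  have hn0 : (0 : ℝ) < n := by exact_mod_cast hn
  have hn1 : (1 : ℝ) ≤ n := by exact_mod_cast hn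
  set r := Real.sqrt n with hr
  have hr1 : 1 ≤ r := Real.one_le_sqrt.2 hn1
  have hr0 : 0 < r := by linarith
  have hrr : r ^ 2 = n := Real.sq_sqrt hn0.le
  set q : EuclideanSpace ℝ ι → ℝ := fun h => h.ofLp ⬝ᵥ H *ᵥ h.ofLp with hq
  have hpd : H.PosDef := by
    refine Matrix.PosDef.of_dotProduct_mulVec_pos hH fun x hx => ?_
    have := hlow (WithLp.toLp 2 x)
    have hx' : 0 < ‖WithLp.toLp 2 x‖ := norm_pos_iff.2 fun h => hx (by
      have := congrArg WithLp.ofLp h; simpa using this)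
    rw [star_trivial]
    exact lt_of_lt_of_le (by positivity) this
  set G := H.det ^ (-(1 / 2) : ℝ) * (2 * Real.pi) ^ ((d : ℝ) / 2) with hG
  have hdet0 := hpd.det_pos
  have hG0 : 0 < G := by positivity
  have hgauss : ∫ h, Real.exp (-(q h / 2)) = G := integral_exp_neg_quadratic_form hpd
  -- The integral of a non-integrable function is 0 by convention, whereas this one is positive.
  have hgi : Integrable fun h => Real.exp (-(q h / 2)) := by
    by_contra h
    rw [integral_undef h] at hgauss
    exact hG0.ne hgauss
  set A := (F₁ * l₃ + F₃ + 2 * F₁) * Real.exp (l₁ / 2) with hA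
  set B := ((d + 1 + 3).factorial * Real.exp (l₁ / 2) / (l₁ / 2) ^ (d + 1 + 3)) with hB
  have hA0 : 0 < A := by positivity
  have hB0 : 0 < B := by positivity
  set g : EuclideanSpace ℝ ι → ℝ := fun h => A * B / r * (1 + ‖r • h‖) ^ (-((d : ℝ) + 1)) with hg
  set D : EuclideanSpace ℝ ι → ℝ := fun h =>
    Real.exp (ℓ (φ + h) - ℓ φ) * f (φ + h) - f φ * Real.exp (-(q h / 2)) with hD
  have hfφ : F₂ ≤ f φ := hf.lower φ (hφ.trans (by linarith))
  have hDg : ∀ h, |D h| ≤ g h := by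
    intro h
    set x := ‖h‖ with hx
    have hx0 : 0 ≤ x := norm_nonneg _
    set s := ‖r • h‖ with hs
    have hsx : s = r * x := by rw [hs, norm_smul, Real.norm_eq_abs, abs_of_pos hr0]
    have hs0 : 0 ≤ s := norm_nonneg _
    have hfin : A / r * ((1 + s) ^ 3 * Real.exp (-(l₁ / 2 * s))) ≤ g h := by
      have := pow_mul_exp_neg_le hs0 (show 0 < l₁ / 2 by positivity) d 3
      calc _ ≤ A / r * (B * (1 + s) ^ (-((d : ℝ) + 1))) := by gcongr
        _ = g h := by rw [hg]; ring
    refine le_trans ?_ hfin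
    have hb := abs_laplace_integrand_le (l₁ := l₁) (l₃ := l₃) (a := ℓ (φ + h) - ℓ φ) (Q := q h)
      (y := f (φ + h)) (z := f φ) hl₁ hl₃ hF₁ hF₃ hx0 hr1 (hf0 _) (hf.upper _) (hf0 _) (hf.upper _)
      (by rw [hrr]; exact hlow h)
      (fun hx1 => by
        rw [hrr]
        refine ⟨h1 h hx1, h2 h hx1, ?_⟩
        have hball : ‖φ + h‖ ≤ R + 1 := (norm_add_le _ _).trans (add_le_add hφ hx1)
        have := hf.lipschitz (φ + h) φ hball (hφ.trans (by linarith))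
        simpa using this)
      (fun hx1 => by rw [hrr]; exact h3 h hx1)
    rw [← hsx] at hb
    exact hb
  have hgint : Integrable g :=
    ((integrable_bracket (ι := ι)).comp_smul hr0.ne').const_mul _
  have hgval : ∫ h, g h = A * B / r * ((r ^ d)⁻¹ * bracketIntegral d) := by
    rw [hg, integral_const_mul, Measure.integral_comp_smul volume
      (fun s : EuclideanSpace ℝ ι => (1 + ‖s‖) ^ (-((d : ℝ) + 1))) r, finrank_euclideanSpace,
      abs_of_pos (by positivity), smul_eq_mul, integral_bracket_eq]
  have hqm : Measurable q := by
    have : Continuous q := by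
      simp only [hq, dotProduct, Matrix.mulVec]
      fun_prop
    exact this.measurable
  have hmadd : Measurable fun h : EuclideanSpace ℝ ι => φ + h := measurable_const_add φ
  have hDm : Measurable D := by
    have e1 := hℓm.comp hmadd
    have e2 := hfm.comp hmadd
    exact ((e1.sub_const _).exp.mul e2).sub ((hqm.div_const 2).neg.exp.const_mul _)
  have hDi : Integrable D := hgint.mono' hDm.aestronglyMeasurable (ae_of_all _ hDg)
  have hsum : Integrable fun h => Real.exp (ℓ (φ + h) - ℓ φ) * f (φ + h) := by
    refine (hDi.add (hgi.const_mul (f φ))).congr (ae_of_all _ fun h => ?_)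
    simp [hD]
  have hshift : Integrable fun h => Real.exp (ℓ (φ + h)) * f (φ + h) := by
    refine (hsum.const_mul (Real.exp (ℓ φ))).congr (ae_of_all _ fun h => ?_)
    dsimp only
    rw [← mul_assoc, ← Real.exp_add, add_sub_cancel]
  refine ⟨?_, ?_⟩
  · have := (measurePreserving_add_left volume φ).integrable_comp_emb
      (measurableEmbedding_addLeft φ) (g := fun ψ => Real.exp (ℓ ψ) * f ψ)
    exact this.1 hshift
  have hint : ∫ ψ, Real.exp (ℓ ψ) * f ψ = Real.exp (ℓ φ) * (f φ * G + ∫ h, D h) := by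
    rw [← integral_add_left_eq_self (fun ψ => Real.exp (ℓ ψ) * f ψ) φ, ← hgauss,
      ← integral_const_mul, ← integral_add (hgi.const_mul _) hDi, ← integral_const_mul]
    refine integral_congr_ae (ae_of_all _ fun h => ?_)
    simp only [hD]
    rw [add_sub_cancel, ← mul_assoc, ← Real.exp_add, add_sub_cancel]
  have hDle : |∫ h, D h| ≤ A * B / r * ((r ^ d)⁻¹ * bracketIntegral d) := by
    rw [← hgval]
    exact (norm_integral_le_integral_norm D).trans (integral_mono hDi.norm hgint hDg)
  -- From `det H ≤ (l₂ * n) ^ d`. The scaling `(r ^ d)⁻¹` matches that of the integral of `g`, so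
  -- only `1 / r` remains in the relative error.
  have hGlow : (l₂ ^ ((d : ℝ) / 2))⁻¹ * (r ^ d)⁻¹ ≤ G := by
    have hdle := (det_mem_Icc_of_quadratic_form hH (by positivity) hlow hup).2
    have e : ((l₂ * n) ^ d) ^ (-(1 / 2) : ℝ) = (l₂ ^ ((d : ℝ) / 2))⁻¹ * (r ^ d)⁻¹ := by
      rw [mul_pow, Real.mul_rpow (by positivity) (by positivity), ← hrr, ← pow_mul,
        ← Real.rpow_natCast l₂, ← Real.rpow_natCast r, ← Real.rpow_natCast r,
        ← Real.rpow_mul hl₂.le, ← Real.rpow_mul hr0.le, ← Real.rpow_neg hl₂.le,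
        ← Real.rpow_neg hr0.le]
      congr 2
      · ring
      · push_cast; ring
    rw [hG, ← e]
    have h2pi : 1 ≤ (2 * Real.pi) ^ ((d : ℝ) / 2) :=
      Real.one_le_rpow (by linarith [Real.pi_gt_three]) (by positivity)
    have hmono : ((l₂ * n) ^ d) ^ (-(1 / 2) : ℝ) ≤ H.det ^ (-(1 / 2) : ℝ) :=
      Real.rpow_le_rpow_of_nonpos hdet0 hdle (by norm_num)
    exact hmono.trans (le_mul_of_one_le_right (by positivity) h2pi)
  have hI0 := bracketIntegral_nonneg d
  have hfφ0 : 0 < f φ := lt_of_lt_of_le hF₂ hfφ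
  have e0 : Real.exp (ℓ φ) * (f φ * G + ∫ h, D h) - Real.exp (ℓ φ) * f φ * G
      = Real.exp (ℓ φ) * ∫ h, D h := by ring
  rw [hint, e0, abs_mul, abs_of_pos (Real.exp_pos _)]
  have hLc : laplaceConst l₁ l₂ l₃ F₁ F₂ F₃ d
      = A * B * bracketIntegral d * l₂ ^ ((d : ℝ) / 2) / F₂ := rfl
  have hl2d : 0 < l₂ ^ ((d : ℝ) / 2) := by positivity
  calc Real.exp (ℓ φ) * |∫ h, D h|
      ≤ Real.exp (ℓ φ) * (A * B / r * ((r ^ d)⁻¹ * bracketIntegral d)) := by gcongr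
    _ = Real.exp (ℓ φ) * (A * B * bracketIntegral d * l₂ ^ ((d : ℝ) / 2) / F₂ / r
        * (F₂ * ((l₂ ^ ((d : ℝ) / 2))⁻¹ * (r ^ d)⁻¹))) := by field_simp
    _ ≤ Real.exp (ℓ φ) * (A * B * bracketIntegral d * l₂ ^ ((d : ℝ) / 2) / F₂ / r
        * (f φ * G)) := by gcongr
    _ = _ := by rw [hLc]; ring

end Laplace

/-! ### Submodels -/

section Submodel

open Matrix

variable {p n : ℕ} {ν : Measure ℝ} {J : Finset (Fin p)}

/-- Extension of a parameter vector of the model `J` by zero. -/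
def extend (J : Finset (Fin p)) (φ : EuclideanSpace ℝ J) : EuclideanSpace ℝ (Fin p) :=
  WithLp.toLp 2 fun j => if h : j ∈ J then φ ⟨j, h⟩ else 0

lemma suppOn_extend (φ : EuclideanSpace ℝ J) : SuppOn J (extend J φ) := fun j hj => by
  simp [extend, hj]

@[simp] lemma extend_apply_coe (φ : EuclideanSpace ℝ J) (j : J) : extend J φ j = φ j := by
  simp [extend]

lemma extend_add (φ ψ : EuclideanSpace ℝ J) : extend J (φ + ψ) = extend J φ + extend J ψ := by
  ext j
  by_cases h : j ∈ J <;> simp [extend, h]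

lemma extend_sub (φ ψ : EuclideanSpace ℝ J) : extend J (φ - ψ) = extend J φ - extend J ψ := by
  ext j
  by_cases h : j ∈ J <;> simp [extend, h]

lemma extend_smul (s : ℝ) (φ : EuclideanSpace ℝ J) : extend J (s • φ) = s • extend J φ := by
  ext j
  by_cases h : j ∈ J <;> simp [extend, h]

@[simp] lemma extend_zero : extend J 0 = 0 := by
  ext j
  simp [extend]

@[simp] lemma norm_extend (φ : EuclideanSpace ℝ J) : ‖extend J φ‖ = ‖φ‖ := by
  rw [EuclideanSpace.norm_eq, EuclideanSpace.norm_eq]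
  congr 1
  rw [← Finset.sum_subset (Finset.subset_univ J) fun j _ hj => by
    rw [suppOn_extend φ j hj]; simp, ← Finset.sum_coe_sort J]
  simp

lemma pred_extend (x : Fin p → ℝ) (φ : EuclideanSpace ℝ J) :
    pred x (extend J φ) = ∑ j : J, x j * φ j := by
  rw [(suppOn_extend φ).pred_eq, ← Finset.sum_coe_sort J]
  simp

lemma linPred_eq (ω : Sample n p) (i : Fin n) (φ : EuclideanSpace ℝ J) :
    linPred ω J i φ = pred (ω i).1 (extend J φ) := (pred_extend _ _).symm

lemma logLik_eq (ω : Sample n p) (φ : EuclideanSpace ℝ J) :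
    logLik ν ω J φ = fullLogLik ν ω (extend J φ) := by
  simp only [logLik, fullLogLik, linPred_eq]

lemma differentiable_pred_extend (x : Fin p → ℝ) :
    Differentiable ℝ fun φ : EuclideanSpace ℝ J => pred x (extend J φ) := by
  simp only [pred_extend]
  fun_prop

/-! ### Derivatives in submodels and the maximum likelihood estimator. -/

namespace IsExpFamilyBase

variable (hν : IsExpFamilyBase ν)

include hν

lemma differentiable_iteratedDeriv_cumulant (k : ℕ) :
    Differentiable ℝ (iteratedDeriv k (cumulant ν)) := fun θ =>
  (hν.hasDerivAt_iteratedDeriv_cumulant k θ).differentiableAt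

lemma differentiable_logLik (ω : Sample n p) : Differentiable ℝ (logLik ν ω J) := by
  have : logLik ν ω J = fun φ => ∑ i, ((ω i).2 * pred (ω i).1 (extend J φ)
      - cumulant ν (pred (ω i).1 (extend J φ))) := funext fun φ => logLik_eq ω φ
  rw [this]
  refine Differentiable.fun_sum fun i _ => ?_
  have h := differentiable_pred_extend (J := J) (ω i).1
  have hc : Differentiable ℝ (cumulant ν) := fun θ => (hν.hasDerivAt_cumulant θ).differentiableAt
  exact (h.const_mul _).sub (hc.comp h)

lemma differentiable_score (ω : Sample n p) (v : EuclideanSpace ℝ (Fin p)) :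
    Differentiable ℝ fun φ : EuclideanSpace ℝ J => score ν ω (extend J φ) v := by
  unfold score
  refine Differentiable.fun_sum fun i _ => ?_
  have h := differentiable_pred_extend (J := J) (ω i).1
  exact (((hν.differentiable_iteratedDeriv_cumulant 1).comp h).const_sub _).mul_const _

lemma fderiv_logLik (ω : Sample n p) (φ v : EuclideanSpace ℝ J) :
    fderiv ℝ (logLik ν ω J) φ v = score ν ω (extend J φ) (extend J v) := by
  rw [← (hν.differentiable_logLik ω φ).lineDeriv_eq_fderiv]
  refine HasLineDerivAt.lineDeriv ?_
  have := hν.hasDerivAt_fullLogLik ω (extend J φ) (extend J v) 0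
  simpa only [HasLineDerivAt, logLik_eq, extend_add, extend_smul, zero_smul, add_zero] using this

lemma negHessian_apply (ω : Sample n p) (φ : EuclideanSpace ℝ J) (j k : J) :
    negHessian ν ω J φ j k = ∑ i, (ω i).1 j * (ω i).1 k *
      iteratedDeriv 2 (cumulant ν) (pred (ω i).1 (extend J φ)) := by
  have hs : ∀ i, ∀ l : J, pred (ω i).1 (extend J (EuclideanSpace.single l 1)) = (ω i).1 l := by
    intro i l
    rw [pred_extend]
    simp
  simp only [negHessian, Matrix.of_apply, hν.fderiv_logLik]
  rw [← (hν.differentiable_score ω _ φ).lineDeriv_eq_fderiv, HasLineDerivAt.lineDeriv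
    (f' := -∑ i, (ω i).1 j * (ω i).1 k *
      iteratedDeriv 2 (cumulant ν) (pred (ω i).1 (extend J φ))) ?_, neg_neg]
  have := hν.hasDerivAt_score ω (extend J φ) (extend J (EuclideanSpace.single j 1))
    (extend J (EuclideanSpace.single k 1)) 0
  simpa only [HasLineDerivAt, extend_add, extend_smul, zero_smul, add_zero, hs] using this

lemma isHermitian_negHessian (ω : Sample n p) (φ : EuclideanSpace ℝ J) :
    (negHessian ν ω J φ).IsHermitian := by
  ext j k
  simp only [Matrix.conjTranspose_apply, star_trivial, hν.negHessian_apply]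
  exact Finset.sum_congr rfl fun _ _ => by ring

lemma dotProduct_negHessian_mulVec (ω : Sample n p) (φ h : EuclideanSpace ℝ J) :
    h.ofLp ⬝ᵥ negHessian ν ω J φ *ᵥ h.ofLp = curv ν ω (extend J φ) (extend J h) := by
  have e : ∀ i, pred (ω i).1 (extend J h) ^ 2
      * iteratedDeriv 2 (cumulant ν) (pred (ω i).1 (extend J φ))
      = ∑ j : J, ∑ k : J, h j * ((ω i).1 j * (ω i).1 k *
        iteratedDeriv 2 (cumulant ν) (pred (ω i).1 (extend J φ)) * h k) := by
    intro i
    rw [pred_extend _ h, sq, Finset.sum_mul_sum, Finset.sum_mul]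
    refine Finset.sum_congr rfl fun j _ => ?_
    rw [Finset.sum_mul]
    exact Finset.sum_congr rfl fun k _ => by ring
  simp only [dotProduct, Matrix.mulVec, hν.negHessian_apply, curv, e]
  conv_rhs => rw [Finset.sum_comm]
  refine Finset.sum_congr rfl fun j _ => ?_
  rw [Finset.sum_comm, Finset.mul_sum]
  exact Finset.sum_congr rfl fun k _ => by rw [Finset.sum_mul, Finset.mul_sum]

/-- Bounds on the curvature are bounds on the Hessian matrices. -/
lemma hessianBounds_of_curvBounds {ω : Sample n p} (hn : 1 ≤ n) {m : ℕ} {r l₁ l₂ l₃ : ℝ}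
    (h : CurvBounds ν ω m r l₁ l₂ l₃) : HessianBounds ν ω m r l₁ l₂ l₃ := by
  have hn0 : (0 : ℝ) < n := by exact_mod_cast hn
  intro J hJ
  have hsq : ∀ x : J → ℝ, ‖extend J (WithLp.toLp 2 x)‖ ^ 2 = x ⬝ᵥ x := by
    intro x
    rw [norm_extend, EuclideanSpace.norm_sq_eq]
    simp [dotProduct, sq]
  have hdot : ∀ (φ : EuclideanSpace ℝ J) (x : J → ℝ), x ⬝ᵥ negHessian ν ω J φ *ᵥ x
      = curv ν ω (extend J φ) (extend J (WithLp.toLp 2 x)) := fun φ x =>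
    hν.dotProduct_negHessian_mulVec ω φ (WithLp.toLp 2 x)
  have hone : ∀ s : ℝ, (s • (1 : Matrix J J ℝ)).IsHermitian := fun s =>
    Matrix.isHermitian_one.smul (IsSelfAdjoint.all s)
  have hHs : ∀ {A : Matrix J J ℝ} (s : ℝ), A.IsHermitian → (s • A).IsHermitian := fun s hA =>
    hA.smul (IsSelfAdjoint.all s)
  refine ⟨fun φ hφ => ⟨?_, ?_⟩, fun φ φ' hφ hφ' => ?_⟩
  · refine Matrix.PosSemidef.of_dotProduct_mulVec_nonneg
      ((hHs _ (hν.isHermitian_negHessian ω φ)).sub (hone _)) fun x => ?_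
    have hb := (h J hJ _ _ (suppOn_extend φ) (suppOn_extend (WithLp.toLp 2 x))
      (by rwa [norm_extend])).1
    rw [hsq, ← hdot] at hb
    simp only [star_trivial, Matrix.sub_mulVec, dotProduct_sub, Matrix.smul_mulVec,
      Matrix.one_mulVec, dotProduct_smul, smul_eq_mul, sub_nonneg]
    rw [one_div, inv_mul_eq_div, le_div_iff₀ hn0]
    linarith
  · refine Matrix.PosSemidef.of_dotProduct_mulVec_nonneg
      ((hone _).sub (hHs _ (hν.isHermitian_negHessian ω φ))) fun x => ?_
    have hb := (h J hJ _ _ (suppOn_extend φ) (suppOn_extend (WithLp.toLp 2 x))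
      (by rwa [norm_extend])).2.1
    rw [hsq, ← hdot] at hb
    simp only [star_trivial, Matrix.sub_mulVec, dotProduct_sub, Matrix.smul_mulVec,
      Matrix.one_mulVec, dotProduct_smul, smul_eq_mul, sub_nonneg]
    rw [one_div, inv_mul_eq_div, div_le_iff₀ hn0]
    linarith
  · refine Matrix.PosSemidef.of_dotProduct_mulVec_nonneg
      ((hone _).sub (hHs _ ((hν.isHermitian_negHessian ω φ).sub
        (hν.isHermitian_negHessian ω φ')))) fun x => ?_
    have hb := (le_abs_self _).trans ((h J hJ _ _ (suppOn_extend φ)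
      (suppOn_extend (WithLp.toLp 2 x)) (by rwa [norm_extend])).2.2 _ (suppOn_extend φ')
      (by rwa [norm_extend]))
    rw [hsq, ← hdot, ← hdot, ← extend_sub, norm_extend] at hb
    simp only [star_trivial, Matrix.sub_mulVec, dotProduct_sub, Matrix.smul_mulVec,
      Matrix.one_mulVec, dotProduct_smul, smul_eq_mul, sub_nonneg]
    rw [one_div, inv_mul_eq_div, div_le_iff₀ hn0]
    linarith

/-- Existence and uniqueness of the maximum likelihood estimator, and the behaviour of the
log-likelihood around it. -/
lemma exists_isMLE {ω : Sample n p} (hn : 1 ≤ n) {m : ℕ} {R l₁ l₂ l₃ : ℝ} (hR : 0 ≤ R)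
    (hl₁ : 0 < l₁) (hl₃ : 0 < l₃) (h : CurvBounds ν ω m (R + 1) l₁ l₂ l₃) (hJ : J.card ≤ m)
    (hfar : ∀ w, SuppOn J w → R < ‖w‖ → fullLogLik ν ω w < fullLogLik ν ω 0) :
    ∃ φ : EuclideanSpace ℝ J, IsMLE ν ω J φ ∧ ‖φ‖ ≤ R ∧
      (∀ h, ‖h‖ ≤ 1 → logLik ν ω J (φ + h) - logLik ν ω J φ ≤ -(l₁ * n * ‖h‖ ^ 2 / 2)) ∧
      (∀ h : EuclideanSpace ℝ J, ‖h‖ ≤ 1 → |logLik ν ω J (φ + h) - logLik ν ω J φ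
        + (h.ofLp ⬝ᵥ negHessian ν ω J φ *ᵥ h.ofLp) / 2| ≤ l₃ * n * ‖h‖ ^ 3) ∧
      (∀ h, 1 ≤ ‖h‖ → logLik ν ω J (φ + h) - logLik ν ω J φ ≤ -(l₁ * n * ‖h‖ / 2)) := by
  have hn0 : (0 : ℝ) < n := by exact_mod_cast hn
  have hcont : Continuous (logLik ν ω J) := (hν.differentiable_logLik ω).continuous
  obtain ⟨φ, hφR, hφmax⟩ := (isCompact_closedBall (0 : EuclideanSpace ℝ J) R).exists_isMaxOn
    ⟨0, by simpa using hR⟩ hcont.continuousOn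
  rw [mem_closedBall_zero_iff] at hφR
  -- The maximum over the compact ball is global, since outside it the value is below that at the
  -- origin, which the ball contains.
  have hmax : ∀ ψ, logLik ν ω J ψ ≤ logLik ν ω J φ := by
    intro ψ
    rcases le_or_gt ‖ψ‖ R with hψ | hψ
    · exact hφmax (mem_closedBall_zero_iff.2 hψ)
    · have h0 : logLik ν ω J 0 ≤ logLik ν ω J φ :=
        hφmax (mem_closedBall_zero_iff.2 (by simpa using hR))
      have h1 := hfar (extend J ψ) (suppOn_extend ψ) (by rwa [norm_extend])
      rw [← extend_zero (J := J), ← logLik_eq, ← logLik_eq] at h1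
      linarith
  have hscore : ∀ v : EuclideanSpace ℝ J, score ν ω (extend J φ) (extend J v) = 0 := by
    intro v
    rw [← hν.fderiv_logLik]
    have : IsLocalMax (logLik ν ω J) φ := Filter.Eventually.of_forall hmax
    rw [this.fderiv_eq_zero]
    rfl
  have htaylor : ∀ v : EuclideanSpace ℝ J, ‖v‖ ≤ 1 → ∃ ξ ∈ Set.Ioo (0 : ℝ) 1,
      logLik ν ω J (φ + v) - logLik ν ω J φ
        = -curv ν ω (extend J φ + ξ • extend J v) (extend J v) / 2 ∧
      ‖extend J φ + ξ • extend J v‖ ≤ R + 1 := by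
    intro v hv
    obtain ⟨ξ, hξ, he⟩ := hν.exists_taylor_fullLogLik ω (extend J φ) (extend J v)
    refine ⟨ξ, hξ, ?_, ?_⟩
    · rw [logLik_eq, logLik_eq, extend_add, he, hscore]
      ring
    · refine (norm_add_le _ _).trans ?_
      rw [norm_extend, norm_smul, norm_extend, Real.norm_eq_abs, abs_of_pos hξ.1]
      have : ξ * ‖v‖ ≤ 1 * 1 := mul_le_mul hξ.2.le hv (norm_nonneg _) zero_le_one
      linarith
  have hsupp : ∀ (ξ : ℝ) (v : EuclideanSpace ℝ J), SuppOn J (extend J φ + ξ • extend J v) :=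
    fun ξ v => (suppOn_extend φ).add ((suppOn_extend v).smul ξ)
  have h1 : ∀ v, ‖v‖ ≤ 1 →
      logLik ν ω J (φ + v) - logLik ν ω J φ ≤ -(l₁ * n * ‖v‖ ^ 2 / 2) := by
    intro v hv
    obtain ⟨ξ, hξ, he, hb⟩ := htaylor v hv
    have := (h J hJ _ _ (hsupp ξ v) (suppOn_extend v) hb).1
    rw [norm_extend] at this
    linarith
  have h3 : ∀ v, 1 ≤ ‖v‖ → logLik ν ω J (φ + v) - logLik ν ω J φ ≤ -(l₁ * n * ‖v‖ / 2) := by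
    intro v hv
    have hv0 : 0 < ‖v‖ := by linarith
    have hunit : ‖(‖v‖⁻¹ • v : EuclideanSpace ℝ J)‖ = 1 := by
      rw [norm_smul, norm_inv, norm_norm, inv_mul_cancel₀ hv0.ne']
    have hc := hν.fullLogLik_chord ω (extend J φ) (extend J (‖v‖⁻¹ • v)) hv
    have e : ‖v‖ • extend J (‖v‖⁻¹ • v) = extend J v := by
      rw [extend_smul, smul_smul, mul_inv_cancel₀ hv0.ne', one_smul]
    rw [e, ← extend_add, ← extend_add, ← logLik_eq, ← logLik_eq, ← logLik_eq] at hc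
    have h1' := h1 (‖v‖⁻¹ • v) hunit.le
    rw [hunit] at h1'
    have := mul_le_mul_of_nonneg_left h1' hv0.le
    linarith
  refine ⟨φ, ⟨hmax, fun φ' hφ' => ?_⟩, hφR, h1, fun v hv => ?_, h3⟩
  · by_contra hne
    set v := φ' - φ with hv
    have hv0 : 0 < ‖v‖ := norm_pos_iff.2 (sub_ne_zero.2 hne)
    have hz : 0 ≤ logLik ν ω J (φ + v) - logLik ν ω J φ := by
      rw [hv, add_sub_cancel]
      exact sub_nonneg.2 (hφ' φ)
    rcases le_total ‖v‖ 1 with hle | hle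
    · have := h1 v hle
      have : 0 < l₁ * n * ‖v‖ ^ 2 / 2 := by positivity
      linarith
    · have := h3 v hle
      have : 0 < l₁ * n * ‖v‖ / 2 := by positivity
      linarith
  · obtain ⟨ξ, hξ, he, hb⟩ := htaylor v hv
    -- The score vanishes at the maximizer, so the error is half the difference of the curvatures at
    -- the intermediate point and at `φ`; the Lipschitz bound makes it cubic.
    have hlip := (h J hJ _ _ (hsupp ξ v) (suppOn_extend v) hb).2.2 (extend J φ) (suppOn_extend φ)
      (by rw [norm_extend]; linarith)
    rw [add_sub_cancel_left, norm_smul, norm_extend, Real.norm_eq_abs, abs_of_pos hξ.1] at hlip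
    rw [he, hν.dotProduct_negHessian_mulVec]
    have e : -curv ν ω (extend J φ + ξ • extend J v) (extend J v) / 2
        + curv ν ω (extend J φ) (extend J v) / 2
        = -((curv ν ω (extend J φ + ξ • extend J v) (extend J v)
          - curv ν ω (extend J φ) (extend J v)) / 2) := by ring
    rw [e, abs_neg, abs_div, abs_two]
    have hpos : 0 ≤ l₃ * n * ‖v‖ ^ 3 := by positivity
    calc _ ≤ l₃ * n * (ξ * ‖v‖) * ‖v‖ ^ 2 / 2 := by gcongr
      _ = (l₃ * n * ‖v‖ ^ 3) * (ξ / 2) := by ring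
      _ ≤ (l₃ * n * ‖v‖ ^ 3) * 1 := by
        gcongr
        linarith [hξ.2]
      _ = _ := mul_one _

end IsExpFamilyBase

end Submodel

/-! ### The Laplace approximation and the information criterion -/

section Criterion

/-- After multiplication by `d!` both sides are products, compared factor by factor through `p * (d
- i) ≤ d * (p - i)`. -/
lemma pow_le_pow_mul_choose {p d : ℕ} (hdp : d ≤ p) : p ^ d ≤ d ^ d * p.choose d := by
  have h : p ^ d * d.factorial ≤ d ^ d * p.descFactorial d := by
    rw [← Nat.descFactorial_self d, Nat.descFactorial_eq_prod_range,
      Nat.descFactorial_eq_prod_range, ← Finset.card_range d, ← Finset.prod_const,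
      ← Finset.prod_const, Finset.card_range, ← Finset.prod_mul_distrib,
      ← Finset.prod_mul_distrib]
    refine Finset.prod_le_prod' fun i hi => ?_
    obtain ⟨e, rfl⟩ := Nat.exists_eq_add_of_le (Finset.mem_range.1 hi).le
    obtain ⟨f, rfl⟩ := Nat.exists_eq_add_of_le hdp
    have h1 : i + e - i = e := by omega
    have h2 : i + e + f - i = e + f := by omega
    rw [h1, h2]
    nlinarith [Nat.zero_le (i * f)]
  rw [Nat.descFactorial_eq_factorial_mul_choose] at h
  refine Nat.le_of_mul_le_mul_right (c := d.factorial) ?_ (Nat.factorial_pos d)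
  calc _ ≤ _ := h
    _ = _ := by ring

/-- `log (p choose d)` is `d log p` up to a constant. -/
lemma mul_log_sub_log_choose_mem_Icc {p d q : ℕ} (hdp : d ≤ p) (hdq : d ≤ q) :
    d * Real.log p - Real.log (p.choose d) ∈ Set.Icc 0 (q * Real.log (2 * q)) := by
  have hc : (0 : ℝ) < p.choose d := by exact_mod_cast Nat.choose_pos hdp
  rcases Nat.eq_zero_or_pos d with rfl | hd
  · simp only [Nat.cast_zero, zero_mul, Nat.choose_zero_right, Nat.cast_one, Real.log_one, sub_zero,
      Set.mem_Icc, le_refl, true_and]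
    rcases Nat.eq_zero_or_pos q with rfl | hq
    · simp
    · have : (1 : ℝ) ≤ q := by exact_mod_cast hq
      have := Real.log_nonneg (show (1 : ℝ) ≤ 2 * q by linarith)
      positivity
  · have hd1 : (1 : ℝ) ≤ d := by exact_mod_cast hd
    have hdq' : (d : ℝ) ≤ q := by exact_mod_cast hdq
    have hp : (0 : ℝ) < p := by exact_mod_cast hd.trans_le hdp
    rw [Set.mem_Icc, sub_nonneg, sub_le_iff_le_add, ← Real.log_pow]
    constructor
    · exact Real.log_le_log hc (by exact_mod_cast Nat.choose_le_pow p d)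
    · have h1 : ((p : ℝ) ^ d) ≤ (d : ℝ) ^ d * p.choose d := by
        exact_mod_cast pow_le_pow_mul_choose hdp
      have h2 := Real.log_le_log (by positivity) h1
      rw [Real.log_mul (by positivity) hc.ne', Real.log_pow (d : ℝ)] at h2
      have h3 : d * Real.log d ≤ q * Real.log (2 * q) :=
        mul_le_mul hdq' (Real.log_le_log (by linarith) (by linarith))
          (Real.log_nonneg hd1) (by positivity)
      linarith

/-- The growing factor `√(log(np)) ≥ √(log n)` beats any constant, uniformly in `p`. This is why the
constant `C = 2` suffices for every prior. -/
lemma eventually_div_sqrt_le (K : ℝ) : ∀ᶠ n : ℕ in atTop, 1 ≤ n ∧ K / Real.sqrt n ≤ 1 / 2 ∧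
    ∀ p : ℕ, 1 ≤ p → K / Real.sqrt n ≤ 2 * Real.sqrt (Real.log (n * p) / n) := by
  have h1 : Tendsto (fun n : ℕ => Real.log n) atTop atTop :=
    Real.tendsto_log_atTop.comp tendsto_natCast_atTop_atTop
  have h2 : Tendsto (fun n : ℕ => Real.sqrt n) atTop atTop :=
    Real.tendsto_sqrt_atTop.comp tendsto_natCast_atTop_atTop
  filter_upwards [h1.eventually_ge_atTop (K ^ 2), h2.eventually_ge_atTop (2 * K),
    eventually_ge_atTop 1] with n hn1 hn2 hn
  have hn0 : (0 : ℝ) < n := by exact_mod_cast hn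
  have hs : 0 < Real.sqrt n := Real.sqrt_pos.2 hn0
  refine ⟨hn, ?_, fun p hp => ?_⟩
  · rw [div_le_iff₀ hs]
    linarith
  · have hp1 : (1 : ℝ) ≤ p := by exact_mod_cast hp
    have hlog : Real.log n ≤ Real.log (n * p) :=
      Real.log_le_log hn0 (le_mul_of_one_le_right hn0.le hp1)
    have hK : K ≤ Real.sqrt (Real.log (n * p)) := Real.le_sqrt_of_sq_le (hn1.trans hlog)
    rw [Real.sqrt_div' _ hn0.le, ← mul_div_assoc]
    gcongr
    linarith [Real.sqrt_nonneg (Real.log (n * p))]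

/-- Source of the summand `+ 1` in `C₁`: the ratios satisfy `I / G ≤ 3 / 2` and `G / I ≤ 2`, and
`log t ≤ t - 1`. -/
lemma abs_log_sub_log_le_one {I G : ℝ} (hG : 0 < G) (h : |I - G| ≤ 1 / 2 * G) :
    |Real.log I - Real.log G| ≤ 1 := by
  rw [abs_le] at h
  have hI : 0 < I := by linarith
  rw [← Real.log_div hI.ne' hG.ne', abs_le]
  have h1 : I / G ≤ 3 / 2 := by rw [div_le_iff₀ hG]; linarith
  have h2 : G / I ≤ 2 := by rw [div_le_iff₀ hI]; linarith
  constructor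
  · have := Real.log_le_sub_one_of_pos (div_pos hG hI)
    rw [← inv_div I G, Real.log_inv, inv_div] at this
    linarith
  · have := Real.log_le_sub_one_of_pos (div_pos hI hG)
    linarith

/-- The logarithm of the leading term of the Laplace approximation, compared with the
information criterion. -/
lemma abs_log_laplace_le {n d q : ℕ} (hn : 1 ≤ n) (hdq : d ≤ q) {l₁ l₂ F₁ F₂ D f : ℝ}
    (hl₁ : 0 < l₁) (hl₁' : l₁ ≤ 1) (hl₂ : 0 < l₂) (hF₂ : 0 < F₂)
    (hD : D ∈ Set.Icc ((l₁ * n) ^ d) ((l₂ * n) ^ d)) (hf : f ∈ Set.Icc F₂ F₁) :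
    |Real.log f + Real.log (D ^ (-(1 / 2) : ℝ) * (2 * Real.pi) ^ ((d : ℝ) / 2))
        + d / 2 * Real.log n|
      ≤ q / 2 * Real.log (2 * Real.pi) + q * Real.log (max l₁⁻¹ l₂)
        + Real.log (max F₁ F₂⁻¹) := by
  have hn0 : (0 : ℝ) < n := by exact_mod_cast hn
  have hD0 : 0 < D := lt_of_lt_of_le (by positivity) hD.1
  have hf0 : 0 < f := hF₂.trans_le hf.1
  have hdq' : (d : ℝ) ≤ q := by exact_mod_cast hdq
  have hd0 : (0 : ℝ) ≤ d := Nat.cast_nonneg d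
  have hpi : 0 ≤ Real.log (2 * Real.pi) := Real.log_nonneg (by linarith [Real.pi_gt_three])
  have hfu : Real.log f ≤ Real.log (max F₁ F₂⁻¹) :=
    Real.log_le_log hf0 (hf.2.trans (le_max_left _ _))
  have hfl : -Real.log f ≤ Real.log (max F₁ F₂⁻¹) := by
    rw [← Real.log_inv]
    exact Real.log_le_log (by positivity) ((inv_anti₀ hF₂ hf.1).trans (le_max_right _ _))
  set m := Real.log (max l₁⁻¹ l₂) with hm
  -- Here `l₁ ≤ 1` is needed: only for `m ≥ 0` may the dimension `d` be replaced by the larger `q`.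
  have hm0 : 0 ≤ m := Real.log_nonneg (le_max_of_le_left ((one_le_inv₀ hl₁).2 hl₁'))
  have hm1 : -Real.log l₁ ≤ m := by
    rw [← Real.log_inv]
    exact Real.log_le_log (by positivity) (le_max_left _ _)
  have hm2 : Real.log l₂ ≤ m := Real.log_le_log hl₂ (le_max_right _ _)
  have hDl := Real.log_le_log (by positivity) hD.1
  have hDu := Real.log_le_log hD0 hD.2
  rw [Real.log_pow, Real.log_mul hl₁.ne' hn0.ne'] at hDl
  rw [Real.log_pow, Real.log_mul hl₂.ne' hn0.ne'] at hDu
  rw [Real.log_mul (by positivity) (by positivity), Real.log_rpow hD0,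
    Real.log_rpow (by positivity)]
  have hdm : (d : ℝ) * m ≤ q * m := by gcongr
  have hdm0 : 0 ≤ (d : ℝ) * m := by positivity
  have hdp : (d : ℝ) * Real.log (2 * Real.pi) ≤ q * Real.log (2 * Real.pi) := by gcongr
  have hdp0 : 0 ≤ (d : ℝ) * Real.log (2 * Real.pi) := by positivity
  have h1 := mul_le_mul_of_nonneg_left hm1 hd0
  have h2 := mul_le_mul_of_nonneg_left hm2 hd0
  rw [abs_le]
  constructor <;> linarith

/-- On the event that the curvature is bounded and the likelihood is small away from a ball, the
maximum likelihood estimator exists, and the Laplace approximation and the information criterion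
approximate the posterior probability of the model. -/
theorem laplace_and_criterion {ν : Measure ℝ} (hν : IsExpFamilyBase ν) {n p q m : ℕ}
    {ω : Sample n p} (hn : 1 ≤ n) {R l₁ l₂ l₃ F₁ F₂ F₃ : ℝ} (hR : 0 ≤ R) (hl₁ : 0 < l₁)
    (hl₁' : l₁ ≤ 1) (hl₂ : 0 < l₂) (hl₃ : 0 < l₃) (hF₁ : 0 < F₁) (hF₂ : 0 < F₂) (hF₃ : 0 < F₃)
    (hω : CurvBounds ν ω m (R + 1) l₁ l₂ l₃) {J : Finset (Fin p)} (hJ : J.card ≤ m)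
    (hJq : J.card ≤ q)
    (hfar : ∀ w, SuppOn J w → R < ‖w‖ → fullLogLik ν ω w < fullLogLik ν ω 0)
    {w : ℝ} (hw : 0 ≤ w) {f : EuclideanSpace ℝ J → ℝ} (hf : IsDensity f)
    (hfb : PriorBounds f (R + 1) F₁ F₂ F₃) {ε : ℝ}
    (hε : laplaceConst l₁ l₂ l₃ F₁ F₂ F₃ J.card / Real.sqrt n ≤ ε)
    (hε' : laplaceConst l₁ l₂ l₃ F₁ F₂ F₃ J.card / Real.sqrt n ≤ 1 / 2)
    {γ : ℝ} (hγ : 0 ≤ γ) :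
    ∃ φ : EuclideanSpace ℝ J, IsMLE ν ω J φ ∧ ‖φ‖ ≤ R ∧
      Integrable (fun ψ => lik ν ω J ψ * f ψ) ∧
      bayes ν ω J w f ∈ Set.Icc (laplaceApprox ν ω J w f φ * (1 - ε))
        (laplaceApprox ν ω J w f φ * (1 + ε)) ∧
      |Real.log (bayes ν ω J (gammaPrior γ q J) f) - (-(1 / 2) * ebic ν ω J γ φ)|
        ≤ q / 2 * Real.log (2 * Real.pi) + γ * q * Real.log (2 * q)
          + q * Real.log (max l₁⁻¹ l₂) + Real.log (max F₁ F₂⁻¹) + 1 := by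
  classical
  have hn0 : (0 : ℝ) < n := by exact_mod_cast hn
  obtain ⟨φ, hmle, hφ, h1, h2, h3⟩ := hν.exists_isMLE hn hR hl₁ hl₃ hω hJ hfar
  have hφ' : ‖φ‖ ≤ R + 1 := by linarith
  have hquad : ∀ h : EuclideanSpace ℝ J,
      l₁ * n * ‖h‖ ^ 2 ≤ h.ofLp ⬝ᵥ (negHessian ν ω J φ).mulVec h.ofLp ∧
      h.ofLp ⬝ᵥ (negHessian ν ω J φ).mulVec h.ofLp ≤ l₂ * n * ‖h‖ ^ 2 := by
    intro h
    rw [hν.dotProduct_negHessian_mulVec, ← norm_extend h]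
    have := hω J hJ _ _ (suppOn_extend φ) (suppOn_extend h) (by rwa [norm_extend])
    exact ⟨this.1, this.2.1⟩
  have hH := hν.isHermitian_negHessian ω φ
  have hdet := det_mem_Icc_of_quadratic_form hH (by positivity) (fun h => (hquad h).1)
    fun h => (hquad h).2
  obtain ⟨hint, hlap⟩ := laplace_approximation hl₁ hl₂ hl₃ hF₁ hF₂ hF₃ hn
    (hν.differentiable_logLik ω).continuous.measurable hf.measurable hf.nonneg hfb hφ hH
    (fun h => (hquad h).1) (fun h => (hquad h).2) h1 h2 h3
  rw [Fintype.card_coe] at hlap hdet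
  have hfφ : f φ ∈ Set.Icc F₂ F₁ := ⟨hfb.lower φ hφ', hfb.upper φ⟩
  have hf0 : 0 < f φ := hF₂.trans_le hfφ.1
  have hdet0 : 0 < (negHessian ν ω J φ).det := lt_of_lt_of_le (by positivity) hdet.1
  set D := (negHessian ν ω J φ).det ^ (-(1 / 2) : ℝ) * (2 * Real.pi) ^ ((J.card : ℝ) / 2) with hD
  have hD0 : 0 < D := by positivity
  set G := Real.exp (logLik ν ω J φ) * f φ * D with hG
  have hG0 : 0 < G := by positivity
  set I := ∫ ψ, Real.exp (logLik ν ω J ψ) * f ψ with hI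
  have hb : ∀ w, bayes ν ω J w f = w * I := fun w => rfl
  have ha : laplaceApprox ν ω J w f φ = w * G := by
    simp only [laplaceApprox, lik, hG, hD]
    ring
  refine ⟨φ, hmle, hφ, hint, ?_, ?_⟩
  · have h := abs_le.1 (hlap.trans (mul_le_mul_of_nonneg_right hε hG0.le))
    rw [hb, ha, Set.mem_Icc, mul_assoc w G, mul_assoc w G]
    exact ⟨mul_le_mul_of_nonneg_left (by linarith [h.1]) hw,
      mul_le_mul_of_nonneg_left (by linarith [h.2]) hw⟩
  -- A relative error of at most one half keeps the integral positive, so its logarithm is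
  -- meaningful and within 1 of that of the Laplace term.
  · have hhalf := hlap.trans (mul_le_mul_of_nonneg_right hε' hG0.le)
    have hI0 : 0 < I := by
      have := (abs_le.1 hhalf).1
      linarith
    have hlogI := abs_log_sub_log_le_one hG0 hhalf
    have hlogG : Real.log G = logLik ν ω J φ + Real.log (f φ) + Real.log D := by
      rw [hG, Real.log_mul (by positivity) hD0.ne', Real.log_mul (by positivity) hf0.ne',
        Real.log_exp]
    have hcrit := abs_log_laplace_le hn hJq hl₁ hl₁' hl₂ hF₂ hdet hfφ
    rw [← hD] at hcrit
    have hJp : J.card ≤ p := by simpa using J.card_le_univ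
    have hch : (0 : ℝ) < (p.choose J.card : ℕ) := by exact_mod_cast Nat.choose_pos hJp
    have hbin := mul_log_sub_log_choose_mem_Icc hJp hJq
    have hprior : gammaPrior γ q J = ((p.choose J.card : ℕ) : ℝ) ^ (-γ) := if_pos hJq
    have hebic : -(1 / 2) * ebic ν ω J γ φ = logLik ν ω J φ - J.card / 2 * Real.log n
        - γ * (J.card * Real.log p) := by
      simp only [ebic, lik, Real.log_exp]
      ring
    rw [hb, hprior, Real.log_mul (by positivity) hI0.ne', Real.log_rpow hch, hebic]
    have hb1 := mul_le_mul_of_nonneg_left hbin.1 hγ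
    have hb2 := mul_le_mul_of_nonneg_left hbin.2 hγ
    rw [hlogG] at hlogI
    rw [abs_le] at hlogI hcrit ⊢
    constructor <;> linarith

end Criterion

end SparseGLM

end

theorem mainTheorem1
    (ν : MeasureTheory.Measure ℝ) (hν : SparseGLM.IsExpFamilyBase ν)
    (q : ℕ) (a₁ a₂ a₃ : ℝ) (ha₁ : 0 < a₁) (ha₂ : 0 < a₂) (ha₃ : 0 < a₃)
    (cond : SparseGLM.CovCondition) :
    ∃ R lam₁ lam₂ lam₃ : ℝ, 0 < R ∧ 0 < lam₁ ∧ 0 < lam₂ ∧ 0 < lam₃ ∧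
    ∀ F₁ F₂ F₃ : ℝ, 0 < F₁ → 0 < F₂ → 0 < F₃ →
    ∃ C : ℝ,
      C ≤ 4 * F₃ * F₂⁻¹ * lam₁ ^ (-(1 / 2) : ℝ) + 2 * q * lam₃ * lam₁ ^ (-(3 / 2) : ℝ) + 2 ∧
    ∀ γ : ℝ, 0 ≤ γ →
    ∃ C₁ : ℝ,
      C₁ ≤ (q : ℝ) / 2 * Real.log (2 * Real.pi) + γ * q * Real.log (2 * q)
        + q * Real.log (max lam₁⁻¹ lam₂) + Real.log (max F₁ F₂⁻¹) + 1 ∧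
    ∀ S : SparseGLM.Scenario, S.BaseAssumptions q a₁ a₂ a₃ → cond.Holds ν S →
    ∀ P : ∀ n, Finset (Fin (S.p n)) → ℝ, (∀ n J, 0 ≤ P n J) →
    ∀ f : ∀ n, ∀ J : Finset (Fin (S.p n)), EuclideanSpace ℝ J → ℝ,
    (∀ n J, J.card ≤ q →
      SparseGLM.IsDensity (f n J) ∧ SparseGLM.PriorBounds (f n J) (R + 1) F₁ F₂ F₃) →
    ∀ᶠ n : ℕ in Filter.atTop,
      SparseGLM.ProbAtLeast (SparseGLM.sampleLaw ν n (S.covLaw n) (S.φstar n))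
        (1 - cond.failProb S n)
        {ω | SparseGLM.HessianBounds ν ω (2 * q) (R + 1) lam₁ lam₂ lam₃ ∧
          ∀ J : Finset (Fin (S.p n)), J.card ≤ q →
            ∃ φhat : EuclideanSpace ℝ J,
              SparseGLM.IsMLE ν ω J φhat ∧ ‖φhat‖ ≤ R ∧
              MeasureTheory.Integrable (fun φ => SparseGLM.lik ν ω J φ * f n J φ) ∧
              SparseGLM.bayes ν ω J (P n J) (f n J) ∈ Set.Icc
                (SparseGLM.laplaceApprox ν ω J (P n J) (f n J) φhat
                  * (1 - C * Real.sqrt (Real.log (n * S.p n) / n)))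
                (SparseGLM.laplaceApprox ν ω J (P n J) (f n J) φhat
                  * (1 + C * Real.sqrt (Real.log (n * S.p n) / n))) ∧
              |Real.log (SparseGLM.bayes ν ω J (SparseGLM.gammaPrior γ q J) (f n J))
                - (-(1 / 2) * SparseGLM.ebic ν ω J γ φhat)| ≤ C₁} := by
  obtain ⟨R, lam₁, lam₂, lam₃, hR, hl₁, hl₁', hl₂, hl₃, hev⟩ :=
    SparseGLM.exists_event_constants (a₂ := a₂) hν q ha₁ ha₃ cond
  refine ⟨R, lam₁, lam₂, lam₃, hR, hl₁, hl₂, hl₃, fun F₁ F₂ F₃ hF₁ hF₂ hF₃ => ⟨2, ?_, ?_⟩⟩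
  · have : 0 ≤ 4 * F₃ * F₂⁻¹ * lam₁ ^ (-(1 / 2) : ℝ)
        + 2 * q * lam₃ * lam₁ ^ (-(3 / 2) : ℝ) := by positivity
    linarith
  refine fun γ hγ => ⟨_, le_rfl, fun S hS hcond P hP f hf => ?_⟩
  -- A sum over all admissible dimensions bounds every Laplace constant at once, so one threshold
  -- for `n` serves all models.
  set K := ∑ d ∈ Finset.range (q + 1), SparseGLM.laplaceConst lam₁ lam₂ lam₃ F₁ F₂ F₃ d with hK
  have hKd : ∀ d ≤ q, SparseGLM.laplaceConst lam₁ lam₂ lam₃ F₁ F₂ F₃ d ≤ K := fun d hd =>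
    Finset.single_le_sum
      (fun d _ => SparseGLM.laplaceConst_nonneg hl₁ hl₂ hl₃ hF₁ hF₂ hF₃ d)
      (Finset.mem_range.2 (Nat.lt_succ_of_le hd))
  filter_upwards [hev S hS hcond, SparseGLM.eventually_div_sqrt_le K]
    with n ⟨E, hE, hEsub, hEprob⟩ ⟨hn, hhalf, hsqrt⟩
  refine ⟨E, hE, fun ω hω => ?_, hEprob⟩
  obtain ⟨hcurv, hfar⟩ := hEsub hω
  refine ⟨hν.hessianBounds_of_curvBounds hn hcurv, fun J hJ => ?_⟩
  have hle := div_le_div_of_nonneg_right (hKd _ hJ) (Real.sqrt_nonneg n)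
  exact SparseGLM.laplace_and_criterion hν hn hR.le hl₁ hl₁' hl₂ hl₃ hF₁ hF₂ hF₃ hcurv
    (by omega) hJ (hfar J hJ) (hP n J) (hf n J hJ).1 (hf n J hJ).2
    (hle.trans (hsqrt (S.p n) (S.p_pos n))) (hle.trans hhalf) hγ
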